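/- Let $\hbar>0$. Let $TS^3=\{(x,y)\in\mathbb R^4\times\mathbb R^4: |x|^2=1,\ x\cdot y=0\}$ with the symplectic form $\omega_3$ obtained by restricting $\omega_4=\sum_{j=1}^4 dx_j\wedge dy_j$, and let $K(x,y)=\frac12|y|^2$ be the energy of a free particle. Let $V_n=\mathbb R^{2n}$ be the standard symplectic space with symplectic basis $v_1,\dots,v_n,w_1,\dots,w_n$, let $\mathrm{Mp}^c(V_n)=\mathrm{Mp}(V_n)\times_{\mathbb Z_2}U(1)$ be the metaplectic-c group, with projection $\sigma:\mathrm{Mp}^c(V_n)\to\mathrm{Sp}(V_n)$ and determinant map $\eta:\mathrm{Mp}^c(V_n)\to U(1)$ (the homomorphism with kernel $\mathrm{Mp}(V_n)$ and $\eta(u)=u^2$ on $U(1)$). With $W_n=\mathrm{span}\{v_1,\dots,v_n,w_1,\dots,w_{n-1}\}$, so that $W_n/W_n^\perp\cong V_{n-1}$, let $\nu:\mathrm{Sp}(V_n;W_n)\to\mathrm{Sp}(V_{n-1})$ be the homomorphism induced on the symplectic maps that preserve $W_n$, and let $\hat\nu:\mathrm{Mp}^c(V_n;W_n)=\sigma^{-1}(\mathrm{Sp}(V_n;W_n))\to\mathrm{Mp}^c(V_{n-1})$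 be its lift, with $\eta_*\circ\hat\nu_*=\eta_*$. Let $(Q,\Gamma,\delta)$ be the metaplectic-c prequantization of $(TS^3,\omega_3)$ induced from the trivial one on $Z=\mathbb R^4\times\mathbb R^4$: start with $Q_4=Z\times\mathrm{Mp}^c(V_4)$, with the Cartesian frames and the one-form $\delta_4=\frac1{i\hbar}\beta_4+\frac12\eta_*\vartheta_0$, where $\beta_4=-\sum_j y_j\,dx_j$ and $\vartheta_0$ is the trivial connection; restrict it to the frames over $A=\{|x|^2=1\}$ that map $W_4$ onto $TA$; pass to the bundle associated by $\hat\nu$, with the induced one-form; and restrict to $TS^3\subset A$, where $TA/TA^\perp$ is identified with the tangent spaces of $TS^3$ by the differential of $(x,y)\mapsto(x,y-(x\cdot y)x)$. For a regular value $\mathcal E$ of $K$ put $S=K^{-1}(\mathcal E)\subset TS^3$, and let $TS^\perp\subset TS$ be the line bundle of vectors that are $\omega_3$-orthogonal to $TS$. Restricting $Q$ to the frames over $S$ that map $W_3$ onto $TS$ and passing to the bundle associated by $\hat\nu$ gives a principal $\mathrm{Mp}^c(V_2)$ bundle $Q_S$ over $S$, which is a circle bundle with connection one-form $\delta_S$ over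 the symplectic frame bundle $\mathrm{Sp}(TS/TS^\perp)$. The flow $\psi^t$ of the Hamiltonian vector field $\xi_K$ (where $\omega_3(\xi_K,\cdot)=dK$) induces a flow $\widetilde\psi^t$ on $\mathrm{Sp}(TS/TS^\perp)$. The regular value $\mathcal E$ is called a quantized energy level of $(TS^3,\omega_3,K)$ if $\delta_S$ has trivial holonomy over every closed orbit of $\widetilde\psi^t$. Then the positive quantized energy levels of $(TS^3,\omega_3,K)$ are exactly $$\mathcal E_n=\tfrac12 n^2\hbar^2,\qquad n=1,2,3,\dots$$ Moreover, for every $\mathcal E>0$, with $\lambda=\sqrt{2\mathcal E}$ and $S=K^{-1}(\mathcal E)$, every orbit of $\widetilde\psi^t$ on $\mathrm{Sp}(TS/TS^\perp)$ closes up after time $T=2\pi/\lambda$, and every horizontal lift $q(t)$ of such an orbit to $Q_S$ satisfies $q(T)=q(0)\cdot e^{\lambda^2T/i\hbar}$, where $e^{\lambda^2T/i\hbar}\in U(1)\subset\mathrm{Mp}^c(V_2)$. -/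

import Mathlib

open Matrix
open scoped ComplexOrder ContDiff

noncomputable section

namespace MpcQuant

/-- The symplectic group of the model space `V n` (real `2n × 2n` symplectic matrices). -/
abbrev Sp (n : ℕ) : Type := Matrix.symplecticGroup (Fin n) ℝ

/-- Siegel upper half space: symmetric complex `τ` whose imaginary part `(τ - τᴴ) / 2i` is
positive definite. -/
def siegelSet (n : ℕ) : Set (Matrix (Fin n) (Fin n) ℂ) :=
  {τ | τᵀ = τ ∧ ((2 * Complex.I)⁻¹ • (τ - τᴴ)).PosDef}

abbrev Siegel (n : ℕ) : Type := siegelSet n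

/-- A real symplectic matrix regarded as a complex matrix. -/
def cplx {n : ℕ} (g : Sp n) : Matrix (Fin n ⊕ Fin n) (Fin n ⊕ Fin n) ℂ :=
  g.1.map (fun r : ℝ => (r : ℂ))

/-- For `g = (a, b; c, d)` in blocks, the numerator `a τ + b`. -/
def num {n : ℕ} (g : Sp n) (τ : Matrix (Fin n) (Fin n) ℂ) : Matrix (Fin n) (Fin n) ℂ :=
  (cplx g).toBlocks₁₁ * τ + (cplx g).toBlocks₁₂

/-- For `g = (a, b; c, d)` in blocks, the denominator `c τ + d`. -/
def den {n : ℕ} (g : Sp n) (τ : Matrix (Fin n) (Fin n) ℂ) : Matrix (Fin n) (Fin n) ℂ :=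
  (cplx g).toBlocks₂₁ * τ + (cplx g).toBlocks₂₂

variable {n : ℕ}

lemma cplx_mul (g h : Sp n) : cplx (g * h) = cplx g * cplx h := by
  have := Matrix.map_mul (L := g.1) (M := h.1) (f := Complex.ofRealHom)
  exact this

lemma cplx_one : cplx (1 : Sp n) = 1 := by
  ext i j
  by_cases h : i = j <;> simp [cplx, Matrix.one_apply, h]

lemma cplx_blocks (g : Sp n) : cplx g = fromBlocks (cplx g).toBlocks₁₁ (cplx g).toBlocks₁₂
    (cplx g).toBlocks₂₁ (cplx g).toBlocks₂₂ := (fromBlocks_toBlocks _).symm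

lemma num_mul_rel (g h : Sp n) (τ τ' : Matrix (Fin n) (Fin n) ℂ)
    (hτ : num h τ = τ' * den h τ) :
    num (g * h) τ = num g τ' * den h τ ∧ den (g * h) τ = den g τ' * den h τ := by
  have e : cplx (g * h) = _ := cplx_mul g h
  rw [cplx_blocks g, cplx_blocks h, fromBlocks_multiply] at e
  have h1 : num (g * h) τ = (cplx g).toBlocks₁₁ * num h τ + (cplx g).toBlocks₁₂ * den h τ := by
    simp only [num, den, e, toBlocks_fromBlocks₁₁, toBlocks_fromBlocks₁₂]
    noncomm_ring
  have h2 : den (g * h) τ = (cplx g).toBlocks₂₁ * num h τ + (cplx g).toBlocks₂₂ * den h τ := by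
    simp only [num, den, e, toBlocks_fromBlocks₂₁, toBlocks_fromBlocks₂₂]
    noncomm_ring
  rw [h1, h2, hτ]
  constructor
  · rw [show num g τ' = (cplx g).toBlocks₁₁ * τ' + (cplx g).toBlocks₁₂ from rfl, Matrix.add_mul,
      Matrix.mul_assoc]
  · rw [show den g τ' = (cplx g).toBlocks₂₁ * τ' + (cplx g).toBlocks₂₂ from rfl, Matrix.add_mul,
      Matrix.mul_assoc]

lemma num_den_one (τ : Matrix (Fin n) (Fin n) ℂ) :
    num (1 : Sp n) τ = τ ∧ den (1 : Sp n) τ = 1 := by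
  constructor
  · rw [num, cplx_one, ← fromBlocks_one, toBlocks_fromBlocks₁₁, toBlocks_fromBlocks₁₂]; simp
  · rw [den, cplx_one, ← fromBlocks_one, toBlocks_fromBlocks₂₁, toBlocks_fromBlocks₂₂]; simp

lemma cplx_rel (g : Sp n) :
    (cplx g).toBlocks₁₁ᵀ * (cplx g).toBlocks₂₁ = (cplx g).toBlocks₂₁ᵀ * (cplx g).toBlocks₁₁ ∧
    (cplx g).toBlocks₁₂ᵀ * (cplx g).toBlocks₂₂ = (cplx g).toBlocks₂₂ᵀ * (cplx g).toBlocks₁₂ ∧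
    (cplx g).toBlocks₁₁ᵀ * (cplx g).toBlocks₂₂ - (cplx g).toBlocks₂₁ᵀ * (cplx g).toBlocks₁₂
      = 1 := by
  have h := SymplecticGroup.map_mem g.2 Complex.ofRealHom
  have h' : cplx g ∈ symplecticGroup (Fin n) ℂ := h
  rw [cplx_blocks g] at h'
  exact SymplecticGroup.fromBlocks_mem_iff.1 h'

lemma block_conj (g : Sp n) :
    (cplx g).toBlocks₁₁ᴴ = (cplx g).toBlocks₁₁ᵀ ∧ (cplx g).toBlocks₁₂ᴴ = (cplx g).toBlocks₁₂ᵀ ∧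
    (cplx g).toBlocks₂₁ᴴ = (cplx g).toBlocks₂₁ᵀ ∧ (cplx g).toBlocks₂₂ᴴ = (cplx g).toBlocks₂₂ᵀ := by
  refine ⟨?_, ?_, ?_, ?_⟩ <;> ext i j <;>
    simp [cplx, toBlocks₁₁, toBlocks₁₂, toBlocks₂₁, toBlocks₂₂]

lemma aux_rel {m : Type*} [Fintype m] [DecidableEq m] {a b c d τ σ : Matrix m m ℂ}
    (h1 : aᵀ * c = cᵀ * a) (h2 : bᵀ * d = dᵀ * b) (h3 : aᵀ * d - cᵀ * b = 1) :
    (σ * aᵀ + bᵀ) * (c * τ + d) - (σ * cᵀ + dᵀ) * (a * τ + b) = σ - τ := by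
  have h4 : dᵀ * a - bᵀ * c = 1 := by simpa using congrArg transpose h3
  have e : (σ * aᵀ + bᵀ) * (c * τ + d) - (σ * cᵀ + dᵀ) * (a * τ + b)
      = σ * (aᵀ * c - cᵀ * a) * τ + σ * (aᵀ * d - cᵀ * b) - (dᵀ * a - bᵀ * c) * τ
        + (bᵀ * d - dᵀ * b) := by noncomm_ring
  rw [e, h1, h2, h3, h4]
  simp

lemma symm_rel (g : Sp n) {τ : Matrix (Fin n) (Fin n) ℂ} (hτ : τᵀ = τ) :
    (num g τ)ᵀ * den g τ = (den g τ)ᵀ * num g τ := by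
  obtain ⟨h1, h2, h3⟩ := cplx_rel g
  have := aux_rel (τ := τ) (σ := τ) h1 h2 h3
  rw [sub_self] at this
  simp only [num, den, transpose_add, transpose_mul, hτ]
  exact sub_eq_zero.1 this

lemma herm_rel (g : Sp n) (τ : Matrix (Fin n) (Fin n) ℂ) :
    (den g τ)ᴴ * num g τ - (num g τ)ᴴ * den g τ = τ - τᴴ := by
  obtain ⟨h1, h2, h3⟩ := cplx_rel g
  obtain ⟨k1, k2, k3, k4⟩ := block_conj g
  have := aux_rel (τ := τ) (σ := τᴴ) h1 h2 h3
  simp only [num, den, conjTranspose_add, conjTranspose_mul, k1, k2, k3, k4]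
  rw [← neg_sub, this, neg_sub]

lemma det_den_ne_zero (g : Sp n) (τ : Siegel n) : (den g τ.1).det ≠ 0 := by
  intro h0
  obtain ⟨v, hv, hv0⟩ := Matrix.exists_mulVec_eq_zero_iff.2 h0
  have hpos := τ.2.2.dotProduct_mulVec_pos hv
  have hz : star v ⬝ᵥ (((2 * Complex.I)⁻¹ • (τ.1 - τ.1ᴴ)) *ᵥ v) = 0 := by
    rw [← herm_rel g τ.1, Matrix.smul_mulVec, Matrix.sub_mulVec, ← Matrix.mulVec_mulVec,
      ← Matrix.mulVec_mulVec, hv0, Matrix.mulVec_zero, sub_zero, dotProduct_smul,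
      Matrix.dotProduct_mulVec, ← Matrix.star_mulVec, hv0]
    simp
  rw [hz] at hpos
  exact lt_irrefl _ hpos

lemma smul_mem (g : Sp n) (τ : Siegel n) : num g τ.1 * (den g τ.1)⁻¹ ∈ siegelSet n := by
  have hD : IsUnit (den g τ.1).det := (det_den_ne_zero g τ).isUnit
  have hDT : IsUnit (den g τ.1)ᵀ.det := by rwa [Matrix.det_transpose]
  have hDH : IsUnit (den g τ.1)ᴴ.det := by
    rw [Matrix.det_conjTranspose]; exact hD.star
  set N := num g τ.1
  set D := den g τ.1
  constructor
  · have h : Nᵀ * D = Dᵀ * N := symm_rel g τ.2.1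
    rw [Matrix.transpose_mul, Matrix.transpose_nonsing_inv]
    calc Dᵀ⁻¹ * Nᵀ = Dᵀ⁻¹ * (Nᵀ * D) * D⁻¹ := by
          rw [Matrix.mul_assoc, Matrix.mul_assoc, Matrix.mul_nonsing_inv _ hD, Matrix.mul_one]
      _ = N * D⁻¹ := by
          rw [h, ← Matrix.mul_assoc, Matrix.nonsing_inv_mul _ hDT, Matrix.one_mul]
  · have h : Dᴴ * N - Nᴴ * D = τ.1 - τ.1ᴴ := herm_rel g τ.1
    have e : (2 * Complex.I)⁻¹ • (N * D⁻¹ - (N * D⁻¹)ᴴ)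
        = (D⁻¹)ᴴ * ((2 * Complex.I)⁻¹ • (τ.1 - τ.1ᴴ)) * D⁻¹ := by
      rw [← h, Matrix.mul_smul, Matrix.smul_mul, Matrix.conjTranspose_mul, Matrix.mul_sub,
        Matrix.sub_mul, Matrix.conjTranspose_nonsing_inv, ← Matrix.mul_assoc,
        Matrix.nonsing_inv_mul _ hDH, Matrix.one_mul, Matrix.mul_assoc, Matrix.mul_assoc,
        Matrix.mul_nonsing_inv _ hD, Matrix.mul_one]
    rw [e]
    refine τ.2.2.conjTranspose_mul_mul_same ?_
    exact Matrix.mulVec_injective_of_isUnit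
      ((Matrix.isUnit_nonsing_inv_iff).2 ((Matrix.isUnit_iff_isUnit_det _).2 hD))

/-- The action `g • τ = (a τ + b) (c τ + d)⁻¹`. -/
instance : MulAction (Sp n) (Siegel n) where
  smul g τ := ⟨num g τ.1 * (den g τ.1)⁻¹, smul_mem g τ⟩
  one_smul τ := by
    apply Subtype.ext
    change num 1 τ.1 * (den 1 τ.1)⁻¹ = τ.1
    rw [(num_den_one τ.1).1, (num_den_one τ.1).2]; simp
  mul_smul g h τ := by
    apply Subtype.ext
    change num (g * h) τ.1 * (den (g * h) τ.1)⁻¹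
      = num g (num h τ.1 * (den h τ.1)⁻¹) * (den g (num h τ.1 * (den h τ.1)⁻¹))⁻¹
    have hD : IsUnit (den h τ.1).det := (det_den_ne_zero h τ).isUnit
    obtain ⟨e1, e2⟩ := num_mul_rel g h τ.1 (num h τ.1 * (den h τ.1)⁻¹)
      (by rw [Matrix.mul_assoc, Matrix.nonsing_inv_mul _ hD, Matrix.mul_one])
    rw [e1, e2, Matrix.mul_inv_rev, Matrix.mul_assoc, ← Matrix.mul_assoc (den h τ.1),
      Matrix.mul_nonsing_inv _ hD, Matrix.one_mul]

lemma coe_smul (g : Sp n) (τ : Siegel n) :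
    ((g • τ : Siegel n) : Matrix (Fin n) (Fin n) ℂ) = num g τ.1 * (den g τ.1)⁻¹ := rfl

lemma continuous_smul (g : Sp n) : Continuous (fun τ : Siegel n => g • τ) := by
  apply Continuous.subtype_mk
  have hN : Continuous (fun τ : Siegel n => num g τ.1) := by
    unfold num; fun_prop
  have hD : Continuous (fun τ : Siegel n => den g τ.1) := by
    unfold den; fun_prop
  have hI : Continuous (fun τ : Siegel n => (den g τ.1)⁻¹) := by
    simp only [Matrix.inv_def, Ring.inverse_eq_inv']
    exact (hD.matrix_det.inv₀ (det_den_ne_zero g)).smul hD.matrix_adjugate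
  exact hN.matrix_mul hI

lemma det_den_mul (g h : Sp n) (τ : Siegel n) :
    (den (g * h) τ.1).det = (den g (h • τ : Siegel n).1).det * (den h τ.1).det := by
  have hD : IsUnit (den h τ.1).det := (det_den_ne_zero h τ).isUnit
  rw [(num_mul_rel g h τ.1 (h • τ : Siegel n).1
    (by rw [coe_smul, Matrix.mul_assoc, Matrix.nonsing_inv_mul _ hD, Matrix.mul_one])).2,
    Matrix.det_mul]

lemma det_den_one (τ : Siegel n) : (den (1 : Sp n) τ.1).det = 1 := by
  rw [(num_den_one τ.1).2, Matrix.det_one]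

/-- The metaplectic-c group `Mpᶜ(V n) = Mp(V n) ×_{ℤ/2} U(1)`. An element is a symplectic matrix `g`
together with a continuous function `φ` on the Siegel upper half space and a unit complex number `η`
such that `φ(τ)² = η det (c τ + d)`; the product is `(g₁, φ₁) (g₂, φ₂) = (g₁ g₂, φ₁(g₂ τ) φ₂(τ))`.
The elements with `η = 1` (a choice of continuous square root of `det (c τ + d)`) form the
metaplectic group `Mp(V n)`. The projection map `σ` is `g`, the determinant map is `η` (it is
determined by `g` and `φ`), and `U(1)` sits inside as the constant functions `φ = u` over `g = 1`,
so that `η(u) = u²`. -/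
@[ext]
structure Mpc (n : ℕ) where
  g : Sp n
  φ : Siegel n → ℂ
  η : Circle
  cont : Continuous φ
  sq : ∀ τ : Siegel n, φ τ ^ 2 = (η : ℂ) * (den g τ.1).det

lemma Mpc.ne_zero (a : Mpc n) (τ : Siegel n) : a.φ τ ≠ 0 := by
  intro h
  have := a.sq τ
  rw [h, zero_pow two_ne_zero] at this
  exact mul_ne_zero (Circle.coe_ne_zero a.η) (det_den_ne_zero a.g τ) this.symm

instance : Group (Mpc n) where
  mul a b := ⟨a.g * b.g, fun τ => a.φ (b.g • τ) * b.φ τ, a.η * b.η,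
    (a.cont.comp (continuous_smul b.g)).mul b.cont, fun τ => by
      rw [mul_pow, a.sq, b.sq, det_den_mul, Circle.coe_mul]; ring⟩
  one := ⟨1, fun _ => 1, 1, continuous_const, fun τ => by rw [det_den_one]; simp⟩
  inv a := ⟨a.g⁻¹, fun τ => (a.φ (a.g⁻¹ • τ))⁻¹, a.η⁻¹,
    (a.cont.comp (continuous_smul a.g⁻¹)).inv₀ (fun τ => a.ne_zero _), fun τ => by
      have h := det_den_mul a.g a.g⁻¹ τ
      rw [mul_inv_cancel, det_den_one] at h
      have h1 := det_den_ne_zero a.g (a.g⁻¹ • τ)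
      rw [inv_pow, a.sq, mul_inv, Circle.coe_inv, eq_inv_of_mul_eq_one_right h.symm]⟩
  mul_assoc a b c := by
    refine Mpc.ext (mul_assoc _ _ _) (funext fun τ => ?_) (mul_assoc _ _ _)
    change a.φ (b.g • c.g • τ) * b.φ (c.g • τ) * c.φ τ
      = a.φ ((b.g * c.g) • τ) * (b.φ (c.g • τ) * c.φ τ)
    rw [mul_smul, mul_assoc]
  one_mul a := by
    refine Mpc.ext (one_mul _) (funext fun τ => ?_) (one_mul _)
    change 1 * a.φ τ = a.φ τ
    rw [one_mul]
  mul_one a := by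
    refine Mpc.ext (mul_one _) (funext fun τ => ?_) (mul_one _)
    change a.φ ((1 : Sp n) • τ) * 1 = a.φ τ
    rw [one_smul, mul_one]
  inv_mul_cancel a := by
    refine Mpc.ext (inv_mul_cancel _) (funext fun τ => ?_) (inv_mul_cancel _)
    change (a.φ (a.g⁻¹ • a.g • τ))⁻¹ * a.φ τ = 1
    rw [inv_smul_smul, inv_mul_cancel₀ (a.ne_zero τ)]


/-- The model symplectic space `V n`: coordinates `Sum.inl j` along `v_j`, `Sum.inr j` along `w_j`. -/
abbrev V (n : ℕ) : Type := Fin n ⊕ Fin n → ℝ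

/-- The symplectic form `∑ v_j^* ∧ w_j^*`. -/
def Ω (u v : V n) : ℝ := ∑ j, (u (Sum.inl j) * v (Sum.inr j) - u (Sum.inr j) * v (Sum.inl j))

/-- The linear map of a symplectic matrix. -/
def toLin (g : Sp n) : V n →ₗ[ℝ] V n := Matrix.mulVecLin g.1

/-- The model subspace `W = span {v_1, …, v_{n+1}, w_1, …, w_n}` of `V (n+1)`. -/
def W (n : ℕ) : Submodule ℝ (V (n + 1)) :=
  LinearMap.ker (LinearMap.proj (Sum.inr (Fin.last n)) : V (n + 1) →ₗ[ℝ] ℝ)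

/-- The inclusion of `V n` in `W ⊂ V (n+1)` on the first `n` pairs of basis vectors; composed with
`W → W/W^⊥` it is the identification of `V n` with `W/W^⊥`. -/
def incl (n : ℕ) : V n →ₗ[ℝ] V (n + 1) where
  toFun v := Sum.elim (Fin.snoc (fun j => v (Sum.inl j)) 0) (Fin.snoc (fun j => v (Sum.inr j)) 0)
  map_add' u v := by
    ext i
    rcases i with i | i <;> induction i using Fin.lastCases <;> simp
  map_smul' r v := by
    ext i
    rcases i with i | i <;> induction i using Fin.lastCases <;> simp

lemma incl_apply (u : V n) : (∀ i, incl n u (Sum.inl (Fin.castSucc i)) = u (Sum.inl i)) ∧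
    (∀ i, incl n u (Sum.inr (Fin.castSucc i)) = u (Sum.inr i)) ∧
    incl n u (Sum.inl (Fin.last n)) = 0 ∧ incl n u (Sum.inr (Fin.last n)) = 0 := by
  simp [incl]

/-- The basis vector `v_{n+1}`, which spans `W^⊥`. -/
def nullVec (n : ℕ) : V (n + 1) := Pi.single (Sum.inl (Fin.last n)) 1

/-- The indices of the first `n` pairs of basis vectors. -/
def cut (n : ℕ) : Fin n ⊕ Fin n → Fin (n + 1) ⊕ Fin (n + 1) := Sum.map Fin.castSucc Fin.castSucc

/-- `Sp(V; W)`: the symplectic matrices that preserve `W`. -/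
def spW (n : ℕ) : Set (Sp (n + 1)) := {g | ∀ u ∈ W n, toLin g u ∈ W n}

lemma Ω_eq (u v : V n) : Ω u v = - (u ⬝ᵥ (Matrix.J (Fin n) ℝ *ᵥ v)) := by
  simp [Ω, Matrix.J, dotProduct, Matrix.fromBlocks_mulVec, Fintype.sum_sum_type,
    Finset.sum_add_distrib, sub_eq_add_neg, Matrix.neg_mulVec, add_comm]

lemma Ω_toLin (g : Sp n) (u v : V n) : Ω (toLin g u) (toLin g v) = Ω u v := by
  have h := SymplecticGroup.mem_iff'.1 g.2
  rw [Ω_eq, Ω_eq]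
  simp only [toLin, Matrix.mulVecLin_apply]
  rw [Matrix.mulVec_mulVec, Matrix.dotProduct_mulVec, ← Matrix.vecMul_transpose,
    Matrix.vecMul_vecMul, ← Matrix.mul_assoc, h, ← Matrix.dotProduct_mulVec]

lemma J_conj_apply {m : ℕ} (M : Matrix (Fin n ⊕ Fin n) (Fin m ⊕ Fin m) ℝ) (i j) :
    (M * Matrix.J (Fin m) ℝ * Mᵀ) i j =
      ∑ k, (M i (Sum.inr k) * M j (Sum.inl k) - M i (Sum.inl k) * M j (Sum.inr k)) := by
  simp only [Matrix.mul_apply, Matrix.J, Fintype.sum_sum_type, Matrix.transpose_apply,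
    Matrix.fromBlocks_apply₁₁, Matrix.fromBlocks_apply₁₂, Matrix.fromBlocks_apply₂₁,
    Matrix.fromBlocks_apply₂₂, Matrix.zero_apply, Matrix.neg_apply, Matrix.one_apply]
  simp [Finset.sum_add_distrib, sub_eq_add_neg]

lemma row_last {g : Sp (n + 1)} (hg : g ∈ spW n) (j) (hj : j ≠ Sum.inr (Fin.last n)) :
    g.1 (Sum.inr (Fin.last n)) j = 0 := by
  have h := hg (Pi.single j 1) (by simp [W, hj.symm])
  simpa [W, toLin] using h

lemma col_last {g : Sp (n + 1)} (hg : g ∈ spW n) (i) :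
    g.1 i (Sum.inl (Fin.last n)) * g.1 (Sum.inr (Fin.last n)) (Sum.inr (Fin.last n)) =
      if i = Sum.inl (Fin.last n) then 1 else 0 := by
  have h := congrFun (congrFun (SymplecticGroup.mem_iff.1 g.2) i) (Sum.inr (Fin.last n))
  rw [J_conj_apply, Fin.sum_univ_castSucc] at h
  simp only [row_last hg _ (by simp : Sum.inl _ ≠ _), mul_zero, zero_sub] at h
  rw [Finset.sum_eq_zero (fun k _ => by
    rw [row_last hg _ (by simp [Fin.castSucc_ne_last])]; simp)] at h
  rcases i with i | i
  · by_cases hi : i = Fin.last n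
    · subst hi; simp [Matrix.J] at h ⊢; linarith
    · simp [Matrix.J, hi] at h ⊢; exact h
  · simp [Matrix.J] at h ⊢; exact h

lemma corner_ne_zero {g : Sp (n + 1)} (hg : g ∈ spW n) :
    g.1 (Sum.inr (Fin.last n)) (Sum.inr (Fin.last n)) ≠ 0 := by
  intro h
  have := col_last hg (Sum.inl (Fin.last n))
  simp [h] at this

lemma col_last_zero {g : Sp (n + 1)} (hg : g ∈ spW n) (i) (hi : i ≠ Sum.inl (Fin.last n)) :
    g.1 i (Sum.inl (Fin.last n)) = 0 := by
  have h := col_last hg i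
  rw [if_neg hi] at h
  exact (mul_eq_zero.1 h).resolve_right (corner_ne_zero hg)

lemma cut_ne_inl (i : Fin n ⊕ Fin n) : cut n i ≠ Sum.inl (Fin.last n) := by
  rcases i with i | i <;> simp [cut, Fin.castSucc_ne_last]

/-- `ν : Sp(V; W) → Sp(W/W^⊥) = Sp(V n)`, the induced map on `W/W^⊥`. -/
def nu (g : spW n) : Sp n :=
  ⟨g.1.1.submatrix (cut n) (cut n), by
    rw [SymplecticGroup.mem_iff]
    ext i j
    have h := congrFun (congrFun (SymplecticGroup.mem_iff.1 g.1.2) (cut n i)) (cut n j)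
    rw [J_conj_apply, Fin.sum_univ_castSucc, col_last_zero g.2 _ (cut_ne_inl i),
      col_last_zero g.2 _ (cut_ne_inl j)] at h
    rw [J_conj_apply]
    have h2 : Matrix.J (Fin (n + 1)) ℝ (cut n i) (cut n j) = Matrix.J (Fin n) ℝ i j := by
      rcases i with i | i <;> rcases j with j | j <;>
        simp [cut, Matrix.J, Matrix.one_apply]
    rw [h2] at h
    simpa [cut] using h⟩

lemma toLin_incl (g : spW n) (u : V n) : ∃ s : ℝ,
    toLin g.1 (incl n u) = incl n (toLin (nu g) u) + s • nullVec n := by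
  refine ⟨toLin g.1 (incl n u) (Sum.inl (Fin.last n)), ?_⟩
  ext i
  have key : ∀ i, toLin g.1 (incl n u) (cut n i) = toLin (nu g) u i := by
    intro i
    simp [toLin, nu, Matrix.mulVec, dotProduct, Fintype.sum_sum_type, Fin.sum_univ_castSucc, incl,
      cut]
  rcases i with i | i
  · induction i using Fin.lastCases with
    | last => simp [incl, nullVec]
    | cast i =>
      have := key (Sum.inl i)
      simp only [cut, Sum.map_inl] at this
      simp [this, (incl_apply _).1, nullVec, Fin.castSucc_ne_last]
  · induction i using Fin.lastCases with
    | last =>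
      have : toLin g.1 (incl n u) ∈ W n := g.2 _ (by simp [W, incl])
      simpa [W, incl, nullVec] using this
    | cast i =>
      have := key (Sum.inr i)
      simp only [cut, Sum.map_inr] at this
      simp [this, (incl_apply _).2.1, nullVec]

lemma incl_mem_W (u : V n) : incl n u ∈ W n := by simp [W, incl]

lemma nullVec_mem_W : nullVec n ∈ W n := by simp [W, nullVec]

lemma Ω_incl (u v : V n) : Ω (incl n u) (incl n v) = Ω u v := by
  simp [Ω, incl, Fin.sum_univ_castSucc]

lemma Ω_nullVec (u : V (n + 1)) (hu : u ∈ W n) : Ω (nullVec n) u = 0 := by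
  have : u (Sum.inr (Fin.last n)) = 0 := hu
  simp [Ω, nullVec, Fin.sum_univ_castSucc, this, Fin.castSucc_ne_last]

/-- The block diagonal matrix `diag(τ, i)`. -/
def extMat (τ : Matrix (Fin n) (Fin n) ℂ) : Matrix (Fin (n + 1)) (Fin (n + 1)) ℂ :=
  Matrix.of (Fin.snoc (fun i => Fin.snoc (fun j => τ i j) 0) (Fin.snoc (fun _ => 0) Complex.I))

lemma extMat_cc (τ : Matrix (Fin n) (Fin n) ℂ) (i j : Fin n) :
    extMat τ i.castSucc j.castSucc = τ i j := by simp [extMat]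
lemma extMat_cl (τ : Matrix (Fin n) (Fin n) ℂ) (i : Fin n) :
    extMat τ i.castSucc (Fin.last n) = 0 := by simp [extMat]
lemma extMat_lc (τ : Matrix (Fin n) (Fin n) ℂ) (j : Fin n) :
    extMat τ (Fin.last n) j.castSucc = 0 := by simp [extMat]
lemma extMat_ll (τ : Matrix (Fin n) (Fin n) ℂ) :
    extMat τ (Fin.last n) (Fin.last n) = Complex.I := by simp [extMat]

lemma extMat_mem (τ : Siegel n) : extMat τ.1 ∈ siegelSet (n + 1) := by
  obtain ⟨τ, h1, h2⟩ := τ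
  constructor
  · ext i j
    induction i using Fin.lastCases <;> induction j using Fin.lastCases <;>
      simp only [Matrix.transpose_apply, extMat_cc, extMat_cl, extMat_lc, extMat_ll]
    exact congrFun (congrFun h1 _) _
  · have hl : (2 * Complex.I)⁻¹ * (Complex.I + Complex.I) = 1 := by
      rw [← two_mul]
      exact inv_mul_cancel₀ (mul_ne_zero two_ne_zero Complex.I_ne_zero)
    refine Matrix.PosDef.of_dotProduct_mulVec_pos ?_ ?_
    · have h3 := h2.1
      ext i j
      have h4 := fun i j => congrFun (congrFun h3 i) j
      induction i using Fin.lastCases <;> induction j using Fin.lastCases <;>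
        simp only [Matrix.conjTranspose_apply, Matrix.smul_apply, Matrix.sub_apply, extMat_cc,
          extMat_cl, extMat_lc, extMat_ll] at h4 ⊢
      · rw [Complex.star_def, Complex.conj_I, sub_neg_eq_add, smul_eq_mul, hl, map_one]
      · simp
      · simp
      · exact h4 _ _
    · intro v hv
      have e : star v ⬝ᵥ (((2 * Complex.I)⁻¹ • (extMat τ - (extMat τ)ᴴ)) *ᵥ v)
          = star (fun i => v (Fin.castSucc i)) ⬝ᵥ
              (((2 * Complex.I)⁻¹ • (τ - τᴴ)) *ᵥ (fun i => v (Fin.castSucc i)))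
            + star (v (Fin.last n)) * v (Fin.last n) := by
        simp only [dotProduct, Matrix.mulVec, Fin.sum_univ_castSucc, Matrix.smul_apply,
          Matrix.sub_apply, Matrix.conjTranspose_apply, extMat_cc, extMat_cl, extMat_lc, extMat_ll,
          Pi.star_apply, Complex.star_def, Complex.conj_I, sub_neg_eq_add, smul_eq_mul, hl]
        simp
      rw [e]
      by_cases h0 : (fun i => v (Fin.castSucc i)) = 0
      · have hn : v (Fin.last n) ≠ 0 := by
          intro h
          apply hv
          ext i
          induction i using Fin.lastCases with
          | last => exact h
          | cast i => exact congrFun h0 i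
        rw [h0]
        simp only [Matrix.mulVec_zero, dotProduct_zero, zero_add]
        exact star_mul_self_pos (IsRegular.of_ne_zero hn)
      · exact add_pos_of_pos_of_nonneg (h2.dotProduct_mulVec_pos h0) (star_mul_self_nonneg _)

lemma det_den_ext (g : spW n) (τ : Matrix (Fin n) (Fin n) ℂ) :
    (den g.1 (extMat τ)).det =
      ((g.1.1 (Sum.inr (Fin.last n)) (Sum.inr (Fin.last n)) : ℝ) : ℂ) * (den (nu g) τ).det := by
  have hrow : ∀ j, den g.1 (extMat τ) (Fin.last n) (Fin.castSucc j) = 0 := by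
    intro j
    simp [den, Matrix.mul_apply, toBlocks₂₁, toBlocks₂₂, cplx,
      row_last g.2 _ (by simp : Sum.inl _ ≠ _), row_last g.2 (Sum.inr (Fin.castSucc j))
      (by simp [Fin.castSucc_ne_last])]
  have hcorner : den g.1 (extMat τ) (Fin.last n) (Fin.last n) =
      ((g.1.1 (Sum.inr (Fin.last n)) (Sum.inr (Fin.last n)) : ℝ) : ℂ) := by
    simp [den, Matrix.mul_apply, toBlocks₂₁, toBlocks₂₂, cplx,
      row_last g.2 _ (by simp : Sum.inl _ ≠ _)]
  have hsub : (den g.1 (extMat τ)).submatrix Fin.castSucc Fin.castSucc = den (nu g) τ := by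
    ext i j
    simp [den, Matrix.mul_apply, toBlocks₂₁, toBlocks₂₂, cplx, nu, cut, Fin.sum_univ_castSucc,
      extMat_cc, extMat_lc]
  rw [Matrix.det_succ_row _ (Fin.last n), Fin.sum_univ_castSucc,
    Finset.sum_eq_zero (fun j _ => by rw [hrow]; simp), zero_add, hcorner, ← hsub]
  simp [Fin.succAbove_last, ← two_mul]

/-- `Mpᶜ(V; W) = σ⁻¹(Sp(V; W))`. -/
abbrev MpcW (n : ℕ) : Type := {a : Mpc (n + 1) // a.g ∈ spW n}

/-- The scalar by which an element of `Mpᶜ(V; W)` acts on `V/W`. -/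
def corner (a : MpcW n) : ℝ := a.1.g.1 (Sum.inr (Fin.last n)) (Sum.inr (Fin.last n))

/-- The homomorphism `ν̂ : Mpᶜ(V; W) → Mpᶜ(W/W^⊥)` over `ν`. For `g` preserving `W`, acting on `V/W`
by `r`, one has `det (c τ + d) = r det (c' τ' + d')` where `τ'` is the upper left block of `τ` and
`(a', b'; c', d') = ν(g)`. So `φ` depends on `τ'` only, and `|r|^{-1/2} φ` is the function of `ν̂(a)`.
It satisfies `η ∘ ν̂ = sign(r) η`, is the identity on `U(1)`, and `η_* ∘ ν̂_* = η_*`. -/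
def nuHat (a : MpcW n) : Mpc n where
  g := nu ⟨a.1.g, a.2⟩
  φ τ := ((Real.sqrt |corner a| : ℝ) : ℂ)⁻¹ * a.1.φ ⟨extMat τ.1, extMat_mem τ⟩
  η := if 0 < corner a then a.1.η else Circle.exp Real.pi * a.1.η
  cont := by
    refine continuous_const.mul (a.1.cont.comp (Continuous.subtype_mk ?_ _))
    refine continuous_matrix fun i j => ?_
    induction i using Fin.lastCases <;> induction j using Fin.lastCases <;>
      simp only [extMat_cc, extMat_cl, extMat_lc, extMat_ll]
    · exact continuous_const
    · exact continuous_const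
    · exact continuous_const
    · exact continuous_subtype_val.matrix_elem _ _
  sq τ := by
    have hc : corner a ≠ 0 := corner_ne_zero a.2
    rw [mul_pow, a.1.sq, det_den_ext ⟨a.1.g, a.2⟩, inv_pow, ← Complex.ofReal_pow,
      Real.sq_sqrt (abs_nonneg _)]
    change ((|corner a| : ℝ) : ℂ)⁻¹ * (a.1.η * ((corner a : ℂ) * _)) = _
    have hc' : (corner a : ℂ) ≠ 0 := Complex.ofReal_ne_zero.2 hc
    split_ifs with h
    · rw [abs_of_pos h]
      field_simp
    · rw [abs_of_neg (lt_of_le_of_ne (not_lt.1 h) hc)]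
      simp only [Complex.ofReal_neg, Circle.coe_mul, Circle.coe_exp, Complex.exp_pi_mul_I]
      field_simp

/-- The inclusion of `U(1)` in `Mpᶜ(V n)`. -/
def ofCircle (u : Circle) : Mpc n where
  g := 1
  φ _ := u
  η := u ^ 2
  cont := continuous_const
  sq τ := by rw [det_den_one]; simp

/-- The point `i 1` of the Siegel upper half space. -/
def basePt (n : ℕ) : Siegel n :=
  ⟨Complex.I • 1, by
    constructor
    · simp
    · have : (2 * Complex.I)⁻¹ • (Complex.I • (1 : Matrix (Fin n) (Fin n) ℂ)
          - (Complex.I • (1 : Matrix (Fin n) (Fin n) ℂ))ᴴ) = 1 := by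
        rw [Matrix.conjTranspose_smul, Matrix.conjTranspose_one, ← sub_smul, smul_smul]
        have : (2 * Complex.I)⁻¹ * (Complex.I - star Complex.I) = 1 := by
          rw [Complex.star_def, Complex.conj_I, sub_neg_eq_add, ← two_mul]
          exact inv_mul_cancel₀ (mul_ne_zero two_ne_zero Complex.I_ne_zero)
        rw [this, one_smul]
      rw [this]
      exact Matrix.PosDef.one⟩

/-- Smooth curves in the Lie group `Mpᶜ(V n)`. The Lie group structure is that for which
`(g, φ) ↦ (g, φ(i 1))` is an embedding in `Sp(V n) × (ℂ - 0)`. -/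
def Mpc.SmoothCurve (a : ℝ → Mpc n) : Prop :=
  (∀ i j, ContDiff ℝ ∞ fun t => (a t).g.1 i j) ∧ ContDiff ℝ ∞ fun t => (a t).φ (basePt n)

/-- The value of `½ η_* ϑ₀` on the velocity of a curve `a` in `Mpᶜ`, with `ϑ₀ = a⁻¹ da` the trivial
connection; it is `½ η(a)⁻¹ dη(a)/dt` in `𝔲(1) = i ℝ ⊂ ℂ`. -/
def Mpc.halfEta (a : ℝ → Mpc n) (t : ℝ) : ℂ :=
  (1 / 2) * (deriv (fun s => ((a s).η : ℂ)) t / ((a t).η : ℂ))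

section Associated

variable {P : Type}

/-- Let `P` carry a right action `ρ` of `Mpᶜ(V (n+1))`, and let `ad ⊂ P` be a principal
`Mpᶜ(V; W)` bundle. The identification `(p h, c) ~ (p, ν̂(h) c)` on `ad × Mpᶜ(V n)`. -/
inductive AssocRel (ρ : P → Mpc (n + 1) → P) (ad : Set P) : ad × Mpc n → ad × Mpc n → Prop
  | rel (p p' : ad) (h : MpcW n) (c : Mpc n) (hp : p'.1 = ρ p.1 h.1) :
      AssocRel ρ ad (p', c) (p, nuHat h * c)

/-- The principal `Mpᶜ(V n)` bundle associated to `ad` by `ν̂`. -/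
def Assoc (ρ : P → Mpc (n + 1) → P) (ad : Set P) : Type := Quot (AssocRel (n := n) ρ ad)

variable {ρ : P → Mpc (n + 1) → P} {ad : Set P}

/-- The class of `(p, c)`. -/
def Assoc.mk (p : ad) (c : Mpc n) : Assoc ρ ad := Quot.mk _ (p, c)

/-- The right action of `Mpᶜ(V n)` on the associated bundle. -/
def Assoc.act (q : Assoc ρ ad) (c : Mpc n) : Assoc ρ ad :=
  Quot.map (fun x : ad × Mpc n => (x.1, x.2 * c)) (by
    rintro _ _ ⟨p, p', h, c', hp⟩
    have := AssocRel.rel (ρ := ρ) p p' h (c' * c) hp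
    rwa [← mul_assoc] at this) q

/-- Let `form q f` say that `q` is a smooth curve in `P` on whose velocity at time `t` the connection
one-form `γ` takes the value `f t`. This is the same relation for the one-form induced on the
associated bundle, whose pullback to `ad × Mpᶜ(V n)` is `γ + ½ η_* ϑ₀`: a curve is smooth if it lifts
to a smooth curve `(p, c)` in `ad × Mpᶜ(V n)`, and the value does not depend on the lift. -/
def Assoc.HasForm (form : (ℝ → P) → (ℝ → ℂ) → Prop) (q : ℝ → Assoc ρ ad) (f : ℝ → ℂ) : Prop :=
  ∃ (p : ℝ → ad) (c : ℝ → Mpc n) (f₀ : ℝ → ℂ),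
    (∀ t, q t = Assoc.mk (p t) (c t)) ∧ form (fun t => (p t).1) f₀ ∧ Mpc.SmoothCurve c ∧
      ∀ t, f t = f₀ t + Mpc.halfEta c t

end Associated

/-- `Z = Tℝ⁴` with coordinates `(x, y)`; each tangent space of `Z` is identified with `Z = V 4` by
`v_j ↦ ∂/∂x_j`, `w_j ↦ ∂/∂y_j`. The symplectic form `ω₄ = ∑ dx_j ∧ dy_j` is then `Ω`. -/
abbrev Z : Type := V 4

/-- The coordinates `x`. -/
def X (z : Z) : Fin 4 → ℝ := fun j => z (Sum.inl j)
/-- The coordinates `y`. -/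
def Y (z : Z) : Fin 4 → ℝ := fun j => z (Sum.inr j)

/-- The energy of a free particle, `K = |y|²/2`. -/
def K (z : Z) : ℝ := (1 / 2) * (Y z ⬝ᵥ Y z)

/-- First constraint function. -/
def c₁ (z : Z) : ℝ := (1 / 2) * (X z ⬝ᵥ X z - 1)
/-- Second constraint function. -/
def c₂ (z : Z) : ℝ := X z ⬝ᵥ Y z

/-- `TS³ = {|x|² = 1, x · y = 0}`, with symplectic form `ω₃` the restriction of `ω₄`. -/
def TS3 : Set Z := {z | X z ⬝ᵥ X z = 1 ∧ X z ⬝ᵥ Y z = 0}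

/-- The tangent space of `TS³` at one of its points. -/
def tangentTS3 (z : Z) : Submodule ℝ Z :=
  LinearMap.ker (fderiv ℝ c₁ z : Z →ₗ[ℝ] ℝ) ⊓ LinearMap.ker (fderiv ℝ c₂ z : Z →ₗ[ℝ] ℝ)

/-- The function `R = |x|²/2`. -/
def R (z : Z) : ℝ := (1 / 2) * (X z ⬝ᵥ X z)

/-- The level set `A = R⁻¹(1/2)`, of which `TS³` is the symplectic reduction. -/
def A : Set Z := {z | R z = 1 / 2}

/-- The tangent space of `A` at one of its points. -/
def tangentA (z : Z) : Submodule ℝ Z := LinearMap.ker (fderiv ℝ R z : Z →ₗ[ℝ] ℝ)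

/-- The orbit projection `p(x, y) = (x, y - (x · y) x)` from `A` to `TS³`. -/
def orbitProj (z : Z) : Z := Sum.elim (X z) (Y z - (X z ⬝ᵥ Y z) • X z)

/-- The metaplectic-c prequantization `Q₄ = Z × Mpᶜ(V 4)` of `(Z, ω₄)`. -/
def Q4 : Type := Z × Mpc 4

/-- The right action of `Mpᶜ(V 4)` on `Q₄`. -/
def Q4.act (q : Q4) (h : Mpc 4) : Q4 := (q.1, q.2 * h)

/-- `Γ₄ : Q₄ → Sp(Z, ω₄)`, in the global Cartesian trivialization. -/
def Q4.frame (q : Q4) : V 4 →ₗ[ℝ] Z := toLin q.2.g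

/-- The one-form `β₄ = -∑ y_j dx_j` at `z`, on a tangent vector `w`. -/
def beta4 (z w : Z) : ℝ := -∑ j, Y z j * X w j

/-- `q` is a smooth curve in `Q₄`, and `δ₄ = (1/iħ) β₄ + ½ η_* ϑ₀` has the value `f t` on its velocity. -/
def Q4.HasForm (ħ : ℝ) (q : ℝ → Q4) (f : ℝ → ℂ) : Prop :=
  ContDiff ℝ ∞ (fun t => (q t).1) ∧ Mpc.SmoothCurve (fun t => (q t).2) ∧
    ∀ t, f t = (1 / (Complex.I * ħ)) * (beta4 (q t).1 (deriv (fun s => (q s).1) t) : ℝ) +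
      Mpc.halfEta (fun s => (q s).2) t

/-- The restriction `Q₄^A` of `Q₄` to the frames over `A` that map `W` onto the tangent space of `A`. -/
def adaptedA : Set Q4 := {q | q.1 ∈ A ∧ Submodule.map q.frame (W 3) = tangentA q.1}

/-- The principal `Mpᶜ(V 3)` bundle `Q_{4A}` over `A` associated to `Q₄^A` by `ν̂`. -/
def Q4A : Type := Assoc (n := 3) Q4.act adaptedA

/-- The bundle projection of `Q_{4A}`. -/
def Q4A.pt (q : Q4A) : Z :=
  Quot.lift (fun x : adaptedA × Mpc 3 => x.1.1.1) (by
    rintro _ _ ⟨p, p', h, c', hp⟩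
    change p'.1.1 = p.1.1
    rw [hp]; rfl) q

lemma toLin_mul (g h : Sp n) : toLin (g * h) = toLin g ∘ₗ toLin h := Matrix.mulVecLin_mul _ _

lemma hasFDerivAt_coord (z : Z) (i) : HasFDerivAt (fun z : Z => z i)
    (ContinuousLinearMap.proj i : Z →L[ℝ] ℝ) z :=
  (ContinuousLinearMap.proj i : Z →L[ℝ] ℝ).hasFDerivAt

lemma differentiable_X (j) : Differentiable ℝ fun z : Z => X z j :=
  fun z => (hasFDerivAt_coord z _).differentiableAt
lemma differentiable_Y (j) : Differentiable ℝ fun z : Z => Y z j :=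
  fun z => (hasFDerivAt_coord z _).differentiableAt

lemma fderiv_eq_of_line {F : Type*} [NormedAddCommGroup F] [NormedSpace ℝ F] {f : Z → F} {z w : Z}
    {f' : F} (hf : DifferentiableAt ℝ f z) (h : HasDerivAt (fun s : ℝ => f (z + s • w)) f' 0) :
    fderiv ℝ f z w = f' := by
  rw [← hf.lineDeriv_eq_fderiv]
  exact h.deriv

lemma hasDerivAt_X (z w : Z) (j) : HasDerivAt (fun s : ℝ => X (z + s • w) j) (X w j) 0 := by
  have := ((hasDerivAt_id (0 : ℝ)).mul_const (X w j)).const_add (X z j)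
  simpa [X] using this
lemma hasDerivAt_Y (z w : Z) (j) : HasDerivAt (fun s : ℝ => Y (z + s • w) j) (Y w j) 0 := by
  have := ((hasDerivAt_id (0 : ℝ)).mul_const (Y w j)).const_add (Y z j)
  simpa [Y] using this

lemma hasDerivAt_XX (z w : Z) :
    HasDerivAt (fun s : ℝ => X (z + s • w) ⬝ᵥ X (z + s • w)) (2 * (X z ⬝ᵥ X w)) 0 := by
  have := HasDerivAt.fun_sum (u := Finset.univ)
    (fun j _ => (hasDerivAt_X z w j).mul (hasDerivAt_X z w j))
  refine HasDerivAt.congr_deriv (f := fun s : ℝ => X (z + s • w) ⬝ᵥ X (z + s • w)) this ?_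
  simp only [zero_smul, add_zero, dotProduct, Finset.mul_sum]
  exact Finset.sum_congr rfl fun j _ => by ring

lemma hasDerivAt_XY (z w : Z) :
    HasDerivAt (fun s : ℝ => X (z + s • w) ⬝ᵥ Y (z + s • w)) (X w ⬝ᵥ Y z + X z ⬝ᵥ Y w) 0 := by
  have := HasDerivAt.fun_sum (u := Finset.univ)
    (fun j _ => (hasDerivAt_X z w j).mul (hasDerivAt_Y z w j))
  refine HasDerivAt.congr_deriv (f := fun s : ℝ => X (z + s • w) ⬝ᵥ Y (z + s • w)) this ?_
  simp only [zero_smul, add_zero, dotProduct, Finset.sum_add_distrib]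

lemma fderiv_R (z w : Z) : fderiv ℝ R z w = X z ⬝ᵥ X w := by
  refine fderiv_eq_of_line ?_ ?_
  · have := differentiable_X
    unfold R dotProduct
    fun_prop
  · have := (hasDerivAt_XX z w).const_mul (1 / 2 : ℝ)
    refine HasDerivAt.congr_deriv (f := fun s : ℝ => R (z + s • w)) this ?_
    ring

lemma fderiv_orbitProj (z w : Z) : fderiv ℝ orbitProj z w =
    Sum.elim (X w) (Y w - (X w ⬝ᵥ Y z + X z ⬝ᵥ Y w) • X z - (X z ⬝ᵥ Y z) • X w) := by
  have hX := differentiable_X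
  have hY := differentiable_Y
  refine fderiv_eq_of_line ?_ ?_
  · refine differentiableAt_pi.2 fun i => ?_
    rcases i with i | i
    · exact hX i z
    · simp only [orbitProj, Sum.elim_inr, Pi.sub_apply, Pi.smul_apply, dotProduct, smul_eq_mul]
      fun_prop
  · refine hasDerivAt_pi.2 fun i => ?_
    rcases i with i | i
    · exact hasDerivAt_X z w i
    · have := (hasDerivAt_Y z w i).sub ((hasDerivAt_XY z w).mul (hasDerivAt_X z w i))
      refine HasDerivAt.congr_deriv (f := fun s : ℝ => orbitProj (z + s • w) (Sum.inr i)) this ?_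
      simp only [zero_smul, add_zero, Sum.elim_inr, Pi.sub_apply, Pi.smul_apply, smul_eq_mul]
      ring

lemma Ω_XY (u v : Z) : Ω u v = X u ⬝ᵥ Y v - Y u ⬝ᵥ X v := by
  simp [Ω, X, Y, dotProduct]

lemma adapted_null {q : Q4} (hq : q ∈ adaptedA) :
    fderiv ℝ orbitProj q.1 (q.frame (nullVec 3)) = 0 := by
  obtain ⟨hz, hT⟩ := hq
  set z := q.1
  set w := q.frame (nullVec 3)
  have hxx : X z ⬝ᵥ X z = 1 := by
    have : (1 / 2) * (X z ⬝ᵥ X z) = 1 / 2 := hz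
    linarith
  have horth : ∀ u : Z, X z ⬝ᵥ X u = 0 → Ω w u = 0 := by
    intro u hu
    have hu' : u ∈ tangentA z := by
      change fderiv ℝ R z u = 0
      rw [fderiv_R, hu]
    rw [← hT] at hu'
    obtain ⟨u', hu', rfl⟩ := hu'
    exact (Ω_toLin _ _ _).trans (Ω_nullVec _ hu')
  have hX : X w = 0 := by
    have h := horth (Sum.elim 0 (X w)) (by
      simp [X, dotProduct])
    rw [Ω_XY] at h
    have e1 : Y (Sum.elim (0 : Fin 4 → ℝ) (X w)) = X w := rfl
    have e2 : X (Sum.elim (0 : Fin 4 → ℝ) (X w)) = 0 := rfl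
    rw [e1, e2, dotProduct_zero, sub_zero] at h
    exact dotProduct_self_eq_zero.1 h
  have hY : Y w - (X z ⬝ᵥ Y w) • X z = 0 := by
    set v := Y w - (X z ⬝ᵥ Y w) • X z
    have hv : X z ⬝ᵥ v = 0 := by
      simp [v, dotProduct_sub, hxx]
    have h := horth (Sum.elim v 0) hv
    rw [Ω_XY] at h
    have e1 : Y (Sum.elim v (0 : Fin 4 → ℝ)) = 0 := rfl
    have e2 : X (Sum.elim v (0 : Fin 4 → ℝ)) = v := rfl
    rw [e1, e2, dotProduct_zero, zero_sub, neg_eq_zero] at h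
    refine dotProduct_self_eq_zero.1 ?_
    have : v ⬝ᵥ v = Y w ⬝ᵥ v - (X z ⬝ᵥ Y w) • (X z ⬝ᵥ v) := by
      conv_lhs => rw [show v = Y w - (X z ⬝ᵥ Y w) • X z from rfl]
      rw [sub_dotProduct, smul_dotProduct]
    rw [this, h, hv, smul_zero, sub_zero]
  rw [fderiv_orbitProj, hX, zero_dotProduct, zero_add, smul_zero, sub_zero, hY]
  ext i
  rcases i with i | i <;> rfl

/-- The frame of the tangent space of `TS³` at `p(z)` given by a class `[(z, a), c]`: the isomorphism
`V 3 = W/W^⊥ → T_zA/T_zA^⊥` induced by `σ(a)`, precomposed with `σ(c)`, followed by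
`p_* : T_zA/T_zA^⊥ → T_{p(z)}TS³`. -/
def frameRep (q : Q4) (c : Mpc 3) : V 3 →ₗ[ℝ] Z :=
  (fderiv ℝ orbitProj q.1 : Z →ₗ[ℝ] Z) ∘ₗ q.frame ∘ₗ incl 3 ∘ₗ toLin c.g

/-- The map to symplectic frames of `TS³`. -/
def Q4A.frame (q : Q4A) : V 3 →ₗ[ℝ] Z :=
  Quot.lift (fun x : adaptedA × Mpc 3 => frameRep x.1.1 x.2) (by
    rintro _ _ ⟨p, p', h, c', hp⟩
    refine LinearMap.ext fun v => ?_
    have hn := adapted_null p.2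
    obtain ⟨s, hs⟩ := toLin_incl ⟨h.1.g, h.2⟩ (toLin c'.g v)
    change fderiv ℝ orbitProj p'.1.1 (toLin p'.1.2.g (incl 3 (toLin c'.g v)))
      = fderiv ℝ orbitProj p.1.1 (toLin p.1.2.g (incl 3
        (toLin (nu ⟨h.1.g, h.2⟩ * c'.g) v)))
    rw [hp]
    change fderiv ℝ orbitProj p.1.1 (toLin (p.1.2.g * h.1.g) (incl 3 (toLin c'.g v))) = _
    rw [toLin_mul, toLin_mul, LinearMap.comp_apply, LinearMap.comp_apply, hs, map_add, map_add,
      map_smul, map_smul]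
    change _ + s • fderiv ℝ orbitProj p.1.1 (p.1.frame (nullVec 3)) = _
    rw [hn, smul_zero, add_zero]) q

lemma Ω_orbitProj {z u v : Z} (hu : u ∈ tangentA z) (hv : v ∈ tangentA z) :
    Ω (fderiv ℝ orbitProj z u) (fderiv ℝ orbitProj z v) = Ω u v := by
  have hu' : X z ⬝ᵥ X u = 0 := (fderiv_R z u).symm.trans hu
  have hv' : X z ⬝ᵥ X v = 0 := (fderiv_R z v).symm.trans hv
  rw [fderiv_orbitProj, fderiv_orbitProj, Ω_XY, Ω_XY]
  simp only [show ∀ a b : Fin 4 → ℝ, X (Sum.elim a b) = a from fun _ _ => rfl,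
    show ∀ a b : Fin 4 → ℝ, Y (Sum.elim a b) = b from fun _ _ => rfl,
    dotProduct_sub, sub_dotProduct, dotProduct_smul, smul_dotProduct, hv', smul_eq_mul,
    dotProduct_comm (X u) (X z), hu']
  ring

lemma Q4A.frame_symp (q : Q4A) (u v : V 3) : Ω (q.frame u) (q.frame v) = Ω u v := by
  obtain ⟨⟨p, c⟩, rfl⟩ := Quot.exists_rep q
  have hm : ∀ w : V 3, p.1.frame (incl 3 w) ∈ tangentA p.1.1 := fun w => by
    rw [← p.2.2]
    exact Submodule.mem_map_of_mem (incl_mem_W w)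
  exact (Ω_orbitProj (hm _) (hm _)).trans
    ((Ω_toLin _ _ _).trans ((Ω_incl _ _).trans (Ω_toLin _ _ _)))

/-- The metaplectic-c prequantization `(Q, Γ, δ)` of `(TS³, ω₃)`: the restriction of `Q_{4A}` to `TS³`. -/
def Q : Type := {q : Q4A // q.pt ∈ TS3}

/-- The bundle projection `Q → TS³`. -/
def Q.pt (q : Q) : Z := Q4A.pt q.1
/-- `Γ : Q → Sp(TS³, ω₃)`. -/
def Q.frame (q : Q) : V 3 →ₗ[ℝ] Z := Q4A.frame q.1

lemma Q4A.pt_act (q : Q4A) (c : Mpc 3) : Q4A.pt (Assoc.act q c) = Q4A.pt q := by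
  obtain ⟨x, rfl⟩ := Quot.exists_rep q
  rfl

lemma Q4A.frame_act (q : Q4A) (c : Mpc 3) :
    Q4A.frame (Assoc.act q c) = Q4A.frame q ∘ₗ toLin c.g := by
  obtain ⟨⟨p, d⟩, rfl⟩ := Quot.exists_rep q
  change frameRep p.1 (d * c) = frameRep p.1 d ∘ₗ toLin c.g
  have : (d * c).g = d.g * c.g := rfl
  simp only [frameRep, this, toLin_mul, LinearMap.comp_assoc]

/-- The right action of `Mpᶜ(V 3)` on `Q`. -/
def Q.act (q : Q) (c : Mpc 3) : Q := ⟨Assoc.act q.1 c, by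
  rw [Q4A.pt_act]; exact q.2⟩

/-- `q` is a smooth curve in `Q`, and the prequantization one-form `δ` has the value `f t` on its
velocity. -/
def Q.HasForm (ħ : ℝ) (q : ℝ → Q) (f : ℝ → ℂ) : Prop :=
  Assoc.HasForm (Q4.HasForm ħ) (fun t => (q t).1) f

/-- The level set `S = H⁻¹(E)` in `TS³`. -/
def levelSet (H : Z → ℝ) (E : ℝ) : Set Z := {z | z ∈ TS3 ∧ H z = E}

/-- The tangent space of the level set of `H` through `z`. -/
def tangentLevel (H : Z → ℝ) (z : Z) : Submodule ℝ Z :=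
  tangentTS3 z ⊓ LinearMap.ker (fderiv ℝ H z : Z →ₗ[ℝ] ℝ)

/-- The null space `T_zS^⊥`: vectors of `T_zTS³` that are `ω₃`-orthogonal to `T_zS`. -/
def nullLine (H : Z → ℝ) (z : Z) : Submodule ℝ Z where
  carrier := {ζ | ζ ∈ tangentTS3 z ∧ ∀ u ∈ tangentLevel H z, Ω ζ u = 0}
  zero_mem' := ⟨zero_mem _, fun u _ => by simp [Ω]⟩
  add_mem' := fun {a b} ha hb => ⟨add_mem ha.1 hb.1, fun u hu => by
    have h : Ω (a + b) u = Ω a u + Ω b u := by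
      simp only [Ω, Pi.add_apply, ← Finset.sum_add_distrib]
      exact Finset.sum_congr rfl fun j _ => by ring
    rw [h, ha.2 u hu, hb.2 u hu, add_zero]⟩
  smul_mem' := fun r a ha => ⟨Submodule.smul_mem _ r ha.1, fun u hu => by
    have h : Ω (r • a) u = r * Ω a u := by
      simp only [Ω, Pi.smul_apply, smul_eq_mul, Finset.mul_sum]
      exact Finset.sum_congr rfl fun j _ => by ring
    rw [h, ha.2 u hu, mul_zero]⟩

/-- Linear maps from `V 2 = W/W^⊥` to `T_sTS³/T_sS^⊥` (regarded in `Z/T_sS^⊥`). -/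
def RedFrame (H : Z → ℝ) : Type := Σ s : Z, (V 2 →ₗ[ℝ] (Z ⧸ nullLine H s))

/-- `b` belongs to the symplectic frame bundle `Sp(TS/TS^⊥)` of the level set `S = H⁻¹(E)`: it is a
symplectic isomorphism from `V 2 = W/W^⊥` onto `T_sS/T_sS^⊥` for a point `s` of `S`. -/
def IsRedFrame (H : Z → ℝ) (E : ℝ) (b : RedFrame H) : Prop :=
  b.1 ∈ levelSet H E ∧
  LinearMap.range b.2 = Submodule.map (nullLine H b.1).mkQ (tangentLevel H b.1) ∧
  ∀ (v v' : V 2) (u u' : Z), u ∈ tangentLevel H b.1 → u' ∈ tangentLevel H b.1 →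
    b.2 v = (nullLine H b.1).mkQ u → b.2 v' = (nullLine H b.1).mkQ u' → Ω u u' = Ω v v'

/-- The principal `Mpᶜ(V; W)` bundle `Q^S`: the restriction of `Q` to the frames over `S` that map `W`
onto the tangent space of `S`. -/
def adaptedS (H : Z → ℝ) (E : ℝ) : Set Q :=
  {q | q.pt ∈ levelSet H E ∧ Submodule.map q.frame (W 2) = tangentLevel H q.pt}

/-- The principal `Mpᶜ(V 2)` bundle `Q_S` over `S` associated to `Q^S` by `ν̂`. -/
def QS (H : Z → ℝ) (E : ℝ) : Type := Assoc (n := 2) Q.act (adaptedS H E)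

lemma adaptedS_null {H : Z → ℝ} {E : ℝ} {q : Q} (hq : q ∈ adaptedS H E) :
    q.frame (nullVec 2) ∈ nullLine H q.pt := by
  have hm : q.frame (nullVec 2) ∈ tangentLevel H q.pt := by
    rw [← hq.2]
    exact Submodule.mem_map_of_mem nullVec_mem_W
  refine ⟨hm.1, fun u hu => ?_⟩
  rw [← hq.2] at hu
  obtain ⟨w, hw, rfl⟩ := hu
  exact (Q4A.frame_symp q.1 _ _).trans (Ω_nullVec _ hw)

/-- The isomorphism `V 2 → T_sS/T_sS^⊥` of a class `[q, d]`: the one induced by `Γ(q)` on `W/W^⊥`,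
precomposed with `σ(d)`. -/
def redFrameRep (H : Z → ℝ) (q : Q) (d : Mpc 2) : RedFrame H :=
  ⟨q.pt, (nullLine H q.pt).mkQ ∘ₗ q.frame ∘ₗ incl 2 ∘ₗ toLin d.g⟩

lemma redFrame_eq {H : Z → ℝ} {s s' : Z} (hs : s' = s) (F F' : V 2 →ₗ[ℝ] Z)
    (h : ∀ v, F' v - F v ∈ nullLine H s) :
    (⟨s', (nullLine H s').mkQ ∘ₗ F'⟩ : RedFrame H) = ⟨s, (nullLine H s).mkQ ∘ₗ F⟩ := by
  subst hs
  congr 1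
  exact LinearMap.ext fun v => (Submodule.Quotient.eq _).2 (h v)

/-- The projection `Q_S → Sp(TS/TS^⊥)`. -/
def QS.frame {H : Z → ℝ} {E : ℝ} (q : QS H E) : RedFrame H :=
  Quot.lift (fun x : adaptedS H E × Mpc 2 => redFrameRep H x.1.1 x.2) (by
    rintro _ _ ⟨p, p', h, c', hp⟩
    have hpt : p'.1.pt = p.1.pt := by rw [hp]; exact Q4A.pt_act _ _
    have hfr : p'.1.frame = p.1.frame ∘ₗ toLin h.1.g := by rw [hp]; exact Q4A.frame_act _ _
    refine redFrame_eq hpt _ _ fun v => ?_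
    obtain ⟨s, hs⟩ := toLin_incl ⟨h.1.g, h.2⟩ (toLin c'.g v)
    change p'.1.frame (incl 2 (toLin c'.g v))
      - p.1.frame (incl 2 (toLin (nu ⟨h.1.g, h.2⟩ * c'.g) v)) ∈ _
    rw [hfr, toLin_mul, LinearMap.comp_apply, LinearMap.comp_apply, hs, map_add, map_smul,
      add_sub_cancel_left]
    exact Submodule.smul_mem _ _ (adaptedS_null p.2)) q

/-- A smooth curve in `Q_S` that is horizontal for the induced connection one-form `δ_S`. -/
def QS.IsHorizontal (ħ : ℝ) {H : Z → ℝ} {E : ℝ} (q : ℝ → QS H E) : Prop :=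
  Assoc.HasForm (Q.HasForm ħ) q (fun _ => 0)

/-- The right action of `Mpᶜ(V 2)` on `Q_S`. -/
def QS.act {H : Z → ℝ} {E : ℝ} (q : QS H E) (d : Mpc 2) : QS H E := Assoc.act q d

/-- `ξ` is the value at `z` of the Hamiltonian vector field `ξ_H` on `TS³`: `ω₃(ξ, ·) = dH`. -/
def IsHamVec (H : Z → ℝ) (z ξ : Z) : Prop :=
  ξ ∈ tangentTS3 z ∧ ∀ u ∈ tangentTS3 z, Ω ξ u = fderiv ℝ H z u

/-- Integral curves of `ξ_H` on `TS³`, defined for all times. -/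
def IsHamCurve (H : Z → ℝ) (c : ℝ → Z) : Prop :=
  (∀ t, c t ∈ TS3) ∧ ∀ t, DifferentiableAt ℝ c t ∧ IsHamVec H (c t) (deriv c t)

open Classical in
/-- The flow `φ^t` of `ξ_H` on `TS³` (for `H` whose Hamiltonian vector field is complete). -/
def flow (H : Z → ℝ) (t : ℝ) (z : Z) : Z :=
  if h : ∃ c, IsHamCurve H c ∧ c 0 = z then h.choose t else z

/-- `φ^t_*` at `z`: the derivative of `φ^t` along `TS³`, to be applied to vectors of `T_zTS³`, on which
it is unique. -/
def pushforward (H : Z → ℝ) (t : ℝ) (z : Z) : Z →L[ℝ] Z := fderivWithin ℝ (flow H t) TS3 z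

/-- `b' = φ̃^t(b)` for the induced flow on `Sp(TS/TS^⊥)`: if `b(v) = [u]` then `b'(v) = [φ^t_* u]`. -/
def IsFlowImage (H : Z → ℝ) (t : ℝ) (b b' : RedFrame H) : Prop :=
  b'.1 = flow H t b.1 ∧
  ∀ (v : V 2) (u : Z), u ∈ tangentLevel H b.1 → b.2 v = (nullLine H b.1).mkQ u →
    b'.2 v = (nullLine H b'.1).mkQ (pushforward H t b.1 u)

/-- `q` is a horizontal curve in `Q_S` that lies over the orbit of `φ̃^t` through `b`. -/
def IsHorizontalLift (ħ : ℝ) {H : Z → ℝ} {E : ℝ} (b : RedFrame H) (q : ℝ → QS H E) : Prop :=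
  QS.IsHorizontal ħ q ∧ ∀ t, IsFlowImage H t b (q t).frame

/-- `E` is a regular value of `H` on `TS³`. -/
def IsRegularValue (H : Z → ℝ) (E : ℝ) : Prop :=
  ∀ z ∈ levelSet H E, ∃ u ∈ tangentTS3 z, fderiv ℝ H z u ≠ 0

/-- The regular value `E` is a quantized energy level of `(TS³, ω₃, H)`: the connection `δ_S` on `Q_S`
has trivial holonomy over all closed orbits of `φ̃^t` on `Sp(TS/TS^⊥)`. -/
def IsQuantizedEnergy (ħ : ℝ) (H : Z → ℝ) (E : ℝ) : Prop :=
  IsRegularValue H E ∧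
  ∀ b : RedFrame H, IsRedFrame H E b → ∀ T : ℝ, 0 < T → IsFlowImage H T b b →
    ∀ q : ℝ → QS H E, IsHorizontalLift ħ b q → q T = q 0

end MpcQuant

end

/-!
A closed geodesic of speed `l = √(2E)` on the unit sphere has period `2π / l`, and the holonomy of
`δ_S` over it splits into a dynamical part and a metaplectic part.

*Reduction to a scalar.* The frame at the initial time can be carried along the geodesic by a path of
symplectic matrices `transport` that maps the tangent spaces of `A`, `TS³` and `S` to the
corresponding spaces at time `t`, commutes with the differential of `orbitProj`, and agrees with the
derivative of the flow (the linear rotation `rot`) on the tangent spaces of `S`. A metaplectic lift of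
this path gives a reference curve in `Q_S` over the orbit, and any horizontal lift `q` differs from
the reference curve by a continuous `U(1)`-valued function `u`, since two points of `Q_S` over the same
frame differ by an element of `Mpᶜ(V 2)` over the identity (`exists_comparison`).

*The metaplectic part is trivial.* At the base point of the Siegel half space `det (c τ + d)` equals
`(cos(lt) - i l sin(lt))²` along `transport` (`det_den_transportMat`). Its continuous square root
closes up after one period, so the reference curve is a loop: there is no half-integer shift.

*The dynamical part.* The one-form `β₄` takes the value `-l²` on the velocity of the geodesic, so the
vanishing of the connection form determines the product of the determinants `η` along a lift, and hence
`u⁴` (the signs by which `ν̂` changes `η` disappear). By continuity `u(t) = u(0) exp(-i l² t / ħ)`,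
which is `horizontalLift_holonomy`.

*Quantization.* Over a period the phase is `exp(-2π i l / ħ)`. It is trivial exactly for `l = n ħ`;
the necessity of this condition also uses that a horizontal lift exists for each positive energy
(`exists_adapted`, `isHorizontalLift_transportFrame`) and that `Mpᶜ(V 2)` acts freely on `Q_S`, which
follows from the multiplicativity of `ν̂` (`nuHat_mul`).

Two facts about `Mpᶜ` recur: its elements are determined by the symplectic matrix and one value of
the function `φ` (`Mpc.ext_of_apply`), and along a smooth curve `φ` is jointly continuous in the time
and in the point of the Siegel half space (`Mpc.SmoothCurve.contCurve`), although smoothness is only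
required of the value at the base point. Both rest on the convexity of the Siegel half space.
-/

noncomputable section

namespace MpcQuant

variable {n : ℕ}

/-! ### Continuous square roots on the Siegel upper half space -/

lemma siegelSet_convex (n : ℕ) : Convex ℝ (siegelSet n) := by
  intro τ hτ σ hσ a b ha hb hab
  refine ⟨?_, ?_⟩
  · rw [transpose_add, transpose_smul, transpose_smul, hτ.1, hσ.1]
  · have e : (2 * Complex.I)⁻¹ • ((a • τ + b • σ) - (a • τ + b • σ)ᴴ) =
        a • ((2 * Complex.I)⁻¹ • (τ - τᴴ)) + b • ((2 * Complex.I)⁻¹ • (σ - σᴴ)) := by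
      rw [conjTranspose_add, conjTranspose_smul, conjTranspose_smul, star_trivial, star_trivial,
        smul_comm a, smul_comm b, ← smul_add]
      congr 1
      rw [smul_sub, smul_sub]
      abel
    rw [e]
    rcases ha.eq_or_lt with rfl | ha
    · have : b = 1 := by linarith
      rw [this, zero_smul, zero_add, one_smul]
      exact hσ.2
    · rcases hb.eq_or_lt with rfl | hb
      · have : a = 1 := by linarith
        rw [this, zero_smul, add_zero, one_smul]
        exact hτ.2
      · exact (hτ.2.smul ha).add (hσ.2.smul hb)

instance : PreconnectedSpace (Siegel n) :=
  Subtype.preconnectedSpace (siegelSet_convex n).isPreconnected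

/-- The point at parameter `s` of the segment from `τ` to `σ` in the Siegel upper half space. -/
def segPt (s : unitInterval) (τ σ : Siegel n) : Siegel n :=
  ⟨(1 - (s : ℝ)) • τ.1 + (s : ℝ) • σ.1,
    siegelSet_convex n τ.2 σ.2 (sub_nonneg.2 s.2.2) s.2.1 (by ring)⟩

lemma continuous_segPt :
    Continuous fun p : unitInterval × Siegel n × Siegel n => segPt p.1 p.2.1 p.2.2 := by
  unfold segPt
  fun_prop

lemma segPt_zero (τ σ : Siegel n) : segPt 0 τ σ = τ := by
  apply Subtype.ext; simp [segPt]

lemma segPt_one (τ σ : Siegel n) : segPt 1 τ σ = σ := by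
  apply Subtype.ext; simp [segPt]

/-- A nowhere zero continuous function on the Siegel upper half space has a continuous square root
with a prescribed value at one point. -/
lemma exists_continuous_sqrt {f : Siegel n → ℂ} (hf : Continuous f) (h0 : ∀ τ, f τ ≠ 0)
    (τ₀ : Siegel n) {s : ℂ} (hs : s ^ 2 = f τ₀) :
    ∃ φ : Siegel n → ℂ, Continuous φ ∧ (∀ τ, φ τ ^ 2 = f τ) ∧ φ τ₀ = s := by
  have hs0 : s ≠ 0 := by
    rintro rfl
    exact h0 τ₀ (by rw [← hs]; simp)
  -- The homotopy contracting `f` to the constant `f τ₀` along segments lifts through squaring.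
  have cov := isCoveringMap_npow (𝕜 := ℂ) 2 (by norm_num)
  let H : C(unitInterval × Siegel n, {x : ℂ // x ≠ 0}) :=
    ⟨fun p => ⟨f (segPt p.1 τ₀ p.2), h0 _⟩, by
      refine Continuous.subtype_mk (hf.comp ?_) _
      exact continuous_segPt.comp (continuous_fst.prodMk (continuous_const.prodMk continuous_snd))⟩
  let c : C(Siegel n, {x : ℂ // x ≠ 0}) := ⟨fun _ => ⟨s, hs0⟩, continuous_const⟩
  have H0 : ∀ τ, H (0, τ) = ⟨(c τ).1 ^ 2, pow_ne_zero 2 (c τ).2⟩ := fun τ => by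
    apply Subtype.ext
    change f (segPt 0 τ₀ τ) = s ^ 2
    rw [segPt_zero, hs]
  let L := cov.liftHomotopy H c H0
  have hL : ∀ p, ((L p : {x : ℂ // x ≠ 0}) : ℂ) ^ 2 = f (segPt p.1 τ₀ p.2) := fun p =>
    congrArg Subtype.val (congrFun (cov.liftHomotopy_lifts H c H0) p)
  refine ⟨fun τ => (L (1, τ)).1, by fun_prop, fun τ => ?_, ?_⟩
  · rw [hL, segPt_one]
  · -- over `τ₀` the homotopy is constant, and so is its lift
    have hconst : ∀ t : unitInterval, segPt t τ₀ τ₀ = τ₀ := fun t => by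
      apply Subtype.ext
      change (1 - (t : ℝ)) • τ₀.1 + (t : ℝ) • τ₀.1 = τ₀.1
      rw [← add_smul, sub_add_cancel, one_smul]
    have h := (isPreconnected_univ (α := unitInterval)).eq_of_sq_eq
      (f := fun t => (L (t, τ₀)).1) (g := fun _ => s) (by fun_prop) continuousOn_const
      (fun t _ => by
        change ((L (t, τ₀)).1) ^ 2 = s ^ 2
        rw [hL, hconst, hs]) (fun _ => hs0) (Set.mem_univ 0)
      (congrArg Subtype.val (cov.liftHomotopy_zero H c H0 τ₀))
    exact h (Set.mem_univ 1)

lemma continuous_det_den (g : Sp n) : Continuous fun τ : Siegel n => (den g τ.1).det := by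
  unfold den
  fun_prop

/-! ### The metaplectic-c group -/

lemma Mpc.mul_g (a b : Mpc n) : (a * b).g = a.g * b.g := rfl
lemma Mpc.one_g : (1 : Mpc n).g = 1 := rfl
lemma Mpc.one_φ (τ : Siegel n) : (1 : Mpc n).φ τ = 1 := rfl
lemma Mpc.inv_g (a : Mpc n) : a⁻¹.g = a.g⁻¹ := rfl

/-- An element of `Mpᶜ` is determined by its symplectic matrix and by the value of its function at
one point, because the Siegel upper half space is connected. -/
lemma Mpc.ext_of_apply {a b : Mpc n} (hg : a.g = b.g) {τ₀ : Siegel n} (hφ : a.φ τ₀ = b.φ τ₀) :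
    a = b := by
  have hη : a.η = b.η := by
    have h1 := a.sq τ₀
    rw [hφ, b.sq, hg] at h1
    exact Circle.ext (mul_right_cancel₀ (det_den_ne_zero _ _) h1).symm
  refine Mpc.ext hg (funext fun τ => ?_) hη
  refine (isPreconnected_univ (α := Siegel n)).eq_of_sq_eq a.cont.continuousOn b.cont.continuousOn
    (fun τ _ => ?_) (fun _ => b.ne_zero _) (Set.mem_univ τ₀) hφ (Set.mem_univ τ)
  simp only [Pi.pow_apply]
  rw [a.sq, b.sq, hg, hη]

/-- Every symplectic matrix has a metaplectic lift for each square root of `det (c τ₀ + d)`. -/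
lemma Mpc.exists_lift (g : Sp n) (τ₀ : Siegel n) {s : ℂ} (hs : s ^ 2 = (den g τ₀.1).det) :
    ∃ a : Mpc n, a.g = g ∧ a.φ τ₀ = s ∧ a.η = 1 := by
  obtain ⟨φ, h1, h2, h3⟩ := exists_continuous_sqrt (continuous_det_den g) (det_den_ne_zero g) τ₀ hs
  exact ⟨⟨g, φ, 1, h1, fun τ => by rw [h2]; simp⟩, rfl, h3, rfl⟩

lemma Mpc.eq_ofCircle {a : Mpc n} (hg : a.g = 1) (τ₀ : Siegel n) :
    ∃ u : Circle, a = ofCircle u ∧ (u : ℂ) = a.φ τ₀ := by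
  have h : ‖a.φ τ₀‖ = 1 := by
    have h1 := congrArg norm (a.sq τ₀)
    rw [hg, det_den_one, mul_one, norm_pow, Circle.norm_coe] at h1
    exact (pow_eq_one_iff_of_nonneg (norm_nonneg _) two_ne_zero).1 h1
  exact ⟨⟨a.φ τ₀, mem_sphere_zero_iff_norm.2 h⟩, Mpc.ext_of_apply hg (τ₀ := τ₀) rfl, rfl⟩

lemma ofCircle_φ (u : Circle) (τ : Siegel n) : (ofCircle u : Mpc n).φ τ = u := rfl
lemma ofCircle_η (u : Circle) : (ofCircle u : Mpc n).η = u ^ 2 := rfl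

lemma ofCircle_mul (u v : Circle) : (ofCircle (u * v) : Mpc n) = ofCircle u * ofCircle v :=
  Mpc.ext (mul_one 1).symm (funext fun _ => Circle.coe_mul u v) (mul_pow u v 2)

lemma ofCircle_one : (ofCircle 1 : Mpc n) = 1 :=
  Mpc.ext rfl (funext fun _ => Circle.coe_one) (one_pow 2)

lemma ofCircle_injective : Function.Injective (ofCircle : Circle → Mpc n) := fun _ _ h =>
  Circle.ext (congrFun (congrArg Mpc.φ h) (basePt n))

/-! ### Curves in the metaplectic-c group -/

lemma continuous_smul_of_continuous {T : Type*} [TopologicalSpace T] {g : T → Sp n}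
    {τ : T → Siegel n} (hg : Continuous fun t => (g t).1) (hτ : Continuous τ) :
    Continuous fun t => g t • τ t := by
  apply Continuous.subtype_mk
  have hc : Continuous fun t => cplx (g t) := hg.matrix_map Complex.continuous_ofReal
  have hv : Continuous fun t => (τ t).1 := continuous_subtype_val.comp hτ
  have hN : Continuous fun t => num (g t) (τ t).1 := by
    unfold num toBlocks₁₁ toBlocks₁₂
    fun_prop
  have hD : Continuous fun t => den (g t) (τ t).1 := by
    unfold den toBlocks₂₁ toBlocks₂₂
    fun_prop
  have hI : Continuous fun t => (den (g t) (τ t).1)⁻¹ := by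
    simp only [Matrix.inv_def, Ring.inverse_eq_inv']
    exact (hD.matrix_det.inv₀ fun t => det_den_ne_zero _ _).smul hD.matrix_adjugate
  exact hN.matrix_mul hI

lemma continuous_det_den_of_continuous {T : Type*} [TopologicalSpace T] {g : T → Sp n}
    {τ : T → Siegel n} (hg : Continuous fun t => (g t).1) (hτ : Continuous τ) :
    Continuous fun t => (den (g t) (τ t).1).det := by
  have hc : Continuous fun t => cplx (g t) := hg.matrix_map Complex.continuous_ofReal
  have hv : Continuous fun t => (τ t).1 := continuous_subtype_val.comp hτ
  unfold den toBlocks₂₁ toBlocks₂₂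
  fun_prop

lemma continuous_coe_inv {T : Type*} [TopologicalSpace T] {g : T → Sp n}
    (hg : Continuous fun t => (g t).1) : Continuous fun t => ((g t)⁻¹).1 := by
  simp only [SymplecticGroup.coe_inv]
  fun_prop

/-- A curve in `Mpᶜ` is continuous if its symplectic part is and its functions depend jointly
continuously on the time and on the point of the Siegel upper half space. -/
def Mpc.ContCurve (a : ℝ → Mpc n) : Prop :=
  (Continuous fun t => (a t).g.1) ∧ Continuous fun p : ℝ × Siegel n => (a p.1).φ p.2

lemma Mpc.ContCurve.apply {a : ℝ → Mpc n} (ha : Mpc.ContCurve a) {τ : ℝ → Siegel n}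
    (hτ : Continuous τ) : Continuous fun t => (a t).φ (τ t) :=
  ha.2.comp (continuous_id.prodMk hτ)

lemma Mpc.ContCurve.const (a : Mpc n) : Mpc.ContCurve fun _ => a :=
  ⟨continuous_const, a.cont.comp continuous_snd⟩

lemma Mpc.ContCurve.mul {a b : ℝ → Mpc n} (ha : Mpc.ContCurve a) (hb : Mpc.ContCurve b) :
    Mpc.ContCurve fun t => a t * b t := by
  refine ⟨ha.1.matrix_mul hb.1, Continuous.mul ?_ hb.2⟩
  exact ha.2.comp (continuous_fst.prodMk
    (continuous_smul_of_continuous (hb.1.comp continuous_fst) continuous_snd))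

lemma Mpc.ContCurve.inv {a : ℝ → Mpc n} (ha : Mpc.ContCurve a) :
    Mpc.ContCurve fun t => (a t)⁻¹ := by
  refine ⟨continuous_coe_inv ha.1, Continuous.inv₀ ?_ fun p => Mpc.ne_zero _ _⟩
  exact ha.2.comp (continuous_fst.prodMk (continuous_smul_of_continuous
    ((continuous_coe_inv ha.1).comp continuous_fst) continuous_snd))

lemma contDiff_det {m : ℕ} {M : ℝ → Matrix (Fin m) (Fin m) ℂ}
    (hM : ∀ i j, ContDiff ℝ ∞ fun t => M t i j) : ContDiff ℝ ∞ fun t => (M t).det := by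
  simp only [Matrix.det_apply]
  exact ContDiff.sum fun σ _ => (contDiff_prod fun i _ => hM _ _).const_smul _

lemma Mpc.SmoothCurve.det_den {a : ℝ → Mpc n} (ha : Mpc.SmoothCurve a) :
    ContDiff ℝ ∞ fun t => (den (a t).g (basePt n).1).det := by
  have hc : ∀ i j, ContDiff ℝ ∞ fun t => (((a t).g.1 i j : ℝ) : ℂ) := fun i j =>
    Complex.ofRealCLM.contDiff.comp (ha.1 i j)
  refine contDiff_det fun i j => ?_
  simp only [den, Matrix.add_apply, Matrix.mul_apply]
  exact (ContDiff.sum fun k _ => (hc _ _).mul contDiff_const).add (hc _ _)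

lemma Mpc.SmoothCurve.η {a : ℝ → Mpc n} (ha : Mpc.SmoothCurve a) :
    ContDiff ℝ ∞ fun t => ((a t).η : ℂ) := by
  have h : (fun t => ((a t).η : ℂ)) = fun t =>
      (a t).φ (basePt n) ^ 2 * ((den (a t).g (basePt n).1).det)⁻¹ := by
    funext t
    rw [(a t).sq, mul_assoc, mul_inv_cancel₀ (det_den_ne_zero _ _), mul_one]
  rw [h]
  exact (ha.2.pow 2).mul (ha.det_den.inv fun t => det_den_ne_zero _ _)

/-- Near a time `t₁`, the function of `a t` is the one of `a t₁` times the principal square root of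
the quotient of their squares: this holds at the base point, and along segments from it the
quotient stays close to `1`. -/
lemma Mpc.SmoothCurve.contCurve {a : ℝ → Mpc n} (ha : Mpc.SmoothCurve a) : Mpc.ContCurve a := by
  have hg : Continuous fun t => (a t).g.1 := continuous_matrix fun i j => (ha.1 i j).continuous
  refine ⟨hg, continuous_iff_continuousAt.2 ?_⟩
  rintro ⟨t₁, τ₁⟩
  let Q : ℝ × Siegel n → ℂ := fun p => (a p.1).φ p.2 ^ 2 / (a t₁).φ p.2 ^ 2
  have hQ : Continuous Q := by
    refine Continuous.div ?_ (((a t₁).cont.comp continuous_snd).pow 2)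
      fun p => pow_ne_zero 2 (Mpc.ne_zero _ _)
    simp only [Mpc.sq]
    exact (ha.η.continuous.comp continuous_fst).mul
      (continuous_det_den_of_continuous (hg.comp continuous_fst) continuous_snd)
  have hQ1 : ∀ σ, Q (t₁, σ) = 1 := fun σ => div_self (pow_ne_zero 2 (Mpc.ne_zero _ _))
  let S : ℝ × Siegel n → ℂ := fun p => Q p ^ (((2 : ℕ) : ℂ)⁻¹)
  have hS2 : ∀ p, S p ^ 2 = Q p := fun p => Complex.cpow_nat_inv_pow _ two_ne_zero
  have hSc : ∀ p, Q p ∈ Complex.slitPlane → ContinuousAt S p := fun p hp =>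
    (hQ.continuousAt).cpow continuousAt_const hp
  have hS1 : ∀ σ, S (t₁, σ) = 1 := fun σ => by simp only [S, hQ1, Complex.one_cpow]
  let o := basePt n
  have hev1 : ∀ᶠ p in nhds (t₁, τ₁), ∀ s ∈ (Set.univ : Set unitInterval),
      Q (p.1, segPt s o p.2) ∈ Complex.slitPlane := by
    refine isCompact_univ.eventually_forall_of_forall_eventually fun s _ => ?_
    have hc : Continuous fun z : (ℝ × Siegel n) × unitInterval => Q (z.1.1, segPt z.2 o z.1.2) := by
      refine hQ.comp ((continuous_fst.comp continuous_fst).prodMk (continuous_segPt.comp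
        (continuous_snd.prodMk (continuous_const.prodMk (continuous_snd.comp continuous_fst)))))
    refine hc.continuousAt.eventually (Complex.isOpen_slitPlane.mem_nhds ?_)
    change Q (t₁, _) ∈ _
    rw [hQ1]
    exact Complex.one_mem_slitPlane
  have hev2 : ∀ᶠ p in nhds (t₁, τ₁), (a p.1).φ o / (a t₁).φ o = S (p.1, o) := by
    have h1 : ContinuousAt (fun t => (a t).φ o / (a t₁).φ o + S (t, o)) t₁ := by
      refine (ha.2.continuous.div_const _).continuousAt.add ?_
      refine ContinuousAt.comp (f := fun t : ℝ => (t, o)) (hSc (t₁, o) ?_)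
        (by fun_prop)
      rw [hQ1]
      exact Complex.one_mem_slitPlane
    have h2 : ∀ᶠ t in nhds t₁, (a t).φ o / (a t₁).φ o + S (t, o) ≠ 0 := by
      refine h1.eventually_ne ?_
      rw [hS1, div_self (Mpc.ne_zero _ _)]
      norm_num
    have h3 : ∀ᶠ t in nhds t₁, (a t).φ o / (a t₁).φ o = S (t, o) := by
      filter_upwards [h2] with t ht
      have h4 : ((a t).φ o / (a t₁).φ o) ^ 2 = S (t, o) ^ 2 := by rw [hS2, div_pow]
      rcases sq_eq_sq_iff_eq_or_eq_neg.1 h4 with h5 | h5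
      · exact h5
      · exact absurd (by rw [h5, neg_add_cancel]) ht
    exact (continuous_fst.tendsto (t₁, τ₁)).eventually h3
  have hev : ∀ᶠ p in nhds (t₁, τ₁), (a p.1).φ p.2 = (a t₁).φ p.2 * S p := by
    filter_upwards [hev1, hev2] with p hp1 hp2
    have hseg : Continuous fun s : unitInterval => segPt s o p.2 :=
      continuous_segPt.comp (continuous_id.prodMk (continuous_const.prodMk continuous_const))
    have h := (isPreconnected_univ (α := unitInterval)).eq_of_sq_eq
      (f := fun s => (a p.1).φ (segPt s o p.2) / (a t₁).φ (segPt s o p.2))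
      (g := fun s => S (p.1, segPt s o p.2))
      (((a p.1).cont.comp hseg).div ((a t₁).cont.comp hseg)
        fun _ => Mpc.ne_zero _ _).continuousOn
      (continuous_iff_continuousAt.2 fun s => ContinuousAt.comp
        (f := fun s : unitInterval => (p.1, segPt s o p.2)) (hSc _ (hp1 s trivial))
        (continuous_const.prodMk hseg).continuousAt).continuousOn
      (fun s _ => by
        change ((a p.1).φ _ / (a t₁).φ _) ^ 2 = S _ ^ 2
        rw [hS2, div_pow])
      (fun {s} _ h0 => by
        have h1 := hS2 (p.1, segPt s o p.2)
        rw [h0, zero_pow two_ne_zero] at h1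
        exact Complex.slitPlane_ne_zero (hp1 s trivial) h1.symm)
      (Set.mem_univ 0) (by
        simp only [segPt_zero]
        exact hp2)
    have h1 := h (Set.mem_univ 1)
    simp only [segPt_one] at h1
    rw [← h1, mul_div_cancel₀ _ (Mpc.ne_zero _ _)]
  refine ContinuousAt.congr_of_eventuallyEq ?_ hev
  refine ((a t₁).cont.comp continuous_snd).continuousAt.mul (hSc _ ?_)
  rw [hQ1]
  exact Complex.one_mem_slitPlane

lemma continuous_extMat : Continuous fun τ : Siegel n =>
    (⟨extMat τ.1, extMat_mem τ⟩ : Siegel (n + 1)) := by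
  refine Continuous.subtype_mk (continuous_matrix fun i j => ?_) _
  induction i using Fin.lastCases <;> induction j using Fin.lastCases <;>
    simp only [extMat_cc, extMat_cl, extMat_lc, extMat_ll]
  · exact continuous_const
  · exact continuous_const
  · exact continuous_const
  · exact continuous_subtype_val.matrix_elem _ _

lemma Mpc.ContCurve.nuHat {a : ℝ → MpcW n} (ha : Mpc.ContCurve fun t => (a t).1) :
    Mpc.ContCurve fun t => nuHat (a t) := by
  refine ⟨ha.1.matrix_submatrix _ _, Continuous.mul (Continuous.inv₀ ?_ fun p => ?_) ?_⟩
  · exact Complex.continuous_ofReal.comp (Real.continuous_sqrt.comp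
      (continuous_abs.comp ((ha.1.matrix_elem _ _).comp continuous_fst)))
  · rw [Complex.ofReal_ne_zero, Real.sqrt_ne_zero']
    exact abs_pos.2 (corner_ne_zero (a p.1).2)
  · exact ha.2.comp (continuous_fst.prodMk (continuous_extMat.comp continuous_snd))

lemma nuHat_η_sq (a : MpcW n) : (nuHat a).η ^ 2 = a.1.η ^ 2 := by
  change (if 0 < corner a then a.1.η else Circle.exp Real.pi * a.1.η) ^ 2 = _
  split_ifs
  · rfl
  · rw [mul_pow, sq (Circle.exp Real.pi), ← Circle.exp_add, ← two_mul, Circle.exp_two_pi, one_mul]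

/-! ### The homomorphism `ν̂` and the associated bundle -/

lemma toLin_one_apply (u : V n) : toLin (1 : Sp n) u = u := by simp [toLin]

lemma toLin_mul_apply (g h : Sp n) (u : V n) : toLin (g * h) u = toLin g (toLin h u) := by
  rw [toLin_mul]; rfl

lemma toLin_injective (g : Sp n) : Function.Injective (toLin g) := fun u v h => by
  have := congrArg (toLin g⁻¹) h
  rwa [← toLin_mul_apply, ← toLin_mul_apply, inv_mul_cancel, toLin_one_apply,
    toLin_one_apply] at this

lemma sp_ext {g h : Sp n} (H : ∀ u, toLin g u = toLin h u) : g = h := by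
  apply Subtype.ext
  apply Matrix.mulVec_injective
  exact funext H

/-- An element of `Sp(V; W)` maps `W` onto `W`, by comparison of dimensions. -/
lemma map_W_eq {g : Sp (n + 1)} (hg : g ∈ spW n) : Submodule.map (toLin g) (W n) = W n := by
  apply Submodule.eq_of_le_of_finrank_eq
  · rintro _ ⟨u, hu, rfl⟩
    exact hg u hu
  · exact (Submodule.equivMapOfInjective _ (toLin_injective g) _).symm.finrank_eq

lemma inv_mem_spW {g : Sp (n + 1)} (hg : g ∈ spW n) : g⁻¹ ∈ spW n := fun u hu => by
  rw [← map_W_eq hg] at hu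
  obtain ⟨v, hv, rfl⟩ := hu
  rwa [← toLin_mul_apply, inv_mul_cancel, toLin_one_apply]

lemma mul_mem_spW {g h : Sp (n + 1)} (hg : g ∈ spW n) (hh : h ∈ spW n) : g * h ∈ spW n :=
  fun u hu => by
    rw [toLin_mul_apply]
    exact hg _ (hh u hu)

lemma one_mem_spW : (1 : Sp (n + 1)) ∈ spW n := fun u hu => by rwa [toLin_one_apply]

lemma det_den_corner {g : Sp (n + 1)} (hg : g ∈ spW n) (σ : Matrix (Fin (n + 1)) (Fin (n + 1)) ℂ) :
    (den g σ).det = ((g.1 (Sum.inr (Fin.last n)) (Sum.inr (Fin.last n)) : ℝ) : ℂ) *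
      (den (nu ⟨g, hg⟩) (σ.submatrix Fin.castSucc Fin.castSucc)).det := by
  have hrow : ∀ j, den g σ (Fin.last n) (Fin.castSucc j) = 0 := by
    intro j
    simp [den, Matrix.mul_apply, toBlocks₂₁, toBlocks₂₂, cplx,
      row_last hg _ (by simp : Sum.inl _ ≠ _), row_last hg (Sum.inr (Fin.castSucc j))
      (by simp [Fin.castSucc_ne_last])]
  have hcorner : den g σ (Fin.last n) (Fin.last n) =
      ((g.1 (Sum.inr (Fin.last n)) (Sum.inr (Fin.last n)) : ℝ) : ℂ) := by
    simp [den, Matrix.mul_apply, toBlocks₂₁, toBlocks₂₂, cplx,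
      row_last hg _ (by simp : Sum.inl _ ≠ _)]
  have hcol : ∀ i : Fin n, g.1 (Sum.inr (Fin.castSucc i)) (Sum.inl (Fin.last n)) = 0 := fun i =>
    col_last_zero hg _ (by simp)
  have hsub : (den g σ).submatrix Fin.castSucc Fin.castSucc =
      den (nu ⟨g, hg⟩) (σ.submatrix Fin.castSucc Fin.castSucc) := by
    ext i j
    simp [den, Matrix.mul_apply, toBlocks₂₁, toBlocks₂₂, cplx, nu, cut, Fin.sum_univ_castSucc,
      hcol]
  rw [Matrix.det_succ_row _ (Fin.last n), Fin.sum_univ_castSucc,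
    Finset.sum_eq_zero (fun j _ => by rw [hrow]; simp), zero_add, hcorner, ← hsub]
  simp [Fin.succAbove_last, ← two_mul]

/-- The function of an element of `Mpᶜ(V; W)` depends only on the upper left block: along a segment
with constant upper left block its square is constant. -/
lemma MpcW.φ_eq_of_block (a : MpcW n) {σ σ' : Siegel (n + 1)}
    (h : σ.1.submatrix Fin.castSucc Fin.castSucc = σ'.1.submatrix Fin.castSucc Fin.castSucc) :
    a.1.φ σ = a.1.φ σ' := by
  have hseg : Continuous fun s : unitInterval => segPt s σ σ' :=
    continuous_segPt.comp (continuous_id.prodMk (continuous_const.prodMk continuous_const))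
  have hb : ∀ s : unitInterval, (segPt s σ σ').1.submatrix Fin.castSucc Fin.castSucc =
      σ.1.submatrix Fin.castSucc Fin.castSucc := fun s => by
    have : (segPt s σ σ').1.submatrix Fin.castSucc Fin.castSucc =
        (1 - (s : ℝ)) • σ.1.submatrix Fin.castSucc Fin.castSucc +
          (s : ℝ) • σ'.1.submatrix Fin.castSucc Fin.castSucc := rfl
    rw [this, ← h, ← add_smul, sub_add_cancel, one_smul]
  have h1 := (isPreconnected_univ (α := unitInterval)).eq_of_sq_eq
    (f := fun s => a.1.φ (segPt s σ σ')) (g := fun _ => a.1.φ σ)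
    (a.1.cont.comp hseg).continuousOn continuousOn_const
    (fun s _ => by
      simp only [Pi.pow_apply]
      rw [a.1.sq, a.1.sq, det_den_corner a.2, det_den_corner a.2, hb])
    (fun _ => a.1.ne_zero _) (Set.mem_univ 0) (by simp only [segPt_zero]) (Set.mem_univ 1)
  simp only [segPt_one] at h1
  exact h1.symm

/-- Passing to the upper left block intertwines `g ∈ Sp(V; W)` with `ν(g)`. This is what makes `ν̂`
multiplicative. -/
lemma block_smul {g : Sp (n + 1)} (hg : g ∈ spW n) (τ : Siegel n) :
    (g • (⟨extMat τ.1, extMat_mem τ⟩ : Siegel (n + 1))).1.submatrix Fin.castSucc Fin.castSucc =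
      (nu ⟨g, hg⟩ • τ).1 := by
  set x := (g • (⟨extMat τ.1, extMat_mem τ⟩ : Siegel (n + 1))) with hx
  have hD : IsUnit (den g (extMat τ.1)).det := (det_den_ne_zero g ⟨_, extMat_mem τ⟩).isUnit
  have e : x.1 * den g (extMat τ.1) = num g (extMat τ.1) := by
    rw [hx, coe_smul, Matrix.mul_assoc, Matrix.nonsing_inv_mul _ hD, Matrix.mul_one]
  have hD' : IsUnit (den (nu ⟨g, hg⟩) τ.1).det := (det_den_ne_zero _ τ).isUnit
  have e' : x.1.submatrix Fin.castSucc Fin.castSucc * den (nu ⟨g, hg⟩) τ.1 =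
      num (nu ⟨g, hg⟩) τ.1 := by
    ext i j
    have h := congrFun (congrFun e i.castSucc) j.castSucc
    have hrow : den g (extMat τ.1) (Fin.last n) (Fin.castSucc j) = 0 := by
      simp [den, Matrix.mul_apply, toBlocks₂₁, toBlocks₂₂, cplx,
        row_last hg _ (by simp : Sum.inl _ ≠ _), row_last hg (Sum.inr (Fin.castSucc j))
        (by simp [Fin.castSucc_ne_last])]
    have hD2 : ∀ k : Fin n, den g (extMat τ.1) k.castSucc j.castSucc =
        den (nu ⟨g, hg⟩) τ.1 k j := fun k => by
      simp [den, Matrix.mul_apply, toBlocks₂₁, toBlocks₂₂, cplx, nu, cut, Fin.sum_univ_castSucc,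
        extMat_cc, extMat_lc]
    have hN2 : num g (extMat τ.1) i.castSucc j.castSucc = num (nu ⟨g, hg⟩) τ.1 i j := by
      simp [num, Matrix.mul_apply, toBlocks₁₁, toBlocks₁₂, cplx, nu, cut, Fin.sum_univ_castSucc,
        extMat_cc, extMat_lc]
    rw [Matrix.mul_apply, Fin.sum_univ_castSucc, hrow, mul_zero, add_zero, hN2] at h
    rw [← h, Matrix.mul_apply]
    exact Finset.sum_congr rfl fun k _ => by rw [hD2]; rfl
  rw [coe_smul (nu ⟨g, hg⟩), ← e', Matrix.mul_assoc, Matrix.mul_nonsing_inv _ hD', Matrix.mul_one]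

instance : Mul (MpcW n) := ⟨fun a b => ⟨a.1 * b.1, mul_mem_spW a.2 b.2⟩⟩
instance : One (MpcW n) := ⟨⟨1, one_mem_spW⟩⟩
instance : Inv (MpcW n) := ⟨fun a => ⟨a.1⁻¹, inv_mem_spW a.2⟩⟩

lemma corner_mul (a b : MpcW n) : corner (a * b) = corner a * corner b := by
  change (a.1.g.1 * b.1.g.1) _ _ = _
  rw [Matrix.mul_apply, Fintype.sum_sum_type, Fin.sum_univ_castSucc, Fin.sum_univ_castSucc]
  simp [row_last a.2 _ (by simp : Sum.inl _ ≠ _), corner,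
    row_last a.2 (Sum.inr (Fin.castSucc _)) (by simp [Fin.castSucc_ne_last])]

lemma nu_mul (g h : spW n) : nu ⟨g.1 * h.1, mul_mem_spW g.2 h.2⟩ = nu g * nu h := by
  apply Subtype.ext
  ext i j
  change (g.1.1 * h.1.1) (cut n i) (cut n j) = (nu g).1 i ⬝ᵥ fun k => (nu h).1 k j
  rw [Matrix.mul_apply, Fintype.sum_sum_type, Fin.sum_univ_castSucc, Fin.sum_univ_castSucc,
    col_last_zero g.2 _ (cut_ne_inl i), row_last h.2 (cut n j) (by
      rcases j with j | j <;> simp [cut, Fin.castSucc_ne_last])]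
  simp [dotProduct, Fintype.sum_sum_type, nu, cut]

lemma nuHat_mul (a b : MpcW n) : nuHat (a * b) = nuHat a * nuHat b := by
  refine Mpc.ext_of_apply (τ₀ := basePt n) (nu_mul ⟨a.1.g, a.2⟩ ⟨b.1.g, b.2⟩) ?_
  change ((Real.sqrt |corner (a * b)| : ℝ) : ℂ)⁻¹ * (a.1.φ (b.1.g • _) * b.1.φ _) =
    ((Real.sqrt |corner a| : ℝ) : ℂ)⁻¹ * a.1.φ _ * (((Real.sqrt |corner b| : ℝ) : ℂ)⁻¹ * b.1.φ _)
  rw [corner_mul, abs_mul, Real.sqrt_mul (abs_nonneg _), Complex.ofReal_mul, mul_inv,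
    a.φ_eq_of_block (σ' := ⟨extMat (nu ⟨b.1.g, b.2⟩ • basePt n).1, extMat_mem _⟩)
      (by
        rw [block_smul b.2]
        ext i j
        exact (extMat_cc _ _ _).symm)]
  change _ = _ * a.1.φ ⟨extMat (nu ⟨b.1.g, b.2⟩ • basePt n).1, extMat_mem _⟩ * _
  ring

lemma nuHat_one : nuHat (1 : MpcW n) = 1 := by
  refine Mpc.ext_of_apply (τ₀ := basePt n) ?_ ?_
  · apply Subtype.ext
    ext i j
    change (1 : Matrix _ _ ℝ) (cut n i) (cut n j) = (1 : Matrix _ _ ℝ) i j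
    rcases i with i | i <;> rcases j with j | j <;> simp [cut, Matrix.one_apply]
  · have : corner (1 : MpcW n) = 1 := by
      change (1 : Matrix _ _ ℝ) _ _ = 1
      simp
    change ((Real.sqrt |corner (1 : MpcW n)| : ℝ) : ℂ)⁻¹ * 1 = 1
    simp [this]

section

variable {P : Type} {ρ : P → Mpc (n + 1) → P} {ad : Set P}

/-- The identifications that define the associated bundle already form an equivalence relation. -/
lemma Assoc.exists_of_mk_eq (h1 : ∀ p, ρ p 1 = p) (hm : ∀ p g h, ρ (ρ p g) h = ρ p (g * h))
    {p p' : ad} {c c' : Mpc n} (h : (Assoc.mk p' c' : Assoc ρ ad) = Assoc.mk p c) :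
    ∃ a : MpcW n, p'.1 = ρ p.1 a.1 ∧ c = nuHat a * c' := by
  have key : ∀ x y : ad × Mpc n, Relation.EqvGen (AssocRel ρ ad) x y →
      ∃ a : MpcW n, x.1.1 = ρ y.1.1 a.1 ∧ y.2 = nuHat a * x.2 := by
    intro x y hxy
    induction hxy with
    | rel x y hr =>
      obtain ⟨p, p', a, c, hp⟩ := hr
      exact ⟨a, hp, rfl⟩
    | refl x => exact ⟨1, (h1 _).symm, by rw [nuHat_one, one_mul]⟩
    | symm x y _ ih =>
      obtain ⟨a, e1, e2⟩ := ih
      have e : (a * a⁻¹ : MpcW n) = 1 := Subtype.ext (mul_inv_cancel a.1)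
      have e' : (a⁻¹ * a : MpcW n) = 1 := Subtype.ext (inv_mul_cancel a.1)
      refine ⟨a⁻¹, ?_, ?_⟩
      · rw [e1, hm]
        exact ((congrArg (fun b : MpcW n => ρ y.1.1 b.1) e).trans (h1 _)).symm
      · rw [e2, ← mul_assoc, ← nuHat_mul, e', nuHat_one, one_mul]
    | trans x y z _ _ ih1 ih2 =>
      obtain ⟨a, e1, e2⟩ := ih1
      obtain ⟨b, e3, e4⟩ := ih2
      refine ⟨b * a, ?_, ?_⟩
      · rw [e1, e3, hm]; rfl
      · rw [e4, e2, nuHat_mul, mul_assoc]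
  exact key _ _ (Quot.eqvGen_exact h)

lemma Assoc.act_one (q : Assoc ρ ad) : Assoc.act q (1 : Mpc n) = q := by
  obtain ⟨⟨p, c⟩, rfl⟩ := Quot.exists_rep q
  exact congrArg (fun c => Assoc.mk p c) (mul_one c)

lemma Assoc.act_mul (q : Assoc ρ ad) (c d : Mpc n) :
    Assoc.act (Assoc.act q c) d = Assoc.act q (c * d) := by
  obtain ⟨⟨p, b⟩, rfl⟩ := Quot.exists_rep q
  exact congrArg (fun c => Assoc.mk p c) (mul_assoc b c d)

lemma Assoc.eq_one_of_act_eq (h1 : ∀ p, ρ p 1 = p) (hm : ∀ p g h, ρ (ρ p g) h = ρ p (g * h))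
    (hf : ∀ p g, ρ p g = p → g = 1) {q : Assoc ρ ad} {c : Mpc n} (h : Assoc.act q c = q) :
    c = 1 := by
  obtain ⟨⟨p, b⟩, rfl⟩ := Quot.exists_rep q
  obtain ⟨a, e1, e2⟩ := Assoc.exists_of_mk_eq h1 hm (p := p) (p' := p) (c := b) (c' := b * c) h
  have ha : a = 1 := Subtype.ext (hf _ _ e1.symm)
  rw [ha, nuHat_one, one_mul] at e2
  exact mul_left_cancel (e2.symm.trans (mul_one b).symm)

end

lemma Q4.act_one (q : Q4) : Q4.act q 1 = q := Prod.ext rfl (mul_one _)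
lemma Q4.act_mul (q : Q4) (g h : Mpc 4) : Q4.act (Q4.act q g) h = Q4.act q (g * h) :=
  Prod.ext rfl (mul_assoc _ _ _)
lemma Q4.eq_one_of_act_eq (q : Q4) (g : Mpc 4) (h : Q4.act q g = q) : g = 1 :=
  mul_left_cancel ((congrArg Prod.snd h).trans (mul_one _).symm)

lemma Q.act_one (q : Q) : Q.act q 1 = q := Subtype.ext (Assoc.act_one _)
lemma Q.act_mul (q : Q) (g h : Mpc 3) : Q.act (Q.act q g) h = Q.act q (g * h) :=
  Subtype.ext (Assoc.act_mul _ _ _)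
lemma Q.eq_one_of_act_eq (q : Q) (g : Mpc 3) (h : Q.act q g = q) : g = 1 :=
  Assoc.eq_one_of_act_eq Q4.act_one Q4.act_mul Q4.eq_one_of_act_eq (congrArg Subtype.val h)

/-- `Mpᶜ(V 2)` acts freely on `Q_S`. -/
lemma QS.eq_one_of_act_eq {H : Z → ℝ} {E : ℝ} {q : QS H E} {d : Mpc 2} (h : q.act d = q) : d = 1 :=
  Assoc.eq_one_of_act_eq Q.act_one Q.act_mul Q.eq_one_of_act_eq h

/-! ### The geodesic flow on the sphere -/

lemma X_elim (a b : Fin 4 → ℝ) : X (Sum.elim a b) = a := rfl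
lemma Y_elim (a b : Fin 4 → ℝ) : Y (Sum.elim a b) = b := rfl
lemma X_add (u v : Z) : X (u + v) = X u + X v := rfl
lemma Y_add (u v : Z) : Y (u + v) = Y u + Y v := rfl
lemma X_smul (r : ℝ) (u : Z) : X (r • u) = r • X u := rfl
lemma Y_smul (r : ℝ) (u : Z) : Y (r • u) = r • Y u := rfl
lemma X_sub (u v : Z) : X (u - v) = X u - X v := rfl
lemma Y_sub (u v : Z) : Y (u - v) = Y u - Y v := rfl

lemma Z_ext {u v : Z} (hX : X u = X v) (hY : Y u = Y v) : u = v := by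
  ext i
  rcases i with i | i
  · exact congrFun hX i
  · exact congrFun hY i

lemma hasDerivAt_YY (z w : Z) :
    HasDerivAt (fun s : ℝ => Y (z + s • w) ⬝ᵥ Y (z + s • w)) (2 * (Y z ⬝ᵥ Y w)) 0 := by
  have := HasDerivAt.fun_sum (u := Finset.univ)
    (fun j _ => (hasDerivAt_Y z w j).mul (hasDerivAt_Y z w j))
  refine HasDerivAt.congr_deriv (f := fun s : ℝ => Y (z + s • w) ⬝ᵥ Y (z + s • w)) this ?_
  simp only [zero_smul, add_zero, dotProduct, Finset.mul_sum]
  exact Finset.sum_congr rfl fun j _ => by ring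

lemma fderiv_K (z w : Z) : fderiv ℝ K z w = Y z ⬝ᵥ Y w := by
  refine fderiv_eq_of_line ?_ ?_
  · have := differentiable_Y
    unfold K dotProduct
    fun_prop
  · have := (hasDerivAt_YY z w).const_mul (1 / 2 : ℝ)
    refine HasDerivAt.congr_deriv (f := fun s : ℝ => K (z + s • w)) this ?_
    ring

lemma fderiv_c₁ (z w : Z) : fderiv ℝ c₁ z w = X z ⬝ᵥ X w := by
  refine fderiv_eq_of_line ?_ ?_
  · have := differentiable_X
    unfold c₁ dotProduct
    fun_prop
  · have := ((hasDerivAt_XX z w).sub_const 1).const_mul (1 / 2 : ℝ)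
    refine HasDerivAt.congr_deriv (f := fun s : ℝ => c₁ (z + s • w)) this ?_
    ring

lemma fderiv_c₂ (z w : Z) : fderiv ℝ c₂ z w = X w ⬝ᵥ Y z + X z ⬝ᵥ Y w := by
  refine fderiv_eq_of_line ?_ (hasDerivAt_XY z w)
  have := differentiable_X
  have := differentiable_Y
  unfold c₂ dotProduct
  fun_prop

lemma mem_tangentA {z u : Z} : u ∈ tangentA z ↔ X z ⬝ᵥ X u = 0 := by
  rw [← fderiv_R]; rfl

lemma mem_tangentTS3 {z u : Z} :
    u ∈ tangentTS3 z ↔ X z ⬝ᵥ X u = 0 ∧ X u ⬝ᵥ Y z + X z ⬝ᵥ Y u = 0 := by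
  rw [← fderiv_c₁, ← fderiv_c₂]; rfl

lemma mem_tangentLevel {z u : Z} :
    u ∈ tangentLevel K z ↔
      (X z ⬝ᵥ X u = 0 ∧ X u ⬝ᵥ Y z + X z ⬝ᵥ Y u = 0) ∧ Y z ⬝ᵥ Y u = 0 := by
  rw [← mem_tangentTS3, ← fderiv_K]; rfl

/-- The Hamiltonian vector field of `K` on `TS³`. -/
def hamVec (z : Z) : Z := Sum.elim (Y z) (-(Y z ⬝ᵥ Y z) • X z)

/-- The form `ω₃` is nondegenerate on `T_zTS³`. -/
lemma eq_zero_of_orthogonal {z η : Z} (hz : z ∈ TS3) (hη : η ∈ tangentTS3 z)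
    (h : ∀ u ∈ tangentTS3 z, Ω η u = 0) : η = 0 := by
  obtain ⟨hxx, hxy⟩ := hz
  obtain ⟨h1, h2⟩ := mem_tangentTS3.1 hη
  have hX : X η = 0 := by
    have h3 := h (Sum.elim 0 (X η)) (mem_tangentTS3.2 (by simp [X_elim, Y_elim, h1]))
    rw [Ω_XY, X_elim, Y_elim, dotProduct_zero, sub_zero] at h3
    exact dotProduct_self_eq_zero.1 h3
  have hxY : X z ⬝ᵥ Y η = 0 := by simpa [hX] using h2
  have hY : Y η = 0 := by
    have h3 := h (Sum.elim (Y η) (-(Y η ⬝ᵥ Y z) • X z)) (mem_tangentTS3.2 (by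
      simp [X_elim, Y_elim, hxY, hxx]))
    rw [Ω_XY, X_elim, Y_elim, hX, zero_dotProduct, zero_sub, neg_eq_zero] at h3
    exact dotProduct_self_eq_zero.1 h3
  exact Z_ext hX hY

lemma isHamVec_hamVec {z : Z} (hz : z ∈ TS3) : IsHamVec K z (hamVec z) := by
  obtain ⟨hxx, hxy⟩ := hz
  refine ⟨mem_tangentTS3.2 ?_, fun u hu => ?_⟩
  · simp only [hamVec, X_elim, Y_elim, dotProduct_smul, hxx, hxy]
    simp
  · obtain ⟨h1, h2⟩ := mem_tangentTS3.1 hu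
    rw [fderiv_K, Ω_XY]
    simp only [hamVec, X_elim, Y_elim, smul_dotProduct, h1]
    simp

lemma isHamVec_iff {z ξ : Z} (hz : z ∈ TS3) : IsHamVec K z ξ ↔ ξ = hamVec z := by
  constructor
  · intro h
    have h' := isHamVec_hamVec hz
    refine sub_eq_zero.1 (eq_zero_of_orthogonal hz (sub_mem h.1 h'.1) fun u hu => ?_)
    have : Ω (ξ - hamVec z) u = Ω ξ u - Ω (hamVec z) u := by
      simp only [Ω_XY, X_sub, Y_sub, sub_dotProduct]
      ring
    rw [this, h.2 u hu, h'.2 u hu, sub_self]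
  · rintro rfl
    exact isHamVec_hamVec hz

/-- The rotation `x ↦ cos(lt) x + sin(lt) y / l`, `y ↦ -l sin(lt) x + cos(lt) y`. It is the geodesic
flow at speed `l`, extended linearly to `Z`. -/
def rot (l t : ℝ) : Z →ₗ[ℝ] Z where
  toFun u := Sum.elim (Real.cos (l * t) • X u + (Real.sin (l * t) / l) • Y u)
    (-(l * Real.sin (l * t)) • X u + Real.cos (l * t) • Y u)
  map_add' u v := by
    apply Z_ext <;> simp only [X_elim, Y_elim, X_add, Y_add, smul_add] <;> abel
  map_smul' r u := by
    apply Z_ext <;> simp only [X_elim, Y_elim, X_smul, Y_smul, smul_add, RingHom.id_apply,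
      smul_comm r]

lemma X_rot (l t : ℝ) (u : Z) :
    X (rot l t u) = Real.cos (l * t) • X u + (Real.sin (l * t) / l) • Y u := rfl
lemma Y_rot (l t : ℝ) (u : Z) :
    Y (rot l t u) = -(l * Real.sin (l * t)) • X u + Real.cos (l * t) • Y u := rfl

lemma rot_of_cos_eq_one {l t : ℝ} (h : Real.cos (l * t) = 1) (u : Z) : rot l t u = u := by
  have hs : Real.sin (l * t) = 0 := by
    have := Real.sin_sq_add_cos_sq (l * t)
    rw [h] at this
    nlinarith
  apply Z_ext
  · rw [X_rot, h, hs]; simp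
  · rw [Y_rot, h, hs]; simp

lemma rot_zero (l : ℝ) (u : Z) : rot l 0 u = u := rot_of_cos_eq_one (by simp) u

lemma rot_neg_rot {l : ℝ} (hl : l ≠ 0) (t : ℝ) (u : Z) : rot l (-t) (rot l t u) = u := by
  have h := Real.sin_sq_add_cos_sq (l * t)
  apply Z_ext
  · ext j
    simp only [X_rot, Y_rot, mul_neg, Real.cos_neg, Real.sin_neg, Pi.add_apply, Pi.smul_apply,
      smul_eq_mul]
    field_simp
    linear_combination (l * X u j) * h
  · ext j
    simp only [X_rot, Y_rot, mul_neg, Real.cos_neg, Real.sin_neg, Pi.add_apply, Pi.smul_apply,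
      smul_eq_mul]
    field_simp
    linear_combination (Y u j) * h

lemma rot_rot_neg {l : ℝ} (hl : l ≠ 0) (t : ℝ) (u : Z) : rot l t (rot l (-t) u) = u := by
  simpa using rot_neg_rot hl (-t) u

section dotProducts

variable (l t : ℝ) (u v : Z)

lemma X_rot_dot_X_rot : X (rot l t u) ⬝ᵥ X (rot l t v) =
    Real.cos (l * t) ^ 2 * (X u ⬝ᵥ X v) + (Real.sin (l * t) / l) ^ 2 * (Y u ⬝ᵥ Y v) +
      Real.cos (l * t) * (Real.sin (l * t) / l) * (X u ⬝ᵥ Y v + Y u ⬝ᵥ X v) := by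
  simp only [X_rot, add_dotProduct, dotProduct_add, smul_dotProduct, dotProduct_smul, smul_eq_mul]
  ring

lemma X_rot_dot_Y_rot : X (rot l t u) ⬝ᵥ Y (rot l t v) =
    Real.cos (l * t) ^ 2 * (X u ⬝ᵥ Y v) - l * Real.sin (l * t) * (Real.sin (l * t) / l) *
      (Y u ⬝ᵥ X v) - Real.cos (l * t) * (l * Real.sin (l * t)) * (X u ⬝ᵥ X v) +
      Real.cos (l * t) * (Real.sin (l * t) / l) * (Y u ⬝ᵥ Y v) := by
  simp only [X_rot, Y_rot, add_dotProduct, dotProduct_add, smul_dotProduct, dotProduct_smul,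
    smul_eq_mul]
  ring

lemma Y_rot_dot_Y_rot : Y (rot l t u) ⬝ᵥ Y (rot l t v) =
    (l * Real.sin (l * t)) ^ 2 * (X u ⬝ᵥ X v) + Real.cos (l * t) ^ 2 * (Y u ⬝ᵥ Y v) -
      Real.cos (l * t) * (l * Real.sin (l * t)) * (X u ⬝ᵥ Y v + Y u ⬝ᵥ X v) := by
  simp only [Y_rot, add_dotProduct, dotProduct_add, smul_dotProduct, dotProduct_smul, smul_eq_mul]
  ring

end dotProducts

lemma Ω_rot {l : ℝ} (hl : l ≠ 0) (t : ℝ) (u v : Z) : Ω (rot l t u) (rot l t v) = Ω u v := by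
  have h := Real.sin_sq_add_cos_sq (l * t)
  rw [Ω_XY, Ω_XY, dotProduct_comm (Y (rot l t u)), X_rot_dot_Y_rot, X_rot_dot_Y_rot,
    dotProduct_comm (Y v) (X u), dotProduct_comm (X v) (Y u), dotProduct_comm (X v) (X u),
    dotProduct_comm (Y v) (Y u)]
  field_simp
  linear_combination l * (X u ⬝ᵥ Y v - Y u ⬝ᵥ X v) * h

section level

variable {l : ℝ} {z : Z}

lemma rot_mem_TS3 (hl : l ≠ 0) (hz : z ∈ TS3) (hY : Y z ⬝ᵥ Y z = l ^ 2) (t : ℝ) :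
    rot l t z ∈ TS3 := by
  have h := Real.sin_sq_add_cos_sq (l * t)
  obtain ⟨hxx, hxy⟩ := hz
  have hyx : Y z ⬝ᵥ X z = 0 := by rw [dotProduct_comm, hxy]
  constructor
  · rw [X_rot_dot_X_rot, hxx, hxy, hyx, hY]
    field_simp
    linear_combination l * h
  · rw [X_rot_dot_Y_rot, hxx, hxy, hyx, hY]
    field_simp
    ring

lemma Y_rot_self (hz : z ∈ TS3) (hY : Y z ⬝ᵥ Y z = l ^ 2) (t : ℝ) :
    Y (rot l t z) ⬝ᵥ Y (rot l t z) = l ^ 2 := by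
  have h := Real.sin_sq_add_cos_sq (l * t)
  obtain ⟨hxx, hxy⟩ := hz
  have hyx : Y z ⬝ᵥ X z = 0 := by rw [dotProduct_comm, hxy]
  rw [Y_rot_dot_Y_rot, hxx, hxy, hyx, hY]
  linear_combination l ^ 2 * h

lemma rot_mem_tangentLevel (hl : l ≠ 0) {u : Z} (hu : u ∈ tangentLevel K z)
    (t : ℝ) : rot l t u ∈ tangentLevel K (rot l t z) := by
  obtain ⟨⟨h1, h2⟩, h3⟩ := mem_tangentLevel.1 hu
  have h4 : Y z ⬝ᵥ X u = -(X z ⬝ᵥ Y u) := by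
    rw [dotProduct_comm]; linarith
  have h5 : Y u ⬝ᵥ X z = X z ⬝ᵥ Y u := dotProduct_comm _ _
  have h6 : X u ⬝ᵥ Y z = -(X z ⬝ᵥ Y u) := by linarith
  have h7 : X u ⬝ᵥ X z = 0 := by rw [dotProduct_comm, h1]
  have h8 : Y u ⬝ᵥ Y z = 0 := by rw [dotProduct_comm, h3]
  refine mem_tangentLevel.2 ⟨⟨?_, ?_⟩, ?_⟩
  · rw [X_rot_dot_X_rot, h1, h3, h4]; ring
  · rw [X_rot_dot_Y_rot, X_rot_dot_Y_rot, h1, h3, h4, h5, h6, h7, h8]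
    field_simp
    ring
  · rw [Y_rot_dot_Y_rot, h1, h3, h4]; ring

lemma hasDerivAt_rot (hl : l ≠ 0) (hz : z ∈ TS3) (hY : Y z ⬝ᵥ Y z = l ^ 2) (t : ℝ) :
    HasDerivAt (fun t => rot l t z) (hamVec (rot l t z)) t := by
  have hm : HasDerivAt (fun t : ℝ => l * t) l t := by
    simpa using (hasDerivAt_id t).const_mul l
  have hc := hm.cos
  have hs := hm.sin
  refine hasDerivAt_pi.2 fun i => ?_
  rcases i with j | j
  · have := (hc.mul_const (X z j)).add ((hs.div_const l).mul_const (Y z j))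
    refine HasDerivAt.congr_deriv (f := fun t => rot l t z (Sum.inl j)) this ?_
    change _ = Y (rot l t z) j
    rw [Y_rot]
    simp only [Pi.add_apply, Pi.smul_apply, smul_eq_mul]
    field_simp
  · have := (((hs.const_mul l).neg).mul_const (X z j)).add (hc.mul_const (Y z j))
    refine HasDerivAt.congr_deriv (f := fun t => rot l t z (Sum.inr j)) this ?_
    change _ = -(Y (rot l t z) ⬝ᵥ Y (rot l t z)) * X (rot l t z) j
    rw [Y_rot_self hz hY, X_rot]
    simp only [Pi.add_apply, Pi.smul_apply, smul_eq_mul]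
    field_simp
    ring

lemma isHamCurve_rot (hl : l ≠ 0) (hz : z ∈ TS3) (hY : Y z ⬝ᵥ Y z = l ^ 2) :
    IsHamCurve K (fun t => rot l t z) :=
  ⟨rot_mem_TS3 hl hz hY, fun t => ⟨(hasDerivAt_rot hl hz hY t).differentiableAt, by
    rw [(hasDerivAt_rot hl hz hY t).deriv]
    exact isHamVec_hamVec (rot_mem_TS3 hl hz hY t)⟩⟩

/-- An integral curve has constant speed `l`, and `rot l (-t)` carries it to a constant curve. -/
lemma isHamCurve_eq_rot (hl : l ≠ 0) (hY : Y z ⬝ᵥ Y z = l ^ 2) {c : ℝ → Z}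
    (hc : IsHamCurve K c) (h0 : c 0 = z) (t : ℝ) : c t = rot l t z := by
  have hd : ∀ t, HasDerivAt c (hamVec (c t)) t := fun t => by
    have h := (hc.2 t).1.hasDerivAt
    rwa [(isHamVec_iff (hc.1 t)).1 (hc.2 t).2] at h
  have hX : ∀ t j, HasDerivAt (fun t => X (c t) j) (Y (c t) j) t := fun t j =>
    hasDerivAt_pi.1 (hd t) (Sum.inl j)
  have hY' : ∀ t j, HasDerivAt (fun t => Y (c t) j) (-(Y (c t) ⬝ᵥ Y (c t)) * X (c t) j) t :=
    fun t j => hasDerivAt_pi.1 (hd t) (Sum.inr j)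
  have hE : ∀ t, Y (c t) ⬝ᵥ Y (c t) = l ^ 2 := fun t => by
    have hder : ∀ t, HasDerivAt (fun t => Y (c t) ⬝ᵥ Y (c t)) 0 t := fun t => by
      have := HasDerivAt.fun_sum (u := Finset.univ) (fun j _ => (hY' t j).mul (hY' t j))
      refine HasDerivAt.congr_deriv (f := fun t => Y (c t) ⬝ᵥ Y (c t)) this ?_
      have hxy : ∑ j, X (c t) j * Y (c t) j = 0 := (hc.1 t).2
      calc _ = -(2 * (Y (c t) ⬝ᵥ Y (c t))) * ∑ j, X (c t) j * Y (c t) j := by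
            rw [Finset.mul_sum]
            exact Finset.sum_congr rfl fun j _ => by ring
        _ = 0 := by rw [hxy, mul_zero]
    have := is_const_of_deriv_eq_zero (fun t => (hder t).differentiableAt)
      (fun t => (hder t).deriv) t 0
    rw [this, h0, hY]
  have hconst : ∀ t, rot l (-t) (c t) = z := fun t => by
    have hder : ∀ t, HasDerivAt (fun t => rot l (-t) (c t)) 0 t := fun t => by
      have hm : HasDerivAt (fun t : ℝ => l * -t) (-l) t := by
        simpa using (hasDerivAt_id t).neg.const_mul l
      have hcos := hm.cos
      have hsin := hm.sin
      refine hasDerivAt_pi.2 fun i => ?_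
      rcases i with j | j
      · have := (hcos.mul (hX t j)).add ((hsin.div_const l).mul (hY' t j))
        refine HasDerivAt.congr_deriv (f := fun t => rot l (-t) (c t) (Sum.inl j)) this ?_
        rw [hE]
        simp only [Pi.zero_apply]
        field_simp
        ring
      · have := ((hsin.const_mul l).neg.mul (hX t j)).add (hcos.mul (hY' t j))
        refine HasDerivAt.congr_deriv (f := fun t => rot l (-t) (c t) (Sum.inr j)) this ?_
        rw [hE]
        simp only [Pi.zero_apply, Pi.neg_apply]
        field_simp
        ring
    have := is_const_of_deriv_eq_zero (fun t => (hder t).differentiableAt)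
      (fun t => (hder t).deriv) t 0
    rw [this, neg_zero, rot_zero, h0]
  rw [← hconst t, rot_rot_neg hl]

lemma flow_eq_rot (hl : l ≠ 0) (hz : z ∈ TS3) (hY : Y z ⬝ᵥ Y z = l ^ 2) (t : ℝ) :
    flow K t z = rot l t z := by
  have h : ∃ c, IsHamCurve K c ∧ c 0 = z := ⟨_, isHamCurve_rot hl hz hY, rot_zero l z⟩
  rw [flow, dif_pos h]
  exact isHamCurve_eq_rot hl hY h.choose_spec.1 h.choose_spec.2 t

end level

lemma exists_curve_TS3 {z u : Z} (hz : z ∈ TS3) (hu : u ∈ tangentTS3 z) :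
    ∃ γ : ℝ → Z, γ 0 = z ∧ (∀ s, γ s ∈ TS3) ∧ HasDerivAt γ u 0 := by
  obtain ⟨hxx, hxy⟩ := hz
  obtain ⟨h1, h2⟩ := mem_tangentTS3.1 hu
  set α := X u ⬝ᵥ X u
  set β := X u ⬝ᵥ Y u
  have hα : 0 ≤ α := dotProduct_self_star_nonneg (X u)
  have hpos : ∀ s : ℝ, 0 < 1 + s ^ 2 * α := fun s => by positivity
  have h1' : X u ⬝ᵥ X z = 0 := by rw [dotProduct_comm, h1]
  refine ⟨fun s => Sum.elim ((Real.sqrt (1 + s ^ 2 * α))⁻¹ • (X z + s • X u))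
    (Y z + s • Y u - (s ^ 2 * β / (1 + s ^ 2 * α)) • (X z + s • X u)), ?_, fun s => ⟨?_, ?_⟩, ?_⟩
  · apply Z_ext <;> simp [X_elim, Y_elim]
  · simp only [X_elim, smul_dotProduct, dotProduct_smul, add_dotProduct, dotProduct_add, hxx, h1,
      h1', smul_eq_mul]
    have := Real.sq_sqrt (hpos s).le
    have h3 := (Real.sqrt_pos.2 (hpos s)).ne'
    field_simp
    rw [this]
    ring
  · simp only [X_elim, Y_elim, smul_dotProduct, dotProduct_smul, add_dotProduct, dotProduct_add,
      dotProduct_sub, hxx, hxy, h1, h1', smul_eq_mul]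
    have hD : s ^ 2 * β / (1 + s ^ 2 * α) * (1 + s ^ 2 * α) = s ^ 2 * β :=
      div_mul_cancel₀ _ (hpos s).ne'
    rw [show X u ⬝ᵥ X u = α from rfl, show X u ⬝ᵥ Y u = β from rfl]
    linear_combination (Real.sqrt (1 + s ^ 2 * α))⁻¹ * (s * h2 - hD)
  · have hsq : HasDerivAt (fun s : ℝ => s ^ 2) 0 0 := by
      simpa using hasDerivAt_pow 2 (0 : ℝ)
    have hd : HasDerivAt (fun s : ℝ => 1 + s ^ 2 * α) 0 0 := by
      simpa using (hsq.mul_const α).const_add 1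
    have hn : HasDerivAt (fun s : ℝ => (Real.sqrt (1 + s ^ 2 * α))⁻¹) 0 0 := by
      simpa using (hd.sqrt (hpos 0).ne').fun_inv (Real.sqrt_pos.2 (hpos 0)).ne'
    have hb : HasDerivAt (fun s : ℝ => s ^ 2 * β / (1 + s ^ 2 * α)) 0 0 := by
      simpa using (hsq.mul_const β).fun_div hd (hpos 0).ne'
    refine hasDerivAt_pi.2 fun i => ?_
    rcases i with j | j
    · have := hn.mul (hasDerivAt_X z u j)
      refine HasDerivAt.congr_deriv (f := _) this ?_
      simp [X]
    · have := (hasDerivAt_Y z u j).sub (hb.mul (hasDerivAt_X z u j))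
      refine HasDerivAt.congr_deriv (f := _) this ?_
      simp [Y]

/-- Along the level set the speed is stationary, so the derivative of the flow is `rot` itself. -/
lemma pushforward_eq_rot {l : ℝ} (hl : 0 < l) {z u : Z} (hz : z ∈ TS3) (hY : Y z ⬝ᵥ Y z = l ^ 2)
    (hu : u ∈ tangentLevel K z) (t : ℝ) : pushforward K t z u = rot l t u := by
  let L : Z → ℝ := fun z => Real.sqrt (Y z ⬝ᵥ Y z)
  have hLz : L z = l := by
    simp only [L, hY]
    exact Real.sqrt_sq hl.le
  have hYd := differentiable_Y
  have hXd := differentiable_X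
  have hLd : DifferentiableAt ℝ L z := by
    refine DifferentiableAt.sqrt ?_ (by rw [hY]; positivity)
    unfold dotProduct
    fun_prop
  have hgd : DifferentiableAt ℝ (fun w => rot (L w) t w) z := by
    refine differentiableAt_pi.2 fun i => ?_
    have hne : L z ≠ 0 := by rw [hLz]; exact hl.ne'
    rcases i with j | j
    · change DifferentiableAt ℝ
        (fun w => Real.cos (L w * t) * X w j + Real.sin (L w * t) / L w * Y w j) z
      fun_prop (disch := assumption)
    · change DifferentiableAt ℝ
        (fun w => -(L w * Real.sin (L w * t)) * X w j + Real.cos (L w * t) * Y w j) z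
      fun_prop
  have hcongr : ∀ᶠ w in nhdsWithin z TS3, flow K t w = rot (L w) t w := by
    have h1 : ∀ᶠ w in nhdsWithin z TS3, L w ≠ 0 :=
      nhdsWithin_le_nhds (hLd.continuousAt.eventually_ne (by rw [hLz]; exact hl.ne'))
    filter_upwards [h1, self_mem_nhdsWithin] with w hw hwT
    exact flow_eq_rot hw hwT (Real.sq_sqrt (dotProduct_self_star_nonneg (Y w))).symm t
  have hflow : HasFDerivWithinAt (flow K t) (pushforward K t z) TS3 z := by
    refine DifferentiableWithinAt.hasFDerivWithinAt ?_
    refine hgd.differentiableWithinAt.congr_of_eventuallyEq hcongr ?_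
    exact hcongr.self_of_nhdsWithin hz
  obtain ⟨γ, hγ0, hγT, hγd⟩ := exists_curve_TS3 hz hu.1
  have hcomp : HasDerivAt (fun s => flow K t (γ s)) (pushforward K t z u) 0 := by
    rw [← hγ0] at hflow
    have := hflow.comp_hasDerivAt 0 hγd (Filter.Eventually.of_forall hγT)
    rwa [hγ0] at this
  have hγX : ∀ j, HasDerivAt (fun s => X (γ s) j) (X u j) 0 := fun j =>
    hasDerivAt_pi.1 hγd (Sum.inl j)
  have hγY : ∀ j, HasDerivAt (fun s => Y (γ s) j) (Y u j) 0 := fun j =>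
    hasDerivAt_pi.1 hγd (Sum.inr j)
  have hLγ0 : L (γ 0) = l := by rw [hγ0, hLz]
  have hLγ : HasDerivAt (fun s => L (γ s)) 0 0 := by
    have h1 := HasDerivAt.fun_sum (u := Finset.univ) (fun j _ => (hγY j).mul (hγY j))
    have h2 : HasDerivAt (fun s => Y (γ s) ⬝ᵥ Y (γ s)) 0 0 := by
      refine HasDerivAt.congr_deriv (f := fun s => Y (γ s) ⬝ᵥ Y (γ s)) h1 ?_
      have h3 : ∑ j, Y z j * Y u j = 0 := (mem_tangentLevel.1 hu).2
      rw [hγ0]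
      calc _ = 2 * ∑ j, Y z j * Y u j := by
            rw [Finset.mul_sum]
            exact Finset.sum_congr rfl fun j _ => by ring
        _ = 0 := by rw [h3, mul_zero]
    have h4 := h2.sqrt (by rw [hγ0, hY]; positivity)
    simpa using h4
  have hrot : HasDerivAt (fun s => rot (L (γ s)) t (γ s)) (rot l t u) 0 := by
    have hm : HasDerivAt (fun s => L (γ s) * t) 0 0 := by simpa using hLγ.mul_const t
    have hc := hm.cos
    have hs := hm.sin
    have hne : L (γ 0) ≠ 0 := by rw [hLγ0]; exact hl.ne'
    refine hasDerivAt_pi.2 fun i => ?_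
    rcases i with j | j
    · have := (hc.mul (hγX j)).add ((hs.fun_div hLγ hne).mul (hγY j))
      refine HasDerivAt.congr_deriv (f := fun s => rot (L (γ s)) t (γ s) (Sum.inl j)) this ?_
      rw [hLγ0]
      change _ = Real.cos (l * t) * X u j + Real.sin (l * t) / l * Y u j
      simp
    · have := ((hLγ.fun_mul hs).neg.mul (hγX j)).add (hc.mul (hγY j))
      refine HasDerivAt.congr_deriv (f := fun s => rot (L (γ s)) t (γ s) (Sum.inr j)) this ?_
      rw [hLγ0]
      change _ = -(l * Real.sin (l * t)) * X u j + Real.cos (l * t) * Y u j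
      simp [hLγ0]
  have heq : (fun s => flow K t (γ s)) =ᶠ[nhds 0] fun s => rot (L (γ s)) t (γ s) := by
    have h1 : ∀ᶠ s in nhds (0 : ℝ), L (γ s) ≠ 0 :=
      hLγ.continuousAt.eventually_ne (by rw [hLγ0]; exact hl.ne')
    filter_upwards [h1] with s hs
    exact flow_eq_rot hs (hγT s) (Real.sq_sqrt (dotProduct_self_star_nonneg _)).symm t
  exact hcomp.unique (hrot.congr_of_eventuallyEq heq)

/-! ### A loop of symplectic transports along a closed geodesic -/

/-- For an orthonormal pair `(x, e)`: rotation by `θ` in the plane of `x` and `e`, both in the `x` and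
in the `y` coordinates, and on the orthogonal complement `N` of that plane the linear flow
`(cos θ, sin θ / l; -l sin θ, cos θ)` of `N ⊕ N`. -/
def transportMat (x e : Fin 4 → ℝ) (l θ : ℝ) : Matrix (Fin 4 ⊕ Fin 4) (Fin 4 ⊕ Fin 4) ℝ :=
  fromBlocks
    (Real.cos θ • (1 : Matrix (Fin 4) (Fin 4) ℝ) + Real.sin θ • (vecMulVec e x - vecMulVec x e))
    ((Real.sin θ / l) • (1 - (vecMulVec x x + vecMulVec e e)))
    (-(l * Real.sin θ) • (1 - (vecMulVec x x + vecMulVec e e)))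
    (Real.cos θ • (1 : Matrix (Fin 4) (Fin 4) ℝ) + Real.sin θ • (vecMulVec e x - vecMulVec x e))

lemma fromBlocks_mem_of_rel {m : Type*} [Fintype m] [DecidableEq m] {J N : Matrix m m ℝ}
    (hJt : Jᵀ = -J) (hNt : Nᵀ = N) (hNN : N * N = N) (hJN : J * N = 0) (hNJ : N * J = 0)
    (hJJ : J * J = N - 1) {l : ℝ} (hl : l ≠ 0) {c s : ℝ} (h : s ^ 2 + c ^ 2 = 1) :
    fromBlocks (c • 1 + s • J) ((s / l) • N) (-(l * s) • N) (c • 1 + s • J) ∈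
      symplecticGroup m ℝ := by
  rw [SymplecticGroup.fromBlocks_mem_iff]
  simp only [transpose_add, transpose_smul, transpose_one, hJt, hNt, mul_add, add_mul, mul_one,
    one_mul, neg_mul, hNN, hJN, hNJ, hJJ, Matrix.mul_smul, Matrix.smul_mul, smul_neg,
    smul_zero, neg_zero, add_zero]
  refine ⟨smul_comm _ _ _, smul_comm _ _ _, ?_⟩
  have e : l * s * (s / l) = s ^ 2 := by field_simp
  have e1 : s ^ 2 = 1 - c ^ 2 := by linarith
  rw [show -(s • s • (N - 1)) = s ^ 2 • (1 - N) by module, neg_smul, smul_neg, sub_neg_eq_add,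
    smul_smul (s / l), mul_comm (s / l), e, e1]
  module

section

variable {x e : Fin 4 → ℝ} {l : ℝ} (hxx : x ⬝ᵥ x = 1) (hxe : x ⬝ᵥ e = 0) (hee : e ⬝ᵥ e = 1)

include hxx hxe hee

lemma transportMat_mem (hl : l ≠ 0) (θ : ℝ) : transportMat x e l θ ∈ symplecticGroup (Fin 4) ℝ := by
  have hex : e ⬝ᵥ x = 0 := by rw [dotProduct_comm, hxe]
  refine fromBlocks_mem_of_rel ?_ ?_ ?_ ?_ ?_ ?_ hl (Real.sin_sq_add_cos_sq θ)
  · simp [transpose_vecMulVec]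
  · simp [transpose_vecMulVec]
  all_goals
    simp only [mul_add, add_mul, mul_sub, sub_mul, vecMulVec_mul_vecMulVec, hxx, hxe, hee, hex,
      one_smul, zero_smul, one_mul, mul_one, Matrix.vecMulVec_zero]
    try simp
    try abel

/-- At the base point `i` of the Siegel half space, `c τ + d` is `w = cos θ - i l sin θ` on the
complement of the plane of `x` and `e`, and a rotation on that plane. -/
lemma det_den_transportMat (hl : l ≠ 0) (θ : ℝ) :
    (den ⟨transportMat x e l θ, transportMat_mem hxx hxe hee hl θ⟩ (basePt 4).1).det =
      (Real.cos θ - Complex.I * l * Real.sin θ) ^ 2 := by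
  have hex : e ⬝ᵥ x = 0 := by rw [dotProduct_comm, hxe]
  have h : (Real.sin θ : ℂ) ^ 2 + (Real.cos θ : ℂ) ^ 2 = 1 := by
    exact_mod_cast Real.sin_sq_add_cos_sq θ
  set w : ℂ := Real.cos θ - Complex.I * l * Real.sin θ with hw
  have hw0 : w ≠ 0 := by
    intro h0
    have h1 := congrArg Complex.re h0
    have h2 := congrArg Complex.im h0
    simp only [hw, Complex.sub_re, Complex.sub_im, Complex.mul_re, Complex.mul_im, Complex.I_re,
      Complex.I_im, Complex.ofReal_re, Complex.ofReal_im, Complex.zero_re, Complex.zero_im] at h1 h2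
    have hc : Real.cos θ = 0 := by linarith
    have hs : l * Real.sin θ = 0 := by linarith
    have hs' : Real.sin θ = 0 := (mul_eq_zero.1 hs).resolve_left hl
    have := Real.sin_sq_add_cos_sq θ
    rw [hc, hs'] at this
    norm_num at this
  let U : Matrix (Fin 4) (Fin 2) ℂ := Matrix.of fun i => ![(x i : ℂ), (e i : ℂ)]
  let M : Matrix (Fin 2) (Fin 2) ℂ := !![Complex.I * l * Real.sin θ, -Real.sin θ;
    Real.sin θ, Complex.I * l * Real.sin θ]
  have hU : Uᵀ * U = 1 := by
    have c1 : ∑ i, (x i : ℂ) * x i = 1 := by exact_mod_cast congrArg Complex.ofReal hxx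
    have c2 : ∑ i, (x i : ℂ) * e i = 0 := by exact_mod_cast congrArg Complex.ofReal hxe
    have c3 : ∑ i, (e i : ℂ) * x i = 0 := by exact_mod_cast congrArg Complex.ofReal hex
    have c4 : ∑ i, (e i : ℂ) * e i = 1 := by exact_mod_cast congrArg Complex.ofReal hee
    ext i j
    fin_cases i <;> fin_cases j
    · exact c1
    · exact c2
    · exact c3
    · exact c4
  have hden : den ⟨transportMat x e l θ, transportMat_mem hxx hxe hee hl θ⟩ (basePt 4).1 =
      w • (1 + (w⁻¹ • U) * (M * Uᵀ)) := by
    rw [smul_add, Matrix.smul_mul, smul_smul, mul_inv_cancel₀ hw0, one_smul]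
    ext i j
    simp only [den, basePt, Matrix.mul_smul, Matrix.mul_one, Matrix.add_apply, Matrix.smul_apply,
      Matrix.mul_apply, Fin.sum_univ_two, Matrix.transpose_apply, toBlocks₂₁, toBlocks₂₂, cplx,
      transportMat, Matrix.of_apply, Matrix.map_apply, fromBlocks_apply₂₁, fromBlocks_apply₂₂,
      Matrix.sub_apply, vecMulVec_apply, smul_eq_mul, U, M, hw]
    simp only [Matrix.cons_val_zero, Matrix.cons_val_one, Matrix.cons_val', Matrix.cons_val_fin_one]
    have h1 : (1 : Matrix (Fin 4) (Fin 4) ℂ) i j =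
        (((1 : Matrix (Fin 4) (Fin 4) ℝ) i j : ℝ) : ℂ) := by
      simp only [Matrix.one_apply]
      split_ifs <;> simp
    rw [h1]
    push_cast
    ring
  rw [hden, Matrix.det_smul, Matrix.det_one_add_mul_comm, Matrix.mul_smul, Matrix.mul_assoc, hU,
    Matrix.mul_one, Matrix.det_fin_two, Fintype.card_fin]
  simp only [Matrix.add_apply, Matrix.smul_apply, Matrix.one_apply, M, Matrix.of_apply,
    Matrix.cons_val_zero, Matrix.cons_val_one, Matrix.cons_val', Matrix.cons_val_fin_one,
    smul_eq_mul]
  simp only [↓reduceIte, zero_ne_one, one_ne_zero]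
  field_simp
  rw [hw]
  linear_combination h

end

section

variable {l : ℝ} {z : Z} (hl : l ≠ 0) (hz : z ∈ TS3) (hY : Y z ⬝ᵥ Y z = l ^ 2)

include hl hz hY in
lemma unit_velocity : X z ⬝ᵥ (l⁻¹ • Y z) = 0 ∧ (l⁻¹ • Y z) ⬝ᵥ (l⁻¹ • Y z) = 1 := by
  constructor
  · rw [dotProduct_smul, hz.2, smul_zero]
  · rw [dotProduct_smul, smul_dotProduct, hY, smul_eq_mul, smul_eq_mul]
    field_simp

/-- The symplectic transport of `Z` from `z` to the point of its geodesic at time `t`. -/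
def transport (t : ℝ) : Sp 4 :=
  ⟨transportMat (X z) (l⁻¹ • Y z) l (l * t),
    transportMat_mem hz.1 (unit_velocity hl hz hY).1 (unit_velocity hl hz hY).2 hl _⟩

lemma X_transport (t : ℝ) (u : Z) : X (toLin (transport hl hz hY t) u) =
    Real.cos (l * t) • X u + Real.sin (l * t) • ((X z ⬝ᵥ X u) • (l⁻¹ • Y z) -
      ((l⁻¹ • Y z) ⬝ᵥ X u) • X z) + (Real.sin (l * t) / l) • (Y u - ((X z ⬝ᵥ Y u) • X z +
      ((l⁻¹ • Y z) ⬝ᵥ Y u) • (l⁻¹ • Y z))) := by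
  have : X (toLin (transport hl hz hY t) u) = (transport hl hz hY t).1.toBlocks₁₁ *ᵥ X u +
      (transport hl hz hY t).1.toBlocks₁₂ *ᵥ Y u := by
    ext i
    simp [toLin, X, Y, Matrix.mulVec, dotProduct, Fintype.sum_sum_type, toBlocks₁₁, toBlocks₁₂]
  rw [this]
  simp only [transport, transportMat, toBlocks_fromBlocks₁₁, toBlocks_fromBlocks₁₂,
    Matrix.add_mulVec, Matrix.sub_mulVec, Matrix.smul_mulVec, Matrix.one_mulVec,
    Matrix.vecMulVec_mulVec, op_smul_eq_smul]

lemma Y_transport (t : ℝ) (u : Z) : Y (toLin (transport hl hz hY t) u) =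
    -(l * Real.sin (l * t)) • (X u - ((X z ⬝ᵥ X u) • X z +
      ((l⁻¹ • Y z) ⬝ᵥ X u) • (l⁻¹ • Y z))) + (Real.cos (l * t) • Y u + Real.sin (l * t) •
      ((X z ⬝ᵥ Y u) • (l⁻¹ • Y z) - ((l⁻¹ • Y z) ⬝ᵥ Y u) • X z)) := by
  have : Y (toLin (transport hl hz hY t) u) = (transport hl hz hY t).1.toBlocks₂₁ *ᵥ X u +
      (transport hl hz hY t).1.toBlocks₂₂ *ᵥ Y u := by
    ext i
    simp [toLin, X, Y, Matrix.mulVec, dotProduct, Fintype.sum_sum_type, toBlocks₂₁, toBlocks₂₂]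
  rw [this]
  simp only [transport, transportMat, toBlocks_fromBlocks₂₁, toBlocks_fromBlocks₂₂,
    Matrix.add_mulVec, Matrix.sub_mulVec, Matrix.smul_mulVec, Matrix.one_mulVec,
    Matrix.vecMulVec_mulVec, op_smul_eq_smul]

/-- The transport preserves the dot products with the position and the velocity of the geodesic. -/
lemma dot_transport (t : ℝ) (u : Z) :
    X (rot l t z) ⬝ᵥ X (toLin (transport hl hz hY t) u) = X z ⬝ᵥ X u ∧
    X (rot l t z) ⬝ᵥ Y (toLin (transport hl hz hY t) u) = X z ⬝ᵥ Y u ∧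
    Y (rot l t z) ⬝ᵥ X (toLin (transport hl hz hY t) u) = Y z ⬝ᵥ X u ∧
    Y (rot l t z) ⬝ᵥ Y (toLin (transport hl hz hY t) u) = Y z ⬝ᵥ Y u := by
  have h := Real.sin_sq_add_cos_sq (l * t)
  have hyx : Y z ⬝ᵥ X z = 0 := by rw [dotProduct_comm, hz.2]
  simp only [X_transport, Y_transport, X_rot, Y_rot, add_dotProduct, dotProduct_add,
    smul_dotProduct, dotProduct_smul, dotProduct_sub, hz.1, hz.2, hyx, hY,
    smul_eq_mul]
  refine ⟨?_, ?_, ?_, ?_⟩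
  · field_simp
    linear_combination l ^ 3 * (X z ⬝ᵥ X u) * h
  · field_simp
    linear_combination l ^ 2 * (X z ⬝ᵥ Y u) * h
  · field_simp
    linear_combination l ^ 2 * (Y z ⬝ᵥ X u) * h
  · field_simp
    linear_combination l * (Y z ⬝ᵥ Y u) * h

lemma transport_vertical (t : ℝ) :
    toLin (transport hl hz hY t) (Sum.elim (0 : Fin 4 → ℝ) (X z)) =
      Sum.elim (0 : Fin 4 → ℝ) (X (rot l t z)) := by
  have hyx : Y z ⬝ᵥ X z = 0 := by rw [dotProduct_comm, hz.2]
  apply Z_ext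
  · simp [X_transport, X_elim, Y_elim, hz.1, hyx]
  · simp only [Y_transport, X_elim, Y_elim, X_rot, dotProduct_zero, smul_dotProduct, hz.1, hyx]
    ext j
    simp
    field_simp

/-- The differential of `orbitProj` commutes with the transport along the geodesic. -/
lemma fderiv_orbitProj_transport (t : ℝ) (u : Z) :
    fderiv ℝ orbitProj (rot l t z) (toLin (transport hl hz hY t) u) =
      toLin (transport hl hz hY t) (fderiv ℝ orbitProj z u) := by
  have key : ∀ {z : Z} (_ : z ∈ TS3) (u : Z), fderiv ℝ orbitProj z u =
      u - (X u ⬝ᵥ Y z + X z ⬝ᵥ Y u) • Sum.elim (0 : Fin 4 → ℝ) (X z) := fun {z} hz u => by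
    rw [fderiv_orbitProj, hz.2, zero_smul, sub_zero]
    apply Z_ext
    · simp [X_sub, X_smul, X_elim]
    · simp [Y_sub, Y_smul, Y_elim]
  obtain ⟨h1, h2, h3, h4⟩ := dot_transport hl hz hY t u
  rw [key (rot_mem_TS3 hl hz hY t), key hz, map_sub, map_smul, transport_vertical, h2,
    dotProduct_comm _ (Y (rot l t z)), h3, dotProduct_comm (Y z)]

lemma transport_mem_tangentLevel {t : ℝ} {u : Z} :
    toLin (transport hl hz hY t) u ∈ tangentLevel K (rot l t z) ↔ u ∈ tangentLevel K z := by
  obtain ⟨h1, h2, h3, h4⟩ := dot_transport hl hz hY t u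
  rw [mem_tangentLevel, mem_tangentLevel, h1, h2, h4, dotProduct_comm _ (Y (rot l t z)), h3,
    dotProduct_comm (Y z)]

lemma transport_mem_tangentA {t : ℝ} {u : Z} :
    toLin (transport hl hz hY t) u ∈ tangentA (rot l t z) ↔ u ∈ tangentA z := by
  rw [mem_tangentA, mem_tangentA, (dot_transport hl hz hY t u).1]

/-- On the tangent spaces of the level set the transport is the derivative of the flow. -/
lemma transport_eq_rot (t : ℝ) {u : Z} (hu : u ∈ tangentLevel K z) :
    toLin (transport hl hz hY t) u = rot l t u := by
  obtain ⟨⟨h1, h2⟩, h3⟩ := mem_tangentLevel.1 hu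
  have h4 : Y z ⬝ᵥ X u = -(X z ⬝ᵥ Y u) := by rw [dotProduct_comm]; linarith
  apply Z_ext
  · rw [X_transport, X_rot, smul_dotProduct, smul_dotProduct, h1, h3, h4]
    ext j
    simp
    field_simp
    ring
  · rw [Y_transport, Y_rot, smul_dotProduct, smul_dotProduct, h1, h3, h4]
    ext j
    simp
    field_simp
    ring

lemma transport_of_cos_eq_one {t : ℝ} (h : Real.cos (l * t) = 1) : transport hl hz hY t = 1 := by
  have hs : Real.sin (l * t) = 0 := by
    have := Real.sin_sq_add_cos_sq (l * t)
    rw [h] at this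
    nlinarith
  apply Subtype.ext
  change transportMat _ _ _ _ = 1
  rw [transportMat, h, hs]
  simp [fromBlocks_one]

lemma exists_transportMpc (t : ℝ) : ∃ a : Mpc 4, a.g = transport hl hz hY t ∧
    a.φ (basePt 4) = Real.cos (l * t) - Complex.I * l * Real.sin (l * t) ∧ a.η = 1 :=
  Mpc.exists_lift _ _ (det_den_transportMat hz.1 (unit_velocity hl hz hY).1
    (unit_velocity hl hz hY).2 hl (l * t)).symm

/-- The metaplectic lift of the transport along the geodesic whose value at the base point is
`cos(lt) - i l sin(lt)`. -/
def transportMpc (t : ℝ) : Mpc 4 := (exists_transportMpc hl hz hY t).choose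

lemma transportMpc_g (t : ℝ) : (transportMpc hl hz hY t).g = transport hl hz hY t :=
  (exists_transportMpc hl hz hY t).choose_spec.1

lemma transportMpc_φ (t : ℝ) : (transportMpc hl hz hY t).φ (basePt 4) =
    Real.cos (l * t) - Complex.I * l * Real.sin (l * t) :=
  (exists_transportMpc hl hz hY t).choose_spec.2.1

lemma transportMpc_η (t : ℝ) : (transportMpc hl hz hY t).η = 1 :=
  (exists_transportMpc hl hz hY t).choose_spec.2.2

/-- The metaplectic lift of the transport is a closed loop, since `cos - i l sin` has period `2π`. -/
lemma transportMpc_of_cos_eq_one {t : ℝ} (h : Real.cos (l * t) = 1) :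
    transportMpc hl hz hY t = 1 := by
  have hs : Real.sin (l * t) = 0 := by
    have := Real.sin_sq_add_cos_sq (l * t)
    rw [h] at this
    nlinarith
  refine Mpc.ext_of_apply (τ₀ := basePt 4) ?_ ?_
  · rw [transportMpc_g, transport_of_cos_eq_one hl hz hY h, Mpc.one_g]
  · rw [transportMpc_φ, Mpc.one_φ, h, hs]
    simp

lemma smoothCurve_transportMpc : Mpc.SmoothCurve (transportMpc hl hz hY) := by
  have hm : ContDiff ℝ ∞ fun t : ℝ => l * t := contDiff_const.mul contDiff_id
  have hc : ContDiff ℝ ∞ fun t : ℝ => Real.cos (l * t) := hm.cos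
  have hs : ContDiff ℝ ∞ fun t : ℝ => Real.sin (l * t) := hm.sin
  constructor
  · intro i j
    simp only [transportMpc_g]
    rcases i with i | i <;> rcases j with j | j <;>
      simp only [transport, transportMat, fromBlocks_apply₁₁, fromBlocks_apply₁₂,
        fromBlocks_apply₂₁, fromBlocks_apply₂₂, Matrix.add_apply, Matrix.smul_apply, smul_eq_mul]
    · exact (hc.mul contDiff_const).add (hs.mul contDiff_const)
    · exact (hs.div_const _).mul contDiff_const
    · exact (contDiff_const.mul hs).neg.mul contDiff_const
    · exact (hc.mul contDiff_const).add (hs.mul contDiff_const)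
  · simp only [transportMpc_φ]
    exact (Complex.ofRealCLM.contDiff.comp hc).sub
      (contDiff_const.mul (Complex.ofRealCLM.contDiff.comp hs))

end

/-! ### Points of the prequantization in terms of frames -/

lemma eq_zero_of_Ω_eq_zero {u : V n} (h : ∀ v, Ω u v = 0) : u = 0 := by
  ext i
  rcases i with i | i
  · have := h (Pi.single (Sum.inr i) 1)
    simpa [Ω, Pi.single_apply] using this
  · have := h (Pi.single (Sum.inl i) 1)
    simpa [Ω, Pi.single_apply] using this

lemma Ω_sub_left (u v w : V n) : Ω (u - v) w = Ω u w - Ω v w := by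
  simp only [Ω, Pi.sub_apply, ← Finset.sum_sub_distrib]
  exact Finset.sum_congr rfl fun j _ => by ring

lemma Ω_swap (u v : V n) : Ω u v = -Ω v u := by
  simp only [Ω, ← Finset.sum_neg_distrib]
  exact Finset.sum_congr rfl fun j _ => by ring

lemma Q.frame_injective (q : Q) : Function.Injective q.frame := fun u v h => by
  refine sub_eq_zero.1 (eq_zero_of_Ω_eq_zero fun w => ?_)
  rw [Ω_sub_left, ← Q4A.frame_symp q.1 u w, ← Q4A.frame_symp q.1 v w]
  change Ω (q.frame u) _ - Ω (q.frame v) _ = 0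
  rw [h]
  exact sub_self _

lemma Q.frame_act (q : Q) (c : Mpc 3) : (Q.act q c).frame = q.frame ∘ₗ toLin c.g :=
  Q4A.frame_act q.1 c

lemma map_toLin_eq {g : Sp n} {S S' : Submodule ℝ (V n)} (h : ∀ u, toLin g u ∈ S' ↔ u ∈ S) :
    Submodule.map (toLin g) S = S' := by
  apply le_antisymm
  · rintro _ ⟨u, hu, rfl⟩
    exact (h u).2 hu
  · intro u hu
    have e : toLin g (toLin g⁻¹ u) = u := by
      rw [← toLin_mul_apply, mul_inv_cancel, toLin_one_apply]
    refine ⟨toLin g⁻¹ u, (h _).1 ?_, e⟩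
    rwa [e]

lemma mem_spW_of_map_eq {M : Type*} [AddCommGroup M] [Module ℝ M] {F : V (n + 1) →ₗ[ℝ] M}
    (hF : Function.Injective F) {k : Sp (n + 1)}
    (h : Submodule.map (F ∘ₗ toLin k) (W n) = Submodule.map F (W n)) : k ∈ spW n := fun u hu => by
  have h1 : F (toLin k u) ∈ Submodule.map F (W n) := by
    rw [← h]
    exact Submodule.mem_map_of_mem (f := F ∘ₗ toLin k) hu
  obtain ⟨w, hw, hw'⟩ := h1
  rwa [← hF hw']

lemma eq_incl_add_smul_nullVec {w : V (n + 1)} (hw : w ∈ W n) :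
    w = incl n (w ∘ cut n) + w (Sum.inl (Fin.last n)) • nullVec n := by
  have hlast : w (Sum.inr (Fin.last n)) = 0 := hw
  ext i
  rcases i with i | i <;> induction i using Fin.lastCases <;>
    simp [incl, nullVec, hlast, cut, Fin.castSucc_ne_last]

/-- The class of `(x, c)` in `Q`. -/
def Q.ofFrame (x : adaptedA) (c : Mpc 3) (hz : x.1.1 ∈ TS3) : Q := ⟨Assoc.mk x c, hz⟩

lemma Q.ofFrame_frame (x : adaptedA) (c : Mpc 3) (hz : x.1.1 ∈ TS3) (v : V 3) :
    (Q.ofFrame x c hz).frame v =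
      fderiv ℝ orbitProj x.1.1 (toLin x.1.2.g (incl 3 (toLin c.g v))) := rfl

lemma Q.ofFrame_eq_act {x x' : adaptedA} {c c' : Mpc 3} {hz : x.1.1 ∈ TS3} {hz' : x'.1.1 ∈ TS3}
    {h : MpcW 3} (hx : x'.1 = Q4.act x.1 h.1) {k : Mpc 3} (hk : nuHat h * c' = c * k) :
    Q.ofFrame x' c' hz' = Q.act (Q.ofFrame x c hz) k := by
  apply Subtype.ext
  have h1 : (Assoc.mk x' c' : Q4A) = Assoc.mk x (nuHat h * c') :=
    Quot.sound (AssocRel.rel x x' h c' hx)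
  exact h1.trans (congrArg (fun c => Assoc.mk x c) hk)

section

variable {H : Z → ℝ} {E : ℝ}

/-- The class of `((x, c), d)` in `Q_S`. -/
def QS.ofFrame (x : adaptedA) (c : Mpc 3) (hz : x.1.1 ∈ TS3)
    (hS : Q.ofFrame x c hz ∈ adaptedS H E) (d : Mpc 2) : QS H E := Assoc.mk ⟨_, hS⟩ d

lemma QS.ofFrame_eq {x x' : adaptedA} {c c' : Mpc 3} {hz : x.1.1 ∈ TS3} {hz' : x'.1.1 ∈ TS3}
    {hS : Q.ofFrame x c hz ∈ adaptedS H E} {hS' : Q.ofFrame x' c' hz' ∈ adaptedS H E}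
    {k : MpcW 2} (hk : Q.ofFrame x' c' hz' = Q.act (Q.ofFrame x c hz) k.1) (d : Mpc 2) :
    QS.ofFrame x' c' hz' hS' d = QS.ofFrame x c hz hS (nuHat k * d) :=
  Quot.sound (AssocRel.rel ⟨_, hS⟩ ⟨_, hS'⟩ k d hk)

lemma QS.act_mul (q : QS H E) (c d : Mpc 2) : (q.act c).act d = q.act (c * d) :=
  Assoc.act_mul q c d

/-- A horizontal curve in `Q_S` comes from smooth curves in `Q₄^A`, `Mpᶜ(V 3)` and `Mpᶜ(V 2)`. -/
lemma QS.IsHorizontal.exists_ofFrame {ħ : ℝ} {q : ℝ → QS H E} (hq : QS.IsHorizontal ħ q) :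
    ∃ (x : ℝ → adaptedA) (c : ℝ → Mpc 3) (d : ℝ → Mpc 2) (hz : ∀ t, (x t).1.1 ∈ TS3)
      (hS : ∀ t, Q.ofFrame (x t) (c t) (hz t) ∈ adaptedS H E),
      (∀ t, q t = QS.ofFrame (x t) (c t) (hz t) (hS t) (d t)) ∧
      Mpc.SmoothCurve (fun t => (x t).1.2) ∧ Mpc.SmoothCurve c ∧ Mpc.SmoothCurve d ∧
      ∀ t, (1 / (Complex.I * ħ)) * (beta4 (x t).1.1 (deriv (fun s => (x s).1.1) t) : ℝ) +
        Mpc.halfEta (fun s => (x s).1.2) t + Mpc.halfEta c t + Mpc.halfEta d t = 0 := by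
  obtain ⟨p, d, f₀, hp, ⟨x, c, f₁, hx, ⟨-, hsm, hf₁⟩, hc, hf₀⟩, hd, hf⟩ := hq
  have hz : ∀ t, (x t).1.1 ∈ TS3 := fun t => by
    have h := (p t).1.2
    simp only [] at hx
    rw [hx t] at h
    exact h
  have hpx : ∀ t, (p t).1 = Q.ofFrame (x t) (c t) (hz t) := fun t => Subtype.ext (hx t)
  refine ⟨x, c, d, hz, fun t => by rw [← hpx]; exact (p t).2, fun t => ?_, hsm, hc, hd, fun t => ?_⟩
  · rw [hp t]
    exact congrArg (fun y => Assoc.mk y (d t)) (Subtype.ext (hpx t))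
  · rw [← hf₁, ← hf₀, ← hf]

/-- The representative of the frame of a class `((x, c), d)`, before reduction modulo the null line. -/
lemma QS.ofFrame_frame (x : adaptedA) (c : Mpc 3) (hz : x.1.1 ∈ TS3)
    (hS : Q.ofFrame x c hz ∈ adaptedS H E) (d : Mpc 2) :
    (QS.ofFrame x c hz hS d).frame =
      ⟨x.1.1, (nullLine H x.1.1).mkQ ∘ₗ (Q.ofFrame x c hz).frame ∘ₗ incl 2 ∘ₗ toLin d.g⟩ := rfl

lemma frame_mem_tangentLevel {p : Q} (hp : p ∈ adaptedS H E) {w : V 3} (hw : w ∈ W 2) :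
    p.frame w ∈ tangentLevel H p.pt := by
  rw [← hp.2]
  exact Submodule.mem_map_of_mem hw

lemma QS.isRedFrame (q : QS H E) : IsRedFrame H E q.frame := by
  obtain ⟨⟨⟨p, hp⟩, d⟩, rfl⟩ := Quot.exists_rep q
  change IsRedFrame H E (redFrameRep H p d)
  have hmem : ∀ v : V 2, p.frame (incl 2 v) ∈ tangentLevel H p.pt := fun v =>
    frame_mem_tangentLevel hp (incl_mem_W v)
  refine ⟨hp.1, ?_, ?_⟩
  · apply le_antisymm
    · rintro _ ⟨v, rfl⟩
      exact Submodule.mem_map_of_mem (hmem (toLin d.g v))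
    · rintro _ ⟨u, hu, rfl⟩
      change u ∈ tangentLevel H p.pt at hu
      rw [← hp.2] at hu
      obtain ⟨w, hw, rfl⟩ := hu
      let v : V 2 := w ∘ cut 2
      refine ⟨toLin d.g⁻¹ v, ?_⟩
      change (nullLine H p.pt).mkQ (p.frame (incl 2 (toLin d.g (toLin d.g⁻¹ v)))) = _
      rw [← toLin_mul_apply, mul_inv_cancel, toLin_one_apply]
      refine (Submodule.Quotient.eq _).2 ?_
      have hw' : incl 2 v - w = -(w (Sum.inl (Fin.last 2)) • nullVec 2) :=
        sub_eq_iff_eq_add.2 (eq_neg_add_iff_add_eq.2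
          ((add_comm _ _).trans (eq_incl_add_smul_nullVec hw).symm))
      rw [← map_sub, hw', map_neg, map_smul]
      exact neg_mem (Submodule.smul_mem _ _ (adaptedS_null hp))
  · intro v v' u u' hu hu' h h'
    have e1 : p.frame (incl 2 (toLin d.g v)) - u ∈ nullLine H p.pt :=
      (Submodule.Quotient.eq _).1 h
    have e2 : p.frame (incl 2 (toLin d.g v')) - u' ∈ nullLine H p.pt :=
      (Submodule.Quotient.eq _).1 h'
    have h1 := e1.2 u' hu'
    have h2 := e2.2 _ (hmem (toLin d.g v))
    rw [Ω_sub_left] at h1 h2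
    have h3 : Ω (p.frame (incl 2 (toLin d.g v))) (p.frame (incl 2 (toLin d.g v'))) = Ω v v' :=
      (Q4A.frame_symp p.1 _ _).trans ((Ω_incl _ _).trans (Ω_toLin _ _ _))
    rw [Ω_swap, Ω_swap u'] at h2
    linarith

end

/-! ### The reference curve over a geodesic -/

section

variable {l : ℝ} {z : Z}

lemma hamVec_mem_tangentLevel (hz : z ∈ TS3) : hamVec z ∈ tangentLevel K z := by
  refine ⟨(isHamVec_hamVec hz).1, ?_⟩
  change fderiv ℝ K z (hamVec z) = 0
  rw [fderiv_K, hamVec, Y_elim, dotProduct_smul, dotProduct_comm (Y z) (X z), hz.2, smul_zero]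

lemma nullLine_le_tangentLevel (hz : z ∈ TS3) : nullLine K z ≤ tangentLevel K z := fun ζ hζ => by
  refine ⟨hζ.1, ?_⟩
  change fderiv ℝ K z ζ = 0
  rw [← (isHamVec_hamVec hz).2 ζ hζ.1, Ω_swap, hζ.2 _ (hamVec_mem_tangentLevel hz), neg_zero]

lemma rot_mem_nullLine (hl : l ≠ 0) (hz : z ∈ TS3) {ζ : Z} (hζ : ζ ∈ nullLine K z) (t : ℝ) :
    rot l t ζ ∈ nullLine K (rot l t z) := by
  refine ⟨(rot_mem_tangentLevel hl (nullLine_le_tangentLevel hz hζ) t).1, fun u hu => ?_⟩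
  have hu' : rot l (-t) u ∈ tangentLevel K z := by
    have := rot_mem_tangentLevel hl hu (-t)
    rwa [rot_neg_rot hl] at this
  rw [← rot_rot_neg hl t u, Ω_rot hl]
  exact hζ.2 _ hu'

lemma mem_levelSet_iff {E : ℝ} (hE : 2 * E = l ^ 2) :
    z ∈ levelSet K E ↔ z ∈ TS3 ∧ Y z ⬝ᵥ Y z = l ^ 2 := by
  have : K z = E ↔ Y z ⬝ᵥ Y z = l ^ 2 := by
    rw [K, ← hE]
    constructor <;> intro h <;> linarith
  rw [← this]
  rfl

end

section

variable {l : ℝ} (hl : l ≠ 0) (x₀ : adaptedA) (hz : x₀.1.1 ∈ TS3)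
  (hY : Y x₀.1.1 ⬝ᵥ Y x₀.1.1 = l ^ 2)

lemma transport_frame_mem (t : ℝ) :
    ((rot l t x₀.1.1, transportMpc hl hz hY t * x₀.1.2) : Q4) ∈ adaptedA := by
  have hT := rot_mem_TS3 hl hz hY t
  refine ⟨?_, ?_⟩
  · change (1 / 2) * _ = 1 / 2
    rw [hT.1, mul_one]
  · change Submodule.map (toLin (transportMpc hl hz hY t * x₀.1.2).g) (W 3) = _
    rw [Mpc.mul_g, transportMpc_g, toLin_mul, Submodule.map_comp]
    have h0 : Submodule.map (toLin x₀.1.2.g) (W 3) = tangentA x₀.1.1 := x₀.2.2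
    rw [h0]
    exact map_toLin_eq fun u => transport_mem_tangentA hl hz hY

/-- The frame `x₀` over `A`, transported along the geodesic through its base point. -/
def transportFrame (t : ℝ) : adaptedA :=
  ⟨(rot l t x₀.1.1, transportMpc hl hz hY t * x₀.1.2), transport_frame_mem hl x₀ hz hY t⟩

lemma transportFrame_pt_mem (t : ℝ) : (transportFrame hl x₀ hz hY t).1.1 ∈ TS3 :=
  rot_mem_TS3 hl hz hY t

lemma transportFrame_of_cos_eq_one {t : ℝ} (h : Real.cos (l * t) = 1) :
    transportFrame hl x₀ hz hY t = x₀ := by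
  apply Subtype.ext
  refine Prod.ext (rot_of_cos_eq_one h _) ?_
  change transportMpc hl hz hY t * x₀.1.2 = x₀.1.2
  rw [transportMpc_of_cos_eq_one hl hz hY h, one_mul]

lemma transportFrame_frame (t : ℝ) (c : Mpc 3) (v : V 3) :
    (Q.ofFrame (transportFrame hl x₀ hz hY t) c (transportFrame_pt_mem hl x₀ hz hY t)).frame v =
      toLin (transport hl hz hY t) ((Q.ofFrame x₀ c hz).frame v) := by
  rw [Q.ofFrame_frame, Q.ofFrame_frame, ← fderiv_orbitProj_transport, ← toLin_mul_apply]
  change fderiv ℝ orbitProj _ (toLin (transportMpc hl hz hY t * x₀.1.2).g _) = _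
  rw [Mpc.mul_g, transportMpc_g]
  rfl

lemma transportFrame_mem_adaptedS {E : ℝ} (hE : 2 * E = l ^ 2) {c : Mpc 3}
    (hS : Q.ofFrame x₀ c hz ∈ adaptedS K E) (t : ℝ) :
    Q.ofFrame (transportFrame hl x₀ hz hY t) c (transportFrame_pt_mem hl x₀ hz hY t) ∈
      adaptedS K E := by
  refine ⟨(mem_levelSet_iff hE).2 ⟨rot_mem_TS3 hl hz hY t, Y_rot_self hz hY t⟩, ?_⟩
  have hS2 : Submodule.map (Q.ofFrame x₀ c hz).frame (W 2) = tangentLevel K x₀.1.1 := hS.2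
  change _ = tangentLevel K (rot l t x₀.1.1)
  have hcomp : (Q.ofFrame (transportFrame hl x₀ hz hY t) c
      (transportFrame_pt_mem hl x₀ hz hY t)).frame =
      toLin (transport hl hz hY t) ∘ₗ (Q.ofFrame x₀ c hz).frame :=
    LinearMap.ext (transportFrame_frame hl x₀ hz hY t c)
  rw [hcomp, Submodule.map_comp, hS2]
  exact map_toLin_eq fun u => transport_mem_tangentLevel hl hz hY

end

/-- If a point of `Q_S` with frame representative `F` lies over the image of `b` under the flow, then
`F` represents the rotated frame. -/
lemma isFlowImage_ofFrame {l : ℝ} (hl : 0 < l) {E : ℝ} (hE : 2 * E = l ^ 2) {b : RedFrame K}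
    (hb : b.1 ∈ levelSet K E) {t : ℝ} {x : adaptedA} {c : Mpc 3} {hz : x.1.1 ∈ TS3}
    {hS : Q.ofFrame x c hz ∈ adaptedS K E} {d : Mpc 2}
    (h : IsFlowImage K t b (QS.ofFrame x c hz hS d).frame) :
    x.1.1 = rot l t b.1 ∧ ∀ v, ∀ u ∈ tangentLevel K b.1, b.2 v = (nullLine K b.1).mkQ u →
      (Q.ofFrame x c hz).frame (incl 2 (toLin d.g v)) - rot l t u ∈ nullLine K x.1.1 := by
  obtain ⟨hT, hY⟩ := (mem_levelSet_iff hE).1 hb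
  refine ⟨h.1.trans (flow_eq_rot hl.ne' hT hY t), fun v u hu hv => ?_⟩
  have h2 := h.2 v u hu hv
  rw [pushforward_eq_rot hl hT hY hu] at h2
  exact (Submodule.Quotient.eq _).1 h2

/-- Two points of `Q_S` over the same point of `Sp(TS/TS^⊥)` differ by an element of `U(1)`. The
element is expressed through the representatives: with `a' = a h`, `k = c⁻¹ ν̂(h) c'` and
`m = d⁻¹ ν̂(k) d'`, the element `m` of `Mpᶜ(V 2)` lies over the identity. -/
lemma exists_comparison {E : ℝ} {x x' : adaptedA} (hpt : x'.1.1 = x.1.1) {c c' : Mpc 3}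
    {hz : x.1.1 ∈ TS3} {hz' : x'.1.1 ∈ TS3} (hS : Q.ofFrame x c hz ∈ adaptedS K E)
    (hS' : Q.ofFrame x' c' hz' ∈ adaptedS K E) {d d' : Mpc 2}
    (hF : ∀ v, (Q.ofFrame x' c' hz').frame (incl 2 (toLin d'.g v)) -
      (Q.ofFrame x c hz).frame (incl 2 (toLin d.g v)) ∈ nullLine K x.1.1) :
    ∃ (h : MpcW 3) (k : MpcW 2), h.1 = x.1.2⁻¹ * x'.1.2 ∧ k.1 = c⁻¹ * (nuHat h * c') ∧
      (d⁻¹ * (nuHat k * d')).g = 1 ∧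
      QS.ofFrame x' c' hz' hS' d' = QS.ofFrame x c hz hS (nuHat k * d') := by
  have hh : (x.1.2⁻¹ * x'.1.2).g ∈ spW 3 := by
    refine mem_spW_of_map_eq (toLin_injective x.1.2.g) ?_
    rw [← toLin_mul, ← Mpc.mul_g, mul_inv_cancel_left]
    have h1 : Submodule.map (toLin x.1.2.g) (W 3) = tangentA x.1.1 := x.2.2
    have h2 : Submodule.map (toLin x'.1.2.g) (W 3) = tangentA x'.1.1 := x'.2.2
    rw [h1, h2, hpt]
  let h : MpcW 3 := ⟨x.1.2⁻¹ * x'.1.2, hh⟩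
  have hx : x'.1 = Q4.act x.1 h.1 := Prod.ext hpt (mul_inv_cancel_left _ _).symm
  have hact : Q.ofFrame x' c' hz' = Q.act (Q.ofFrame x c hz) (c⁻¹ * (nuHat h * c')) :=
    Q.ofFrame_eq_act hx (mul_inv_cancel_left _ _).symm
  have hk : (c⁻¹ * (nuHat h * c')).g ∈ spW 2 := by
    refine mem_spW_of_map_eq (Q.frame_injective (Q.ofFrame x c hz)) ?_
    rw [← Q.frame_act, ← hact, hS.2, hS'.2]
    exact congrArg (tangentLevel K) hpt
  let k : MpcW 2 := ⟨c⁻¹ * (nuHat h * c'), hk⟩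
  refine ⟨h, k, rfl, rfl, ?_, QS.ofFrame_eq hact d'⟩
  have hd : (nuHat k * d').g = d.g := by
    refine sp_ext fun v => sub_eq_zero.1 (eq_zero_of_Ω_eq_zero fun w => ?_)
    obtain ⟨s, hs⟩ := toLin_incl ⟨k.1.g, k.2⟩ (toLin d'.g v)
    have hn := adaptedS_null hS
    rw [show (Q.ofFrame x c hz).pt = x.1.1 from rfl] at hn
    have hv : toLin (nuHat k * d').g v = toLin (nu ⟨k.1.g, k.2⟩) (toLin d'.g v) :=
      toLin_mul_apply _ _ _
    have h1 : (Q.ofFrame x' c' hz').frame (incl 2 (toLin d'.g v)) =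
        (Q.ofFrame x c hz).frame (toLin k.1.g (incl 2 (toLin d'.g v))) := by
      rw [hact, Q.frame_act]
      rfl
    have h2 : (Q.ofFrame x c hz).frame (incl 2 (toLin (nuHat k * d').g v - toLin d.g v)) ∈
        nullLine K x.1.1 := by
      have h3 : (Q.ofFrame x c hz).frame (incl 2 (toLin (nuHat k * d').g v - toLin d.g v)) =
          ((Q.ofFrame x' c' hz').frame (incl 2 (toLin d'.g v)) -
            (Q.ofFrame x c hz).frame (incl 2 (toLin d.g v))) -
            s • (Q.ofFrame x c hz).frame (nullVec 2) := by
        rw [h1, hs, hv, map_sub, map_sub, map_add, map_smul]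
        abel
      rw [h3]
      exact sub_mem (hF v) (Submodule.smul_mem _ s hn)
    have h3 : Ω ((Q.ofFrame x c hz).frame (incl 2 (toLin (nuHat k * d').g v - toLin d.g v)))
        ((Q.ofFrame x c hz).frame (incl 2 w)) = 0 :=
      h2.2 _ (frame_mem_tangentLevel hS (incl_mem_W w))
    have h4 := Q4A.frame_symp (Q.ofFrame x c hz).1
      (incl 2 (toLin (nuHat k * d').g v - toLin d.g v)) (incl 2 w)
    rw [← Ω_incl, ← h4]
    exact h3
  rw [Mpc.mul_g, hd, Mpc.inv_g, inv_mul_cancel]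

/-! ### Holonomy of horizontal lifts -/

/-- A continuous complex function whose fourth power is a nonzero constant is constant. -/
lemma eq_of_pow_four_eq {f : ℝ → ℂ} (hf : Continuous f) (h0 : f 0 ≠ 0)
    (h : ∀ t, f t ^ 4 = f 0 ^ 4) (t : ℝ) : f t = f 0 := by
  have h2 : ∀ t, f t ^ 2 = f 0 ^ 2 := fun t =>
    (isPreconnected_univ (α := ℝ)).eq_of_sq_eq (f := fun t => f t ^ 2) (g := fun _ => f 0 ^ 2)
      (hf.pow 2).continuousOn continuousOn_const
      (fun t _ => by
        simp only [Pi.pow_apply]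
        rw [← pow_mul, ← pow_mul]
        exact h t) (fun _ => pow_ne_zero 2 h0) (Set.mem_univ 0) rfl (Set.mem_univ t)
  exact (isPreconnected_univ (α := ℝ)).eq_of_sq_eq (f := f) (g := fun _ => f 0)
    hf.continuousOn continuousOn_const (fun t _ => h2 t) (fun _ => h0) (Set.mem_univ 0) rfl
    (Set.mem_univ t)

lemma beta4_hamVec (z : Z) : beta4 z (hamVec z) = -(Y z ⬝ᵥ Y z) := rfl

/-- Integration of the condition that the connection one-form vanishes. -/
lemma prod_η_eq_of_halfEta {a : ℝ → Mpc 4} {c : ℝ → Mpc 3} {d : ℝ → Mpc 2}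
    (ha : Mpc.SmoothCurve a) (hc : Mpc.SmoothCurve c) (hd : Mpc.SmoothCurve d) {κ : ℝ}
    (h : ∀ t, Mpc.halfEta a t + Mpc.halfEta c t + Mpc.halfEta d t = -(Complex.I * κ)) (t : ℝ) :
    (a t).η * (c t).η * (d t).η * Circle.exp (2 * κ * t) = (a 0).η * (c 0).η * (d 0).η := by
  have hD : ∀ {m : ℕ} {b : ℝ → Mpc m}, Mpc.SmoothCurve b → ∀ t,
      HasDerivAt (fun t => ((b t).η : ℂ)) (2 * Mpc.halfEta b t * (b t).η) t := by
    intro m b hb t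
    refine ((hb.η.differentiable (by simp)) t).hasDerivAt.congr_deriv ?_
    rw [Mpc.halfEta]
    have := Circle.coe_ne_zero (b t).η
    field_simp
  have hder : ∀ t : ℝ, HasDerivAt (fun t : ℝ => ((a t).η : ℂ) * (c t).η * (d t).η *
      Complex.exp ((2 * κ * t : ℝ) * Complex.I)) 0 t := by
    intro t
    have he : HasDerivAt (fun t : ℝ => Complex.exp ((2 * κ * t : ℝ) * Complex.I))
        (Complex.exp ((2 * κ * t : ℝ) * Complex.I) * ((2 * κ : ℝ) * Complex.I)) t := by
      have h1 : HasDerivAt (fun t : ℝ => 2 * κ * t) (2 * κ) t := by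
        simpa using (hasDerivAt_id t).const_mul (2 * κ)
      exact (h1.ofReal_comp.mul_const Complex.I).cexp
    refine ((((hD ha t).mul (hD hc t)).mul (hD hd t)).mul he).congr_deriv ?_
    have ht := h t
    simp only [Pi.mul_apply]
    push_cast
    linear_combination (2 * ((a t).η : ℂ) * (c t).η * (d t).η *
      Complex.exp (2 * κ * t * Complex.I)) * ht
  have hconst := is_const_of_deriv_eq_zero (fun t => (hder t).differentiableAt)
    (fun t => (hder t).deriv) t 0
  apply Circle.ext
  simp only [Circle.coe_mul, Circle.coe_exp]
  simpa using hconst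

/-- The holonomy of a horizontal lift after a time `T` at which the geodesic flow returns. -/
theorem horizontalLift_holonomy {ħ : ℝ} {l : ℝ} (hl : 0 < l) {E : ℝ}
    (hE : 2 * E = l ^ 2) {b : RedFrame K} (hb : IsRedFrame K E b) {q : ℝ → QS K E}
    (hq : IsHorizontalLift ħ b q) {T : ℝ} (hT : Real.cos (l * T) = 1) :
    q T = (q 0).act (ofCircle (Circle.exp (-(l ^ 2 * T / ħ)))) := by
  obtain ⟨x, c, d, hz, hS, hqx, hsa, hsc, hsd, hform⟩ := hq.1.exists_ofFrame
  have hflow : ∀ t, IsFlowImage K t b (QS.ofFrame (x t) (c t) (hz t) (hS t) (d t)).frame :=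
    fun t => by
      rw [← hqx]
      exact hq.2 t
  have hbz : (x 0).1.1 = b.1 := (isFlowImage_ofFrame hl hE hb.1 (hflow 0)).1.trans (rot_zero _ _)
  have hY : Y (x 0).1.1 ⬝ᵥ Y (x 0).1.1 = l ^ 2 := by
    rw [hbz]
    exact ((mem_levelSet_iff hE).1 hb.1).2
  have hzt : ∀ t, (x t).1.1 = rot l t (x 0).1.1 := fun t => by
    rw [hbz]
    exact (isFlowImage_ofFrame hl hE hb.1 (hflow t)).1
  -- the reference curve: the frame at time `0`, transported along the geodesic
  let y : ℝ → adaptedA := transportFrame hl.ne' (x 0) (hz 0) hY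
  have hyz : ∀ t, (y t).1.1 ∈ TS3 := transportFrame_pt_mem hl.ne' (x 0) (hz 0) hY
  have hyS : ∀ t, Q.ofFrame (y t) (c 0) (hyz t) ∈ adaptedS K E :=
    transportFrame_mem_adaptedS hl.ne' (x 0) (hz 0) hY hE (hS 0)
  have hF : ∀ t v, (Q.ofFrame (x t) (c t) (hz t)).frame (incl 2 (toLin (d t).g v)) -
      (Q.ofFrame (y t) (c 0) (hyz t)).frame (incl 2 (toLin (d 0).g v)) ∈
        nullLine K (y t).1.1 := by
    intro t v
    have hv : b.2 v ∈ Submodule.map (nullLine K b.1).mkQ (tangentLevel K b.1) := by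
      rw [← hb.2.1]
      exact LinearMap.mem_range_self _ _
    obtain ⟨u, hu, hub⟩ := hv
    have h1 := (isFlowImage_ofFrame hl hE hb.1 (hflow t)).2 v u hu hub.symm
    have h0 := (isFlowImage_ofFrame hl hE hb.1 (hflow 0)).2 v u hu hub.symm
    rw [rot_zero] at h0
    have h2 := rot_mem_nullLine hl.ne' (hz 0) h0 t
    have hmem : (Q.ofFrame (x 0) (c 0) (hz 0)).frame (incl 2 (toLin (d 0).g v)) ∈
        tangentLevel K (x 0).1.1 := frame_mem_tangentLevel (hS 0) (incl_mem_W _)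
    have h3 : (Q.ofFrame (y t) (c 0) (hyz t)).frame (incl 2 (toLin (d 0).g v)) =
        rot l t ((Q.ofFrame (x 0) (c 0) (hz 0)).frame (incl 2 (toLin (d 0).g v))) :=
      (transportFrame_frame hl.ne' (x 0) (hz 0) hY t (c 0) _).trans
        (transport_eq_rot hl.ne' (hz 0) hY t hmem)
    have hyt : (y t).1.1 = rot l t (x 0).1.1 := rfl
    rw [hzt] at h1
    rw [h3, hyt]
    have h4 := sub_mem h1 h2
    rwa [map_sub, sub_sub_sub_cancel_right] at h4
  choose h k hh hk hm hqy using fun t => exists_comparison (hzt t : (x t).1.1 = (y t).1.1)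
    (hyS t) (hS t) (hF t)
  choose u hu hu' using fun t => Mpc.eq_ofCircle (hm t) (basePt 2)
  have hqu : ∀ t, q t = (QS.ofFrame (y t) (c 0) (hyz t) (hyS t) (d 0)).act (ofCircle (u t)) := by
    intro t
    rw [hqx, hqy, ← hu]
    exact congrArg (QS.ofFrame (y t) (c 0) (hyz t) (hyS t)) (mul_inv_cancel_left _ _).symm
  -- `u` is continuous
  have hcy : Mpc.ContCurve fun t => (y t).1.2 :=
    (smoothCurve_transportMpc hl.ne' (hz 0) hY).contCurve.mul (Mpc.ContCurve.const _)
  have hch : Mpc.ContCurve fun t => (h t).1 := by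
    simp only [hh]
    exact hcy.inv.mul hsa.contCurve
  have hck : Mpc.ContCurve fun t => (k t).1 := by
    simp only [hk]
    exact (Mpc.ContCurve.const _).mul (hch.nuHat.mul hsc.contCurve)
  have hcm : Mpc.ContCurve fun t => (d 0)⁻¹ * (nuHat (k t) * d t) :=
    (Mpc.ContCurve.const _).mul (hck.nuHat.mul hsd.contCurve)
  have hcu : Continuous fun t => (u t : ℂ) := by
    simp only [hu']
    exact hcm.apply continuous_const
  -- in the fourth power of `u` the signs of the corner entries disappear
  have hu4 : ∀ t, u t ^ 4 = (((x 0).1.2.η * (c 0).η * (d 0).η)⁻¹ *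
      ((x t).1.2.η * (c t).η * (d t).η)) ^ 2 := by
    intro t
    have e1 : u t ^ 2 = (d 0).η⁻¹ * ((nuHat (k t)).η * (d t).η) :=
      (congrArg Mpc.η (hu t)).symm
    have e2 : (k t).1.η = (c 0).η⁻¹ * ((nuHat (h t)).η * (c t).η) := congrArg Mpc.η (hk t)
    have e3 : (h t).1.η = ((y t).1.2.η)⁻¹ * (x t).1.2.η := congrArg Mpc.η (hh t)
    have e4 : (y t).1.2.η = (x 0).1.2.η := by
      change (transportMpc hl.ne' (hz 0) hY t).η * (x 0).1.2.η = _
      rw [transportMpc_η, one_mul]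
    rw [show u t ^ 4 = (u t ^ 2) ^ 2 by rw [← pow_mul], e1, mul_pow, mul_pow, nuHat_η_sq, e2,
      mul_pow, mul_pow, nuHat_η_sq, e3, e4]
    simp only [mul_pow, mul_inv, inv_pow]
    ac_rfl
  have hhalf : ∀ t, Mpc.halfEta (fun s => (x s).1.2) t + Mpc.halfEta c t + Mpc.halfEta d t =
      -(Complex.I * ((l ^ 2 / ħ : ℝ) : ℂ)) := by
    intro t
    have h1 := hform t
    have h2 : (fun s => (x s).1.1) = fun s => rot l s (x 0).1.1 := funext hzt
    rw [h2, (hasDerivAt_rot hl.ne' (hz 0) hY t).deriv, hzt t, beta4_hamVec,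
      Y_rot_self (hz 0) hY] at h1
    have h3 : (1 / (Complex.I * ħ)) * ((-(l ^ 2) : ℝ) : ℂ) =
        Complex.I * ((l ^ 2 / ħ : ℝ) : ℂ) := by
      push_cast
      rw [one_div, mul_inv, Complex.inv_I]
      ring
    rw [h3] at h1
    linear_combination h1
  have hη := prod_η_eq_of_halfEta hsa hsc hsd hhalf
  have hconst := eq_of_pow_four_eq (f := fun t => (u t : ℂ) * Circle.exp (l ^ 2 / ħ * t))
    (hcu.mul (by fun_prop)) (mul_ne_zero (Circle.coe_ne_zero _) (Circle.coe_ne_zero _))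
    (fun t => by
      have h1 : ∀ t, (u t * Circle.exp (l ^ 2 / ħ * t)) ^ 4 = 1 := fun t => by
        have h2 : Circle.exp (l ^ 2 / ħ * t) ^ 4 = Circle.exp (2 * (l ^ 2 / ħ) * t) ^ 2 := by
          rw [← Circle.exp_nsmul, ← Circle.exp_nsmul]
          congr 1
          simp only [nsmul_eq_mul]
          push_cast
          ring
        rw [mul_pow, hu4, h2, ← mul_pow, mul_assoc, hη, inv_mul_cancel, one_pow]
      have h3 := congrArg (fun w : Circle => (w : ℂ)) ((h1 t).trans (h1 0).symm)
      simpa only [Circle.coe_pow, Circle.coe_mul] using h3) T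
  have huT : u T = u 0 * Circle.exp (-(l ^ 2 * T / ħ)) := by
    have h1 : u T * Circle.exp (l ^ 2 / ħ * T) = u 0 := by
      apply Circle.ext
      have := hconst
      simp only [mul_zero, Circle.exp_zero, Circle.coe_one, mul_one] at this
      rw [Circle.coe_mul]
      exact this
    rw [← h1, mul_assoc, ← Circle.exp_add]
    have : l ^ 2 / ħ * T + -(l ^ 2 * T / ħ) = 0 := by ring
    rw [this, Circle.exp_zero, mul_one]
  have hyT : y T = y 0 := (transportFrame_of_cos_eq_one hl.ne' (x 0) (hz 0) hY hT).trans
    (transportFrame_of_cos_eq_one hl.ne' (x 0) (hz 0) hY (by simp)).symm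
  have hcongr : ∀ (x x' : adaptedA) (_ : x = x') (hz : x.1.1 ∈ TS3) (hz' : x'.1.1 ∈ TS3)
      (hS : Q.ofFrame x (c 0) hz ∈ adaptedS K E) (hS' : Q.ofFrame x' (c 0) hz' ∈ adaptedS K E),
      QS.ofFrame x (c 0) hz hS (d 0) = QS.ofFrame x' (c 0) hz' hS' (d 0) := by
    rintro x _ rfl _ _ _ _
    rfl
  rw [hqu T, hqu 0, QS.act_mul, ← ofCircle_mul, ← huT]
  exact congrArg (fun p => QS.act p (ofCircle (u T))) (hcongr _ _ hyT _ _ _ _)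

/-! ### Existence of a horizontal lift -/

/-- Along a transported frame, the phase `exp(-i l² t / ħ)` gives a horizontal lift. -/
lemma isHorizontalLift_transportFrame {ħ l : ℝ} (hl : 0 < l) {E : ℝ} (hE : 2 * E = l ^ 2)
    {x : adaptedA} {c : Mpc 3} (hz : x.1.1 ∈ TS3) (hY : Y x.1.1 ⬝ᵥ Y x.1.1 = l ^ 2)
    (hS : Q.ofFrame x c hz ∈ adaptedS K E) (hx : x.1.2.g • basePt 4 = basePt 4) :
    IsHorizontalLift ħ (QS.ofFrame x c hz hS 1).frame fun t =>
      QS.ofFrame (transportFrame hl.ne' x hz hY t) c (transportFrame_pt_mem hl.ne' x hz hY t)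
        (transportFrame_mem_adaptedS hl.ne' x hz hY hE hS t)
        (ofCircle (Circle.exp (-(l ^ 2 * t / ħ)))) := by
  have hsG := smoothCurve_transportMpc hl.ne' hz hY
  have hphase : ∀ t : ℝ, (((ofCircle (Circle.exp (-(l ^ 2 * t / ħ))) : Mpc 2).η : Circle) : ℂ) =
      Complex.exp ((-(2 * l ^ 2 / ħ) * t : ℝ) * Complex.I) := fun t => by
    rw [ofCircle_η, ← Circle.exp_nsmul, Circle.coe_exp]
    congr 3
    simp only [nsmul_eq_mul]
    push_cast
    ring
  have hη0 : ∀ {m : ℕ} {b : ℝ → Mpc m} {η : Circle}, (∀ t, (b t).η = η) →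
      ∀ t, Mpc.halfEta b t = 0 := by
    intro m b η hb t
    simp [Mpc.halfEta, hb]
  refine ⟨⟨fun t => ⟨Q.ofFrame (transportFrame hl.ne' x hz hY t) c
      (transportFrame_pt_mem hl.ne' x hz hY t), transportFrame_mem_adaptedS hl.ne' x hz hY hE hS t⟩,
    fun t => ofCircle (Circle.exp (-(l ^ 2 * t / ħ))),
    fun _ => Complex.I * ((l ^ 2 / ħ : ℝ) : ℂ), fun t => rfl,
    ⟨transportFrame hl.ne' x hz hY, fun _ => c, fun _ => Complex.I * ((l ^ 2 / ħ : ℝ) : ℂ),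
      fun t => rfl, ⟨?_, ⟨?_, ?_⟩, fun t => ?_⟩, ⟨fun i j => contDiff_const, contDiff_const⟩,
      fun t => ?_⟩, ⟨fun i j => contDiff_const, ?_⟩, fun t => ?_⟩, fun t => ⟨?_, fun v u hu hv => ?_⟩⟩
  · have hm : ContDiff ℝ ∞ fun t : ℝ => l * t := contDiff_const.mul contDiff_id
    refine contDiff_pi.2 fun i => ?_
    rcases i with j | j
    · exact (hm.cos.mul contDiff_const).add ((hm.sin.div_const _).mul contDiff_const)
    · exact ((contDiff_const.mul hm.sin).neg.mul contDiff_const).add (hm.cos.mul contDiff_const)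
  · intro i j
    change ContDiff ℝ ∞ fun t => ((transportMpc hl.ne' hz hY t).g.1 * x.1.2.g.1) i j
    simp only [Matrix.mul_apply]
    exact ContDiff.sum fun k _ => (hsG.1 i k).mul contDiff_const
  · change ContDiff ℝ ∞ fun t => (transportMpc hl.ne' hz hY t).φ (x.1.2.g • basePt 4) *
      x.1.2.φ (basePt 4)
    rw [hx]
    exact hsG.2.mul contDiff_const
  · have h1 : Mpc.halfEta (fun s => (transportFrame hl.ne' x hz hY s).1.2) t = 0 :=
      hη0 (η := x.1.2.η) (fun t => by
        change (transportMpc hl.ne' hz hY t).η * x.1.2.η = _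
        rw [transportMpc_η, one_mul]) t
    rw [h1, add_zero]
    change _ = (1 / (Complex.I * ħ)) *
      (beta4 (rot l t x.1.1) (deriv (fun s => rot l s x.1.1) t) : ℝ)
    rw [(hasDerivAt_rot hl.ne' hz hY t).deriv, beta4_hamVec, Y_rot_self hz hY]
    push_cast
    rw [one_div, mul_inv, Complex.inv_I]
    ring
  · rw [hη0 (fun _ => rfl), add_zero]
  · simp only [ofCircle_φ, Circle.coe_exp]
    exact ContDiff.cexp ((Complex.ofRealCLM.contDiff.comp
      ((contDiff_const.mul contDiff_id).div_const ħ).neg).mul contDiff_const)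
  · have h1 : HasDerivAt (fun t : ℝ => Complex.exp ((-(2 * l ^ 2 / ħ) * t : ℝ) * Complex.I))
        (Complex.exp ((-(2 * l ^ 2 / ħ) * t : ℝ) * Complex.I) *
          ((-(2 * l ^ 2 / ħ) : ℝ) * Complex.I)) t := by
      have h1 : HasDerivAt (fun t : ℝ => -(2 * l ^ 2 / ħ) * t) (-(2 * l ^ 2 / ħ)) t := by
        simpa using (hasDerivAt_id t).const_mul (-(2 * l ^ 2 / ħ))
      exact (h1.ofReal_comp.mul_const Complex.I).cexp
    rw [Mpc.halfEta]
    simp only [hphase]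
    rw [h1.deriv, mul_div_cancel_left₀ _ (Complex.exp_ne_zero _)]
    push_cast
    ring
  · exact (flow_eq_rot hl.ne' hz hY t).symm
  · have hu' : u ∈ tangentLevel K x.1.1 := hu
    have hp : pushforward K t x.1.1 u = rot l t u := pushforward_eq_rot hl hz hY hu' t
    have h1 : (Q.ofFrame x c hz).frame (incl 2 (toLin 1 v)) - u ∈ nullLine K x.1.1 :=
      (Submodule.Quotient.eq _).1 hv
    have h2 := rot_mem_nullLine hl.ne' hz h1 t
    refine (Submodule.Quotient.eq _).2 ?_
    change (Q.ofFrame (transportFrame hl.ne' x hz hY t) c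
      (transportFrame_pt_mem hl.ne' x hz hY t)).frame (incl 2 (toLin 1 v)) -
      pushforward K t x.1.1 u ∈ nullLine K (rot l t x.1.1)
    rw [hp, transportFrame_frame, transport_eq_rot hl.ne' hz hY t
      (frame_mem_tangentLevel hS (incl_mem_W _)), ← map_sub]
    exact h2

/-- The partial Fourier transform in the fourth pair of coordinates:
`(x₄, y₄) ↦ (-y₄, x₄)`, identity on the other coordinates. -/
def partialFourier : Sp 4 :=
  ⟨fromBlocks (diagonal ![1, 1, 1, 0]) (-diagonal ![0, 0, 0, 1]) (diagonal ![0, 0, 0, 1])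
    (diagonal ![1, 1, 1, 0]), by
    rw [SymplecticGroup.fromBlocks_mem_iff]
    simp only [diagonal_transpose, transpose_neg, neg_mul, mul_neg, diagonal_mul_diagonal,
      sub_neg_eq_add, diagonal_add, mul_comm, true_and]
    rw [← diagonal_one]
    congr 1
    ext i
    fin_cases i <;> simp⟩

lemma toLin_partialFourier (u : Z) : toLin partialFourier u =
    Sum.elim ![X u 0, X u 1, X u 2, -Y u 3] ![Y u 0, Y u 1, Y u 2, X u 3] := by
  ext i
  rcases i with i | i <;> fin_cases i <;>
    simp [toLin, partialFourier, Matrix.mulVec, dotProduct, Fintype.sum_sum_type,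
      X, Y, diagonal_apply]

lemma partialFourier_smul_basePt : partialFourier • basePt 4 = basePt 4 := by
  apply Subtype.ext
  have hD : IsUnit (den partialFourier (basePt 4).1).det := (det_den_ne_zero _ _).isUnit
  have h : num partialFourier (basePt 4).1 = (basePt 4).1 * den partialFourier (basePt 4).1 := by
    ext i j
    by_cases hij : i = j
    · subst hij
      fin_cases i <;> simp [num, den, basePt, cplx, partialFourier, toBlocks₁₁, toBlocks₁₂,
        toBlocks₂₁, toBlocks₂₂]
    · simp [num, den, basePt, cplx, partialFourier, toBlocks₁₁, toBlocks₁₂,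
        toBlocks₂₁, toBlocks₂₂, hij]
  rw [coe_smul, h, Matrix.mul_assoc, Matrix.mul_nonsing_inv _ hD, Matrix.mul_one]

/-- The point of `TS³` at the fourth unit vector, with velocity `l` times the third one. -/
def stdPt (l : ℝ) : Z := Sum.elim ![0, 0, 0, 1] ![0, 0, l, 0]

lemma stdPt_mem (l : ℝ) : stdPt l ∈ TS3 := by
  constructor <;> simp [stdPt, X_elim, Y_elim, dotProduct, Fin.sum_univ_four]

lemma stdPt_speed (l : ℝ) : Y (stdPt l) ⬝ᵥ Y (stdPt l) = l ^ 2 := by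
  simp [stdPt, Y_elim, dotProduct, Fin.sum_univ_four, sq]

lemma exists_partialFourierMpc : ∃ a : Mpc 4, a.g = partialFourier := by
  obtain ⟨a, ha, -⟩ := Mpc.exists_lift partialFourier (basePt 4)
    (Complex.cpow_nat_inv_pow (den partialFourier (basePt 4).1).det two_ne_zero)
  exact ⟨a, ha⟩

lemma map_partialFourier (l : ℝ) :
    Submodule.map (toLin partialFourier) (W 3) = tangentA (stdPt l) := by
  refine map_toLin_eq fun u => ?_
  rw [mem_tangentA, toLin_partialFourier, X_elim]
  have hW : u ∈ W 3 ↔ Y u 3 = 0 := Iff.rfl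
  rw [hW]
  simp [stdPt, X_elim, dotProduct, Fin.sum_univ_four]

lemma stdFrame_apply (l : ℝ) (v : V 3) :
    fderiv ℝ orbitProj (stdPt l) (toLin partialFourier (incl 3 v)) =
      Sum.elim ![v (Sum.inl 0), v (Sum.inl 1), v (Sum.inl 2), 0]
        ![v (Sum.inr 0), v (Sum.inr 1), v (Sum.inr 2), -(l * v (Sum.inl 2))] := by
  obtain ⟨h1, h2, h3, h4⟩ := incl_apply v
  have e1 : ∀ j : Fin 3, X (incl 3 v) j.castSucc = v (Sum.inl j) := h1
  have e2 : ∀ j : Fin 3, Y (incl 3 v) j.castSucc = v (Sum.inr j) := h2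
  have e3 : X (incl 3 v) 3 = 0 := h3
  have e4 : Y (incl 3 v) 3 = 0 := h4
  have a0 := e1 0
  have a1 := e1 1
  have a2 := e1 2
  have b0 := e2 0
  have b1 := e2 1
  have b2 := e2 2
  simp only [Fin.castSucc_zero, Fin.castSucc_one] at a0 a1 b0 b1
  change X (incl 3 v) 2 = _ at a2
  change Y (incl 3 v) 2 = _ at b2
  rw [fderiv_orbitProj, toLin_partialFourier, (stdPt_mem l).2, a0, a1, a2, b0, b1, b2, e3, e4,
    X_elim, Y_elim]
  ext i
  rcases i with i | i <;> fin_cases i <;>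
    simp [stdPt, X_elim, Y_elim, dotProduct, Fin.sum_univ_four, mul_comm]

/-- Every positive energy has a point of `Q_S` over a frame fixing the base point of the Siegel half
space. -/
lemma exists_adapted {l : ℝ} (hl : 0 < l) {E : ℝ} (hE : 2 * E = l ^ 2) :
    ∃ (x : adaptedA) (hz : x.1.1 ∈ TS3), Y x.1.1 ⬝ᵥ Y x.1.1 = l ^ 2 ∧
      Q.ofFrame x 1 hz ∈ adaptedS K E ∧ x.1.2.g • basePt 4 = basePt 4 := by
  obtain ⟨a, ha⟩ := exists_partialFourierMpc
  have hA : ((stdPt l, a) : Q4) ∈ adaptedA := by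
    refine ⟨?_, ?_⟩
    · change (1 / 2) * _ = 1 / 2
      rw [(stdPt_mem l).1, mul_one]
    · change Submodule.map (toLin a.g) (W 3) = _
      rw [ha]
      exact map_partialFourier l
  have hfr : ∀ v, (Q.ofFrame ⟨_, hA⟩ 1 (stdPt_mem l)).frame v =
      Sum.elim ![v (Sum.inl 0), v (Sum.inl 1), v (Sum.inl 2), 0]
        ![v (Sum.inr 0), v (Sum.inr 1), v (Sum.inr 2), -(l * v (Sum.inl 2))] := fun v => by
    rw [Q.ofFrame_frame, Mpc.one_g, toLin_one_apply, ← stdFrame_apply l]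
    change fderiv ℝ orbitProj (stdPt l) (toLin a.g _) = _
    rw [ha]
  have hlev : ∀ u, u ∈ tangentLevel K (stdPt l) ↔
      (X u 3 = 0 ∧ X u 2 * l + Y u 3 = 0) ∧ l * Y u 2 = 0 := fun u => by
    rw [mem_tangentLevel]
    simp [stdPt, X_elim, Y_elim, dotProduct, Fin.sum_univ_four]
  refine ⟨⟨_, hA⟩, stdPt_mem l, stdPt_speed l,
    ⟨(mem_levelSet_iff hE).2 ⟨stdPt_mem l, stdPt_speed l⟩, ?_⟩, ?_⟩
  · change _ = tangentLevel K (stdPt l)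
    apply le_antisymm
    · rintro _ ⟨v, hv, rfl⟩
      have hv2 : v (Sum.inr 2) = 0 := hv
      rw [hfr, hlev]
      simp [X_elim, Y_elim, hv2, mul_comm]
    · intro u hu
      obtain ⟨⟨h1, h2⟩, h3⟩ := (hlev u).1 hu
      have h4 : Y u 2 = 0 := (mul_eq_zero.1 h3).resolve_left hl.ne'
      refine ⟨Sum.elim ![X u 0, X u 1, X u 2] ![Y u 0, Y u 1, Y u 2], ?_, ?_⟩
      · exact h4
      · rw [hfr]
        apply Z_ext
        · ext i
          fin_cases i <;> simp [X_elim, h1]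
        · ext i
          fin_cases i <;> simp [Y_elim]
          linarith
  · change a.g • basePt 4 = _
    rw [ha]
    exact partialFourier_smul_basePt

lemma isFlowImage_self {l : ℝ} (hl : 0 < l) {E : ℝ} (hE : 2 * E = l ^ 2) {b : RedFrame K}
    (hb : IsRedFrame K E b) {T : ℝ} (hT : Real.cos (l * T) = 1) : IsFlowImage K T b b := by
  obtain ⟨hz, hY⟩ := (mem_levelSet_iff hE).1 hb.1
  refine ⟨?_, fun v u hu hv => ?_⟩
  · rw [flow_eq_rot hl.ne' hz hY, rot_of_cos_eq_one hT]
  · rw [pushforward_eq_rot hl hz hY hu, rot_of_cos_eq_one hT, hv]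

lemma cos_eq_one_of_isFlowImage_self {l : ℝ} (hl : 0 < l) {E : ℝ} (hE : 2 * E = l ^ 2)
    {b : RedFrame K} (hb : IsRedFrame K E b) {T : ℝ} (hT : IsFlowImage K T b b) :
    Real.cos (l * T) = 1 := by
  obtain ⟨hz, hY⟩ := (mem_levelSet_iff hE).1 hb.1
  have h := hT.1
  rw [flow_eq_rot hl.ne' hz hY] at h
  have h1 : X b.1 ⬝ᵥ X b.1 = X b.1 ⬝ᵥ X (rot l T b.1) := by rw [← h]
  rw [X_rot, dotProduct_add, dotProduct_smul, dotProduct_smul, hz.1, hz.2] at h1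
  simpa using h1.symm

lemma isRegularValue_K {E : ℝ} (hE : 0 < E) : IsRegularValue K E := by
  rintro z ⟨hz, hK⟩
  have hY : Y z ⬝ᵥ Y z = 2 * E := by
    rw [← hK, K]
    ring
  refine ⟨Sum.elim (0 : Fin 4 → ℝ) (Y z), mem_tangentTS3.2 ?_, ?_⟩
  · simp [X_elim, Y_elim, hz.2]
  · rw [fderiv_K, Y_elim, hY]
    positivity

/-- Quantization of the positive energies. -/
lemma isQuantizedEnergy_iff {ħ : ℝ} (hħ : 0 < ħ) {l : ℝ} (hl : 0 < l) {E : ℝ}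
    (hE : 2 * E = l ^ 2) : IsQuantizedEnergy ħ K E ↔ ∃ n : ℕ, 0 < n ∧ l = n * ħ := by
  constructor
  · rintro ⟨-, h⟩
    obtain ⟨x, hz, hY, hS, hx⟩ := exists_adapted hl hE
    have hq := isHorizontalLift_transportFrame (ħ := ħ) hl hE hz hY hS hx
    have hT : Real.cos (l * (2 * Real.pi / l)) = 1 := by
      rw [mul_div_cancel₀ _ hl.ne', Real.cos_two_pi]
    have hb := QS.isRedFrame (QS.ofFrame x 1 hz hS 1)
    have h1 := h _ hb _ (by positivity) (isFlowImage_self hl hE hb hT) _ hq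
    rw [horizontalLift_holonomy hl hE hb hq hT] at h1
    have h2 : Circle.exp (-(l ^ 2 * (2 * Real.pi / l) / ħ)) = 1 :=
      ofCircle_injective ((QS.eq_one_of_act_eq h1).trans ofCircle_one.symm)
    obtain ⟨m, hm⟩ := Circle.exp_eq_one.1 h2
    have hm' : l = (-m : ℤ) * ħ := by
      have hpi := Real.pi_pos
      field_simp at hm
      push_cast
      nlinarith
    have hpos : 0 < -m := by
      have : (0 : ℝ) < ((-m : ℤ) : ℝ) := by
        by_contra hneg
        have := mul_nonpos_of_nonpos_of_nonneg (not_lt.1 hneg) hħ.le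
        linarith
      exact_mod_cast this
    refine ⟨(-m).toNat, by omega, ?_⟩
    rw [hm']
    congr 1
    exact_mod_cast (Int.toNat_of_nonneg hpos.le).symm
  · rintro ⟨n, -, hn⟩
    have hE0 : 0 < E := by nlinarith [sq_pos_of_pos hl]
    refine ⟨isRegularValue_K hE0, fun b hb T _ hTb q hq => ?_⟩
    have hT := cos_eq_one_of_isFlowImage_self hl hE hb hTb
    obtain ⟨k, hk⟩ := (Real.cos_eq_one_iff _).1 hT
    have h1 : Circle.exp (-(l ^ 2 * T / ħ)) = 1 := by
      refine Circle.exp_eq_one.2 ⟨-(n * k), ?_⟩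
      have : l ^ 2 * T / ħ = n * (l * T) := by
        rw [hn]
        field_simp
      rw [this, ← hk]
      push_cast
      ring
    rw [horizontalLift_holonomy hl hE hb hq hT, h1, ofCircle_one]
    exact Assoc.act_one _

end MpcQuant

end

theorem mainTheorem2 (ħ : ℝ) (hħ : 0 < ħ) :
    {E : ℝ | 0 < E ∧ MpcQuant.IsQuantizedEnergy ħ MpcQuant.K E} =
        {E : ℝ | ∃ n : ℕ, 0 < n ∧ E = (n : ℝ) ^ 2 * ħ ^ 2 / 2} ∧
      ∀ E : ℝ, 0 < E → ∀ b : MpcQuant.RedFrame MpcQuant.K, MpcQuant.IsRedFrame MpcQuant.K E b →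
        MpcQuant.IsFlowImage MpcQuant.K (2 * Real.pi / Real.sqrt (2 * E)) b b ∧
        ∀ q : ℝ → MpcQuant.QS MpcQuant.K E, MpcQuant.IsHorizontalLift ħ b q →
          q (2 * Real.pi / Real.sqrt (2 * E)) =
            (q 0).act (MpcQuant.ofCircle
              (Circle.exp (-(Real.sqrt (2 * E) ^ 2 * (2 * Real.pi / Real.sqrt (2 * E)) / ħ)))) := by
  have hsq : ∀ E : ℝ, 0 < E → 0 < Real.sqrt (2 * E) ∧ 2 * E = Real.sqrt (2 * E) ^ 2 :=
    fun E hE => ⟨Real.sqrt_pos.2 (by linarith), (Real.sq_sqrt (by linarith)).symm⟩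
  refine ⟨?_, fun E hE b hb => ?_⟩
  · ext E
    constructor
    · rintro ⟨hE, hQ⟩
      obtain ⟨hl, hE2⟩ := hsq E hE
      obtain ⟨n, hn, h⟩ := (MpcQuant.isQuantizedEnergy_iff hħ hl hE2).1 hQ
      refine ⟨n, hn, ?_⟩
      rw [h] at hE2
      linarith
    · rintro ⟨n, hn, rfl⟩
      have hn' : (0 : ℝ) < n := Nat.cast_pos.2 hn
      refine ⟨by positivity, (MpcQuant.isQuantizedEnergy_iff hħ (l := n * ħ) (by positivity)
        (by ring)).2 ⟨n, hn, rfl⟩⟩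
  · obtain ⟨hl, hE2⟩ := hsq E hE
    have hT : Real.cos (Real.sqrt (2 * E) * (2 * Real.pi / Real.sqrt (2 * E))) = 1 := by
      rw [mul_div_cancel₀ _ hl.ne', Real.cos_two_pi]
    exact ⟨MpcQuant.isFlowImage_self hl hE2 hb hT,
      fun q hq => MpcQuant.horizontalLift_holonomy hl hE2 hb hq hT⟩
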